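/- Let $N\ge 1$ be an integer and $\omega\in\mathbb{C}$ a primitive $N$-th root of unity; write $\mathbb{Z}_N=\mathbb{Z}/N\mathbb{Z}$, and $\omega^a$ for $a\in\mathbb{Z}_N$. **The algebra.** Let $A=C(S_N^+(R))$ be the universal unital $C^*$-algebra with generators $q_{ij}$, $i,j\in\mathbb{Z}_N$, subject to the relations (for all $i,j,k\in\mathbb{Z}_N$) 1. $q_{0i}=q_{i0}=\delta_{i0}$; 2. $q_{ij}^*=\omega^{-i(i-j)}\,q_{-i,-j}$; 3. $q_{k,i+j}=\sum_{l\in\mathbb{Z}_N}\omega^{-l(i-k+l)}\,q_{k-l,i}\,q_{lj}$; 4. $q_{i+j,k}=\sum_{l\in\mathbb{Z}_N}\omega^{-i(l-j)}\,q_{jl}\,q_{i,k-l}$; that is, the completion of the universal unital $*$-algebra with these generators and relations in its largest $C^*$-seminorm. It is a $\mathbb{Z}_N$-$C^*$-algebra (a unital $C^*$-algebra with a coaction of $C(\mathbb{Z}_N)$ satisfying the Podleś condition) for the coaction $\rho:A\to A\otimes C(\mathbb{Z}_N)=C(\mathbb{Z}_N,A)$, $\rho_t(q_{ij})=\omega^{t(j-i)}q_{ij}$.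 **Braided tensor products.** A faithful equivariant representation of a $\mathbb{Z}_N$-$C^*$-algebra $(X,\rho)$ is a Hilbert space $\mathcal{L}$ with a unitary representation $U$ of $\mathbb{Z}_N$ and an injective unital $*$-homomorphism $\pi:X\to\mathbb{B}(\mathcal{L})$ with $\pi(\rho_t(x))=U_t\pi(x)U_t^*$. A vector $v$ has degree $m\in\mathbb{Z}_N$ if $U_tv=\omega^{tm}v$ for all $t$. Given such representations of $X$ on $\mathcal{L}$ and of $Y$ on $\mathcal{K}$, let $c:\mathcal{L}\otimes\mathcal{K}\to\mathcal{K}\otimes\mathcal{L}$ be the unitary with $c(v\otimes w)=\omega^{mn}\,w\otimes v$ for $v$ of degree $m$ and $w$ of degree $n$, and let $c'=c^{-1}$, so that $c'(w\otimes v)=\omega^{-mn}\,v\otimes w$. Put $j_1(x)=\pi_X(x)\otimes 1$ and $j_2(y)=c'(\pi_Y(y)\otimes 1)c$. The braided tensor product $X\boxtimes_R Y$ is the $C^*$-subalgebra of $\mathbb{B}(\mathcal{L}\otimes\mathcal{K})$ generated by all $j_1(x)j_2(y)$, with the unique coaction for which $j_1$ and $j_2$ are equivariant (implemented by the diagonal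 representation of $\mathbb{Z}_N$ on $\mathcal{L}\otimes\mathcal{K}$). Iterated braided tensor products are formed in these representations. For equivariant unital $*$-homomorphisms $f,g$, the map $f\boxtimes_R g$ is the equivariant unital $*$-homomorphism with $j_1(x)j_2(y)\mapsto j_1(f(x))j_2(g(y))$. **Theorem.** The $\mathbb{Z}_N$-$C^*$-algebra $(A,\rho)$ has a faithful equivariant representation on some Hilbert space. For every such representation, with $A\boxtimes_R A$ formed in it, there is a unique unital $*$-homomorphism $$\Delta: A\longrightarrow A\boxtimes_R A\qquad\text{with}\qquad \Delta(q_{ij})=\sum_{k\in\mathbb{Z}_N}j_1(q_{ik})\,j_2(q_{kj})\quad(i,j\in\mathbb{Z}_N).$$ Moreover: * $\Delta$ is $\mathbb{Z}_N$-equivariant; * $\Delta$ is coassociative: the maps $\Delta\boxtimes_R\mathrm{id}_A$ and $\mathrm{id}_A\boxtimes_R\Delta$ exist, and so does the canonical isomorphism $(A\boxtimes_R A)\boxtimes_R A\cong A\boxtimes_R(A\boxtimes_R A)$ that respects the three embeddings of $A$, and $(\Delta\boxtimes_R\mathrm{id}_A)\circ\Delta=(\mathrm{id}_A\boxtimes_R\Delta)\circ\Delta$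 under it; * $\Delta$ is bisimplifiable: the closed linear span of $\{\Delta(x)j_2(y): x,y\in A\}$ and the closed linear span of $\{\Delta(x)j_1(y): x,y\in A\}$ are both equal to $A\boxtimes_R A$. Thus $S_N^+(R)=(A,\rho,\Delta)$ is an anyonic compact quantum group for every primitive $N$-th root of unity $\omega$. -/

import Mathlib

namespace Anyonic

/-! ### The free unital `*`-algebra -/

/-- The free unital `*`-algebra over `ℂ` on a set `X`: the free algebra on letters
`x = (x, false)` and `x* = (x, true)`. -/
def FreeStarAlgebra (X : Type*) : Type _ := FreeAlgebra ℂ (X × Bool)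

namespace FreeStarAlgebra

variable {X : Type*}

noncomputable instance : Ring (FreeStarAlgebra X) := inferInstanceAs (Ring (FreeAlgebra ℂ (X × Bool)))

noncomputable instance : Algebra ℂ (FreeStarAlgebra X) :=
  inferInstanceAs (Algebra ℂ (FreeAlgebra ℂ (X × Bool)))

/-- The letters. -/
noncomputable def letter (a : X × Bool) : FreeStarAlgebra X := FreeAlgebra.ι ℂ a

/-- The free generators. -/
noncomputable def gen (x : X) : FreeStarAlgebra X := letter (x, false)

/-- The opposite algebra with conjugate scalars; the involution is an algebra map into it. -/
def ConjOp (X : Type*) : Type _ := (FreeStarAlgebra X)ᵐᵒᵖ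

noncomputable instance : Ring (ConjOp X) := inferInstanceAs (Ring (FreeStarAlgebra X)ᵐᵒᵖ)

noncomputable instance : Algebra ℂ (ConjOp X) :=
  RingHom.toAlgebra' ((algebraMap ℂ (FreeStarAlgebra X)ᵐᵒᵖ).comp (starRingEnd ℂ))
    (fun c x => Algebra.commutes (A := (FreeStarAlgebra X)ᵐᵒᵖ) (starRingEnd ℂ c) x)

/-- The involution as an algebra map: it swaps `x` and `x*`, reverses words, and conjugates
scalars. -/
noncomputable def starAux : FreeStarAlgebra X →ₐ[ℂ] ConjOp X :=
  FreeAlgebra.lift ℂ (fun a : X × Bool => (MulOpposite.op (letter (a.1, !a.2)) : ConjOp X))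

noncomputable instance : Star (FreeStarAlgebra X) where
  star x := MulOpposite.unop (α := FreeStarAlgebra X) (starAux x)

theorem star_def (x : FreeStarAlgebra X) :
    star x = MulOpposite.unop (α := FreeStarAlgebra X) (starAux x) := rfl

theorem star_letter (a : X × Bool) : star (letter a) = letter (a.1, !a.2) := by
  rw [star_def, starAux, letter]
  exact congrArg _ (FreeAlgebra.lift_ι_apply _ _)

theorem star_algebraMap' (c : ℂ) :
    star (algebraMap ℂ (FreeStarAlgebra X) c) = algebraMap ℂ (FreeStarAlgebra X) (star c) := by
  rw [star_def, AlgHom.commutes]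
  rfl

theorem star_mul' (x y : FreeStarAlgebra X) : star (x * y) = star y * star x := by
  rw [star_def, map_mul]
  rfl

theorem star_add' (x y : FreeStarAlgebra X) : star (x + y) = star x + star y := by
  rw [star_def, map_add]
  rfl

/-- Induction on elements of the free `*`-algebra. -/
theorem induction {C : FreeStarAlgebra X → Prop}
    (h1 : ∀ c, C (algebraMap ℂ (FreeStarAlgebra X) c)) (h2 : ∀ a, C (letter a))
    (h3 : ∀ x y, C x → C y → C (x * y)) (h4 : ∀ x y, C x → C y → C (x + y))
    (x : FreeStarAlgebra X) : C x :=
  FreeAlgebra.induction ℂ (X × Bool) h1 h2 h3 h4 x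

noncomputable instance : StarRing (FreeStarAlgebra X) where
  star_involutive x := by
    induction x using induction with
    | h1 c => rw [star_algebraMap', star_algebraMap', star_star]
    | h2 a => rw [star_letter, star_letter]; simp
    | h3 x y hx hy => rw [star_mul', star_mul', hx, hy]
    | h4 x y hx hy => rw [star_add', star_add', hx, hy]
  star_mul := star_mul'
  star_add := star_add'

instance : StarModule ℂ (FreeStarAlgebra X) where
  star_smul c x := by
    rw [Algebra.smul_def, star_mul', star_algebraMap', ← Algebra.commutes, ← Algebra.smul_def]

theorem star_gen (x : X) : star (gen x) = letter (x, true) := star_letter _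

/-- Evaluation of noncommutative `*`-polynomials. -/
noncomputable def eval {B : Type*} [Ring B] [StarRing B] [Algebra ℂ B] [StarModule ℂ B]
    (b : X → B) : FreeStarAlgebra X →⋆ₐ[ℂ] B where
  toAlgHom := (FreeAlgebra.lift ℂ (fun a : X × Bool => if a.2 then star (b a.1) else b a.1) :
    FreeAlgebra ℂ (X × Bool) →ₐ[ℂ] B)
  map_star' x := by
    set f : FreeStarAlgebra X →ₐ[ℂ] B :=
      (FreeAlgebra.lift ℂ (fun a : X × Bool => if a.2 then star (b a.1) else b a.1) :
        FreeAlgebra ℂ (X × Bool) →ₐ[ℂ] B) with hf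
    have hl : ∀ a, f (letter a) = if a.2 then star (b a.1) else b a.1 :=
      fun a => FreeAlgebra.lift_ι_apply _ _
    change f (star x) = star (f x)
    induction x using induction with
    | h1 c => rw [star_algebraMap', AlgHom.commutes, AlgHom.commutes, algebraMap_star_comm]
    | h2 a =>
      obtain ⟨x, e⟩ := a
      rw [star_letter, hl, hl]
      cases e <;> simp
    | h3 x y hx hy => rw [star_mul, map_mul, map_mul, star_mul, hx, hy]
    | h4 x y hx hy => rw [star_add, map_add, map_add, star_add, hx, hy]

theorem eval_gen {B : Type*} [Ring B] [StarRing B] [Algebra ℂ B] [StarModule ℂ B]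
    (b : X → B) (x : X) : eval b (gen x) = b x := by
  have : eval b (gen x) = if ((x, false) : X × Bool).2 then star (b x) else b x :=
    FreeAlgebra.lift_ι_apply _ _
  simpa using this

end FreeStarAlgebra

/-! ### `C*`-seminorms and the associated completions -/

/-- A `C*`-seminorm on a unital `*`-algebra. -/
structure CStarSeminorm (A : Type*) [Ring A] [StarRing A] [Algebra ℂ A] extends
    Seminorm ℂ A where
  mul_le' : ∀ x y, toFun (x * y) ≤ toFun x * toFun y
  star_mul_self' : ∀ x, toFun (star x * x) = toFun x ^ 2

namespace CStarSeminorm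

section
variable {A : Type*} [Ring A] [StarRing A] [Algebra ℂ A]

noncomputable instance : CoeFun (CStarSeminorm A) (fun _ => A → ℝ) := ⟨fun p => p.toSeminorm⟩

theorem mul_le (p : CStarSeminorm A) (x y : A) : p (x * y) ≤ p x * p y := p.mul_le' x y

theorem star_mul_self (p : CStarSeminorm A) (x : A) : p (star x * x) = p x ^ 2 :=
  p.star_mul_self' x

theorem nonneg (p : CStarSeminorm A) (x : A) : 0 ≤ p x := apply_nonneg p.toSeminorm x

theorem le_star (p : CStarSeminorm A) (x : A) : p x ≤ p (star x) := by
  have h1 := p.star_mul_self x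
  have h2 := p.mul_le (star x) x
  rcases (p.nonneg x).eq_or_lt with h | h
  · rw [← h]; exact p.nonneg _
  · nlinarith

theorem star (p : CStarSeminorm A) (x : A) : p (star x) = p x :=
  le_antisymm (by simpa using p.le_star (Star.star x)) (p.le_star x)

theorem one_le (p : CStarSeminorm A) : p 1 ≤ 1 := by
  have h := p.star_mul_self 1
  rw [star_one, one_mul] at h
  nlinarith [p.nonneg 1]

/-- `A` regarded as a seminormed algebra through `p`. -/
def Pre (_p : CStarSeminorm A) : Type _ := A

variable (p : CStarSeminorm A)

noncomputable instance : Ring p.Pre := inferInstanceAs (Ring A)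
noncomputable instance : StarRing p.Pre := inferInstanceAs (StarRing A)
noncomputable instance : Algebra ℂ p.Pre := inferInstanceAs (Algebra ℂ A)
instance [StarModule ℂ A] : StarModule ℂ p.Pre := inferInstanceAs (StarModule ℂ A)

noncomputable instance : SeminormedAddCommGroup p.Pre :=
  { p.toSeminorm.toAddGroupSeminorm.toSeminormedAddCommGroup with
    toAddCommGroup := inferInstanceAs (AddCommGroup A) }

/-- The identity map of `A`, seen as a map into the seminormed algebra. -/
noncomputable def toPre : A →⋆ₐ[ℂ] p.Pre := StarAlgHom.id ℂ A

theorem norm_toPre (x : A) : ‖p.toPre x‖ = p x := rfl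

theorem norm_pre (x : p.Pre) : ‖x‖ = p (x : A) := rfl

noncomputable instance : SeminormedRing p.Pre where
  __ := (inferInstance : SeminormedAddCommGroup p.Pre)
  __ := (inferInstance : Ring p.Pre)
  norm_mul_le := p.mul_le

noncomputable instance : NormedSpace ℂ p.Pre where
  norm_smul_le c x := (map_smul_eq_mul p.toSeminorm c (x : A)).le

instance : NormedStarGroup p.Pre where
  norm_star_le x := (p.star (x : A)).le

/-- The `C*`-algebra obtained from `A` by dividing out the kernel of `p` and completing. -/
abbrev Compl : Type _ := UniformSpace.Completion p.Pre

noncomputable instance : NormedAlgebra ℂ p.Compl where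
  norm_smul_le := norm_smul_le (α := ℂ) (β := UniformSpace.Completion p.Pre)

/-- The canonical map into the completion. -/
noncomputable def coe (x : A) : p.Compl := ((p.toPre x : p.Pre) : UniformSpace.Completion p.Pre)

theorem norm_coe (x : A) : ‖p.coe x‖ = p x := UniformSpace.Completion.norm_coe _

theorem coe_add (x y : A) : p.coe (x + y) = p.coe x + p.coe y :=
  UniformSpace.Completion.coe_add _ _

theorem coe_mul (x y : A) : p.coe (x * y) = p.coe x * p.coe y :=
  UniformSpace.Completion.coe_mul _ _

theorem coe_one : p.coe 1 = 1 := rfl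

theorem coe_zero : p.coe 0 = 0 := rfl

theorem coe_smul (c : ℂ) (x : A) : p.coe (c • x) = c • p.coe x :=
  UniformSpace.Completion.coe_smul c (p.toPre x)

theorem denseRange_coe : DenseRange p.coe := UniformSpace.Completion.denseRange_coe (α := p.Pre)

/-- To check a closed property on the completion it suffices to check it on `A`. -/
theorem compl_induction {C : p.Compl → Prop} (x : p.Compl) (hc : IsClosed {x | C x})
    (h : ∀ a, C (p.coe a)) : C x :=
  UniformSpace.Completion.induction_on x hc h

theorem compl_induction₂ {C : p.Compl → p.Compl → Prop} (x y : p.Compl)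
    (hc : IsClosed {z : p.Compl × p.Compl | C z.1 z.2})
    (h : ∀ a b, C (p.coe a) (p.coe b)) : C x y :=
  UniformSpace.Completion.induction_on₂ x y hc h

noncomputable instance : Star p.Compl where
  star := UniformSpace.Completion.map (fun x : p.Pre => Star.star x)

theorem uniformContinuous_star : UniformContinuous (fun x : p.Pre => Star.star x) :=
  (starNormedAddGroupHom : NormedAddGroupHom p.Pre p.Pre).uniformContinuous

theorem star_coe (x : A) : Star.star (p.coe x) = p.coe (Star.star x) :=
  UniformSpace.Completion.map_coe p.uniformContinuous_star _

instance : ContinuousStar p.Compl where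
  continuous_star := UniformSpace.Completion.continuous_map

noncomputable instance : StarRing p.Compl where
  star_involutive x := by
    refine p.compl_induction (C := fun x => Star.star (Star.star x) = x) x
      (isClosed_eq (by fun_prop) (by fun_prop)) fun a => ?_
    rw [star_coe, star_coe, star_star]
  star_mul x y := by
    refine p.compl_induction₂
      (C := fun x y => Star.star (x * y) = Star.star y * Star.star x) x y
      (isClosed_eq (by fun_prop) (by fun_prop)) fun a b => ?_
    rw [← coe_mul, star_coe, star_mul, coe_mul, star_coe, star_coe]
  star_add x y := by
    refine p.compl_induction₂
      (C := fun x y => Star.star (x + y) = Star.star x + Star.star y) x y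
      (isClosed_eq (by fun_prop) (by fun_prop)) fun a b => ?_
    rw [← coe_add, star_coe, star_add, coe_add, star_coe, star_coe]

noncomputable instance [StarModule ℂ A] : CStarAlgebra p.Compl where
  norm_mul_self_le x := by
    refine p.compl_induction (C := fun x => ‖x‖ * ‖x‖ ≤ ‖Star.star x * x‖) x
      (isClosed_le (by fun_prop) (by fun_prop)) fun a => ?_
    rw [star_coe, ← coe_mul, norm_coe, norm_coe, star_mul_self, sq]
  star_smul c x := by
    refine p.compl_induction (C := fun x => Star.star (c • x) = Star.star c • Star.star x) x
      (isClosed_eq (continuous_id.const_smul c).star (continuous_id.star.const_smul (Star.star c))) fun a => ?_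
    rw [← coe_smul, star_coe, star_smul, coe_smul, star_coe]

/-- The canonical `*`-homomorphism into the completion. -/
noncomputable def coeHom [StarModule ℂ A] : A →⋆ₐ[ℂ] p.Compl where
  toFun := p.coe
  map_one' := p.coe_one
  map_mul' := p.coe_mul
  map_zero' := p.coe_zero
  map_add' := p.coe_add
  commutes' c := by
    rw [Algebra.algebraMap_eq_smul_one, coe_smul, coe_one, ← Algebra.algebraMap_eq_smul_one]
  map_star' x := (p.star_coe x).symm

/-- The extension to the completion of a `*`-homomorphism that is bounded by `p`. -/
noncomputable def extend [StarModule ℂ A] {B : Type*} [CStarAlgebra B] (f : A →⋆ₐ[ℂ] B)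
    (hf : ∀ x, ‖f x‖ ≤ p x) : p.Compl →⋆ₐ[ℂ] B := by
  let g : p.Pre →L[ℂ] B := LinearMap.mkContinuous (f.toAlgHom.toLinearMap : A →ₗ[ℂ] B) 1
    (fun x => (one_mul (p (x : A))).symm ▸ hf x)
  let G : p.Compl →L[ℂ] B := g.fromCompletion
  have hG : ∀ a, G (p.coe a) = f a := fun a => g.fromCompletion_apply_coe _
  exact
  { toFun := G
    map_one' := by rw [← coe_one, hG, map_one]
    map_mul' := fun x y => by
      refine p.compl_induction₂ (C := fun x y => G (x * y) = G x * G y) x y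
        (isClosed_eq (by fun_prop) (by fun_prop)) fun a b => ?_
      rw [← coe_mul, hG, hG, hG, map_mul]
    map_zero' := map_zero G
    map_add' := map_add G
    commutes' := fun c => by
      rw [Algebra.algebraMap_eq_smul_one, map_smul, ← coe_one, hG, map_one,
        ← Algebra.algebraMap_eq_smul_one]
    map_star' := fun x => by
      refine p.compl_induction (C := fun x => G (Star.star x) = Star.star (G x)) x
        (isClosed_eq (by fun_prop) (by fun_prop)) fun a => ?_
      rw [star_coe, hG, hG, map_star] }

theorem extend_coe [StarModule ℂ A] {B : Type*} [CStarAlgebra B] (f : A →⋆ₐ[ℂ] B)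
    (hf : ∀ x, ‖f x‖ ≤ p x) (a : A) : p.extend f hf (p.coe a) = f a :=
  ContinuousLinearMap.fromCompletion_apply_coe _ _

/-- Two `*`-homomorphisms out of the completion agree if they agree on `A`. -/
theorem hom_ext [StarModule ℂ A] {B : Type*} [CStarAlgebra B] {f g : p.Compl →⋆ₐ[ℂ] B}
    (h : ∀ a, f (p.coe a) = g (p.coe a)) : f = g := by
  refine StarAlgHom.ext fun x => ?_
  have hc : ∀ f : p.Compl →⋆ₐ[ℂ] B, Continuous f := fun f =>
    AddMonoidHomClass.continuous_of_bound f 1 fun x => by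
      simpa using NonUnitalStarAlgHom.norm_apply_le f x
  exact p.compl_induction x (isClosed_eq (hc f) (hc g)) h

/-- The pullback of a `C*`-norm along a `*`-homomorphism. -/
noncomputable def ofHom {B : Type*} [CStarAlgebra B] (f : A →⋆ₐ[ℂ] B) : CStarSeminorm A where
  toSeminorm := (normSeminorm ℂ B).comp f.toAlgHom.toLinearMap
  mul_le' x y := by
    change ‖f (x * y)‖ ≤ ‖f x‖ * ‖f y‖
    rw [map_mul]; exact norm_mul_le _ _
  star_mul_self' x := by
    change ‖f (Star.star x * x)‖ = ‖f x‖ ^ 2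
    rw [map_mul, map_star, CStarRing.norm_star_mul_self, sq]

theorem ofHom_apply {B : Type*} [CStarAlgebra B] (f : A →⋆ₐ[ℂ] B) (x : A) :
    ofHom f x = ‖f x‖ := rfl

/-- The largest element of a pointwise bounded non-empty set of `C*`-seminorms, i.e. its pointwise
supremum. -/
noncomputable def sup (S : Set (CStarSeminorm A)) (hS : S.Nonempty)
    (hb : ∀ x, BddAbove ((fun p : CStarSeminorm A => p x) '' S)) : CStarSeminorm A :=
  have hle : ∀ p ∈ S, ∀ x, p x ≤ sSup ((fun p : CStarSeminorm A => p x) '' S) :=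
    fun p hp x => le_csSup (hb x) ⟨p, hp, rfl⟩
  have hge : ∀ x c, (∀ p ∈ S, p x ≤ c) → sSup ((fun p : CStarSeminorm A => p x) '' S) ≤ c :=
    fun x c h => csSup_le (hS.image _) (by rintro _ ⟨p, hp, rfl⟩; exact h p hp)
  have h0 : ∀ x, 0 ≤ sSup ((fun p : CStarSeminorm A => p x) '' S) := fun x => by
    obtain ⟨p, hp⟩ := hS
    exact (p.nonneg x).trans (hle p hp x)
  { toSeminorm := Seminorm.of (fun x => sSup ((fun p : CStarSeminorm A => p x) '' S))
      (fun x y => hge _ _ fun p hp => (map_add_le_add p.toSeminorm x y).trans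
        (add_le_add (hle p hp x) (hle p hp y)))
      (fun c x => by
        have key : ∀ (c : ℂ) x, sSup ((fun p : CStarSeminorm A => p (c • x)) '' S) ≤
            ‖c‖ * sSup ((fun p : CStarSeminorm A => p x) '' S) := fun c x =>
          hge _ _ fun p hp => (map_smul_eq_mul p.toSeminorm c x).le.trans
            (mul_le_mul_of_nonneg_left (hle p hp x) (norm_nonneg c))
        refine le_antisymm (key c x) ?_
        rcases eq_or_ne c 0 with rfl | hc
        · rw [norm_zero, zero_mul]; exact h0 _
        · have h := key c⁻¹ (c • x)
          simp only [smul_smul, inv_mul_cancel₀ hc, one_smul, norm_inv] at h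
          rwa [inv_mul_eq_div, le_div_iff₀ (norm_pos_iff.2 hc), mul_comm] at h)
    mul_le' := fun x y => hge _ _ fun p hp => (p.mul_le x y).trans
      (mul_le_mul (hle p hp x) (hle p hp y) (p.nonneg y) (h0 x))
    star_mul_self' := fun x => by
      refine le_antisymm (hge _ _ fun p hp => ?_) ?_
      · rw [p.star_mul_self]
        exact pow_le_pow_left₀ (p.nonneg x) (hle p hp x) 2
      · refine (Real.le_sqrt (h0 _) (h0 _)).1 (hge _ _ fun p hp => ?_)
        refine Real.le_sqrt_of_sq_le ?_
        rw [← p.star_mul_self]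
        exact hle p hp _ }

theorem sup_apply (S : Set (CStarSeminorm A)) (hS : S.Nonempty)
    (hb : ∀ x, BddAbove ((fun p : CStarSeminorm A => p x) '' S)) (x : A) :
    sup S hS hb x = sSup ((fun p : CStarSeminorm A => p x) '' S) := rfl

end
end CStarSeminorm

/-! ### Powers of the root of unity -/

/-- `ω ^ a` for an exponent `a` modulo `N`. -/
noncomputable def rootPow {N : ℕ} (ω : ℂ) (a : ZMod N) : ℂ := ω ^ a.val

section rootPow
variable {N : ℕ} {ω : ℂ}

theorem rootPow_zero : rootPow ω (0 : ZMod N) = 1 := by simp [rootPow]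

theorem rootPow_add [NeZero N] (hω : IsPrimitiveRoot ω N) (a b : ZMod N) : rootPow ω (a + b) = rootPow ω a * rootPow ω b := by
  rw [rootPow, rootPow, rootPow, ← pow_add, ZMod.val_add]
  exact (pow_eq_pow_mod _ hω.pow_eq_one).symm

theorem star_rootPow [NeZero N] (hω : IsPrimitiveRoot ω N) (a : ZMod N) : star (rootPow ω a) = rootPow ω (-a) := by
  have h1 : rootPow ω a * rootPow ω (-a) = 1 := by
    rw [← rootPow_add hω, add_neg_cancel, rootPow_zero]
  have hn : ‖ω‖ = 1 := Complex.norm_eq_one_of_pow_eq_one hω.pow_eq_one (NeZero.ne N)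
  have h2 : star (rootPow ω a) * rootPow ω a = 1 := by
    rw [rootPow, star_pow, ← mul_pow]
    have : star ω * ω = 1 := by
      rw [mul_comm]
      simpa [Complex.normSq_eq_norm_sq, hn] using Complex.mul_conj ω
    rw [this, one_pow]
  calc star (rootPow ω a) = star (rootPow ω a) * (rootPow ω a * rootPow ω (-a)) := by
        rw [h1, mul_one]
    _ = rootPow ω (-a) := by rw [← mul_assoc, h2, one_mul]

end rootPow

/-! ### The universal `C*`-algebra of the anyonic quantum permutation group -/

/-- The defining relations of the anyonic quantum permutation group, for a matrix `q` over a unital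
`*`-algebra; `E x y` is the sense in which two elements are required to be equal. -/
structure PermRelations {N : ℕ} [NeZero N] (ω : ℂ) {B : Type*} [Ring B] [StarRing B] [Algebra ℂ B]
    (E : B → B → Prop) (q : ZMod N → ZMod N → B) : Prop where
  zero_left : ∀ i, E (q 0 i) (if i = 0 then 1 else 0)
  zero_right : ∀ i, E (q i 0) (if i = 0 then 1 else 0)
  star_eq : ∀ i j, E (star (q i j)) (rootPow ω (-(i * (i - j))) • q (-i) (-j))
  col_add : ∀ i j k, E (q k (i + j))
    (∑ l, rootPow ω (-(l * (i - k + l))) • (q (k - l) i * q l j))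
  row_add : ∀ i j k, E (q (i + j) k)
    (∑ l, rootPow ω (-(i * (l - j))) • (q j l * q i (k - l)))

section Perm

variable {N : ℕ} [NeZero N] {ω : ℂ}

/-- The matrix of free generators. -/
noncomputable def freeGen (i j : ZMod N) : FreeStarAlgebra (ZMod N × ZMod N) :=
  FreeStarAlgebra.gen (i, j)

/-- The `C*`-seminorms on the free unital `*`-algebra on the symbols `q i j` for which the defining
relations hold, i.e. the `C*`-seminorms on the universal unital `*`-algebra with generators `q i j`
subject to the defining relations. -/
def permSeminorms (N : ℕ) [NeZero N] (ω : ℂ) :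
    Set (CStarSeminorm (FreeStarAlgebra (ZMod N × ZMod N))) :=
  {p | PermRelations ω (fun x y => p (x - y) = 0) freeGen}

/-- `*`-homomorphisms transport the relations. -/
theorem PermRelations.map {A B : Type*} [Ring A] [StarRing A] [Algebra ℂ A] [Ring B] [StarRing B]
    [Algebra ℂ B] {E : A → A → Prop} {F : B → B → Prop} {q : ZMod N → ZMod N → A}
    (h : PermRelations ω E q) (f : A →⋆ₐ[ℂ] B) (hf : ∀ x y, E x y → F (f x) (f y)) :
    PermRelations ω F (fun i j => f (q i j)) where
  zero_left i := by simpa [apply_ite f] using hf _ _ (h.zero_left i)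
  zero_right i := by simpa [apply_ite f] using hf _ _ (h.zero_right i)
  star_eq i j := by simpa [map_star] using hf _ _ (h.star_eq i j)
  col_add i j k := by simpa using hf _ _ (h.col_add i j k)
  row_add i j k := by simpa using hf _ _ (h.row_add i j k)

/-- A homomorphism whose values on generators satisfy the relations identifies both sides of each
relation among the free generators. -/
theorem PermRelations.comap {A B : Type*} [Ring A] [StarRing A] [Algebra ℂ A] [Ring B] [StarRing B]
    [Algebra ℂ B] {E : A → A → Prop} {F : B → B → Prop} {q : ZMod N → ZMod N → A}
    (f : A →⋆ₐ[ℂ] B) (h : PermRelations ω F (fun i j => f (q i j)))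
    (hf : ∀ x y, F (f x) (f y) → E x y) :
    PermRelations ω E q where
  zero_left i := hf _ _ (by simpa [apply_ite f] using h.zero_left i)
  zero_right i := hf _ _ (by simpa [apply_ite f] using h.zero_right i)
  star_eq i j := hf _ _ (by simpa [map_star] using h.star_eq i j)
  col_add i j k := hf _ _ (by simpa using h.col_add i j k)
  row_add i j k := hf _ _ (by simpa using h.row_add i j k)

/-- The columns of a matrix satisfying the relations are orthonormal. -/
theorem PermRelations.column_unitary {B : Type*} [Ring B] [StarRing B]
    [Algebra ℂ B] {q : ZMod N → ZMod N → B} (h : PermRelations ω Eq q) (j : ZMod N) :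
    ∑ l, star (q l j) * q l j = 1 := by
  have h1 := h.col_add (-j) j 0
  rw [neg_add_cancel, h.zero_left 0, if_pos rfl] at h1
  rw [h1]
  refine Finset.sum_congr rfl fun l _ => ?_
  rw [h.star_eq, smul_mul_assoc, zero_sub]
  congr 3
  ring

theorem PermRelations.norm_le_one {B : Type*} [CStarAlgebra B]
    {q : ZMod N → ZMod N → B} (h : PermRelations ω Eq q) (i j : ZMod N) : ‖q i j‖ ≤ 1 := by
  let := CStarAlgebra.spectralOrder B
  have := CStarAlgebra.spectralOrderedRing B
  have h1 : star (q i j) * q i j ≤ 1 := by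
    rw [← h.column_unitary j]
    exact Finset.single_le_sum (f := fun l => star (q l j) * q l j)
      (fun l _ => star_mul_self_nonneg _) (Finset.mem_univ i)
  have h2 : ‖star (q i j) * q i j‖ ≤ 1 :=
    (CStarAlgebra.norm_le_one_iff_of_nonneg _ (star_mul_self_nonneg _)).2 h1
  rw [CStarRing.norm_star_mul_self] at h2
  nlinarith [norm_nonneg (q i j)]

theorem permSeminorms_nonempty : (permSeminorms N ω).Nonempty := by
  refine ⟨{ toSeminorm := 0, mul_le' := fun x y => ?_, star_mul_self' := fun x => ?_ }, ?_⟩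
  · exact (mul_zero (0 : ℝ)).ge
  · exact (zero_pow two_ne_zero).symm
  · exact ⟨fun _ => rfl, fun _ => rfl, fun _ _ => rfl, fun _ _ _ => rfl, fun _ _ _ => rfl⟩

theorem coeHom_relations {p : CStarSeminorm (FreeStarAlgebra (ZMod N × ZMod N))}
    (hp : p ∈ permSeminorms N ω) :
    PermRelations ω Eq (fun i j => p.coeHom (freeGen (N := N) i j)) :=
  PermRelations.map hp p.coeHom fun x y h => by
    rw [← sub_eq_zero, ← map_sub, ← norm_eq_zero]
    exact (p.norm_coe _).trans h

theorem permSeminorms_bddAbove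
    (x : FreeStarAlgebra (ZMod N × ZMod N)) :
    BddAbove ((fun p : CStarSeminorm (FreeStarAlgebra (ZMod N × ZMod N)) => p x) ''
      permSeminorms N ω) := by
  suffices h : ∃ c : ℝ, 0 ≤ c ∧ ∀ p ∈ permSeminorms N ω, p x ≤ c by
    obtain ⟨c, -, hc⟩ := h
    exact ⟨c, by rintro _ ⟨p, hp, rfl⟩; exact hc p hp⟩
  induction x using FreeStarAlgebra.induction with
  | h1 c =>
    refine ⟨‖c‖, norm_nonneg c, fun p _ => ?_⟩
    rw [Algebra.algebraMap_eq_smul_one]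
    refine (map_smul_eq_mul p.toSeminorm c 1).le.trans ?_
    exact mul_le_of_le_one_right (norm_nonneg c) p.one_le
  | h2 a =>
    refine ⟨1, zero_le_one, fun p hp => ?_⟩
    obtain ⟨⟨i, j⟩, e⟩ := a
    have h1 : p (freeGen i j) ≤ 1 :=
      (p.norm_coe _).symm.le.trans ((coeHom_relations hp).norm_le_one i j)
    cases e
    · exact h1
    · rw [← FreeStarAlgebra.star_gen, p.star]; exact h1
  | h3 x y hx hy =>
    obtain ⟨c, hc0, hc⟩ := hx
    obtain ⟨d, hd0, hd⟩ := hy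
    exact ⟨c * d, mul_nonneg hc0 hd0, fun p hp => (p.mul_le x y).trans
      (mul_le_mul (hc p hp) (hd p hp) (p.nonneg y) hc0)⟩
  | h4 x y hx hy =>
    obtain ⟨c, hc0, hc⟩ := hx
    obtain ⟨d, hd0, hd⟩ := hy
    exact ⟨c + d, add_nonneg hc0 hd0, fun p hp => (map_add_le_add p.toSeminorm x y).trans
      (add_le_add (hc p hp) (hd p hp))⟩

/-- The largest `C*`-seminorm for which the relations hold. -/
noncomputable def permSeminorm (N : ℕ) [NeZero N] (ω : ℂ) :
    CStarSeminorm (FreeStarAlgebra (ZMod N × ZMod N)) :=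
  CStarSeminorm.sup (permSeminorms N ω) permSeminorms_nonempty (permSeminorms_bddAbove)

theorem permSeminorm_mem : permSeminorm N ω ∈ permSeminorms N ω := by
  have key : ∀ x, (∀ p ∈ permSeminorms N ω, p x = 0) → permSeminorm N ω x = 0 := fun x hx => by
    refine le_antisymm (csSup_le (permSeminorms_nonempty.image _) ?_) ((permSeminorm N ω).nonneg x)
    rintro _ ⟨p, hp, rfl⟩
    exact (hx p hp).le
  exact ⟨fun i => key _ fun p hp => hp.zero_left i, fun i => key _ fun p hp => hp.zero_right i,
    fun i j => key _ fun p hp => hp.star_eq i j, fun i j k => key _ fun p hp => hp.col_add i j k,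
    fun i j k => key _ fun p hp => hp.row_add i j k⟩

/-- The universal unital `C*`-algebra with generators `q i j` subject to the defining relations:
the completion of the universal unital `*`-algebra in its largest `C*`-seminorm. -/
def PermAlg (N : ℕ) [NeZero N] (ω : ℂ) : Type := (permSeminorm N ω).Compl

noncomputable instance instCStarAlgebraPermAlg : CStarAlgebra (PermAlg N ω) :=
  inferInstanceAs (CStarAlgebra (permSeminorm N ω).Compl)

/-- The generators of the universal `C*`-algebra. -/
noncomputable def permGen (N : ℕ) [NeZero N] (ω : ℂ) (i j : ZMod N) : PermAlg N ω :=
  (permSeminorm N ω).coeHom (freeGen i j)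

theorem permGen_relations : PermRelations ω Eq (permGen N ω) :=
  coeHom_relations permSeminorm_mem

theorem eval_le_permSeminorm {B : Type*} [CStarAlgebra B]
    {b : ZMod N → ZMod N → B} (hb : PermRelations ω Eq b)
    (x : FreeStarAlgebra (ZMod N × ZMod N)) :
    ‖FreeStarAlgebra.eval (fun ij : ZMod N × ZMod N => b ij.1 ij.2) x‖ ≤ permSeminorm N ω x := by
  set f := FreeStarAlgebra.eval (fun ij : ZMod N × ZMod N => b ij.1 ij.2) with hf
  have hfg : ∀ i j, f (freeGen i j) = b i j := fun i j => FreeStarAlgebra.eval_gen _ _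
  refine le_csSup (permSeminorms_bddAbove x) ⟨CStarSeminorm.ofHom f, ?_, rfl⟩
  refine PermRelations.comap (F := Eq) f ?_ fun x y h => ?_
  · simpa only [hfg] using hb
  · change ‖f (x - y)‖ = 0
    rw [map_sub, h, sub_self, norm_zero]

/-- The universal property: existence. -/
noncomputable def permLift {B : Type*} [CStarAlgebra B]
    (b : ZMod N → ZMod N → B) (hb : PermRelations ω Eq b) : PermAlg N ω →⋆ₐ[ℂ] B :=
  (permSeminorm N ω).extend (FreeStarAlgebra.eval (fun ij : ZMod N × ZMod N => b ij.1 ij.2))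
    (eval_le_permSeminorm hb)

theorem permLift_gen {B : Type*} [CStarAlgebra B]
    (b : ZMod N → ZMod N → B) (hb : PermRelations ω Eq b) (i j : ZMod N) :
    permLift b hb (permGen N ω i j) = b i j :=
  ((permSeminorm N ω).extend_coe _ _ _).trans (FreeStarAlgebra.eval_gen _ _)

/-- The universal property: uniqueness. -/
theorem permAlg_hom_ext {B : Type*} [CStarAlgebra B]
    {f g : PermAlg N ω →⋆ₐ[ℂ] B} (h : ∀ i j, f (permGen N ω i j) = g (permGen N ω i j)) : f = g := by
  refine (permSeminorm N ω).hom_ext fun a => ?_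
  change f ((permSeminorm N ω).coeHom a) = g ((permSeminorm N ω).coeHom a)
  induction a using FreeStarAlgebra.induction with
  | h1 c =>
    rw [AlgHomClass.commutes]
    exact (AlgHomClass.commutes f c).trans (AlgHomClass.commutes g c).symm
  | h2 a =>
    obtain ⟨⟨i, j⟩, e⟩ := a
    cases e
    · exact h i j
    · rw [← FreeStarAlgebra.star_gen, map_star]
      exact (map_star f _).trans ((congrArg star (h i j)).trans (map_star g _).symm)
  | h3 x y hx hy =>
    rw [map_mul]
    exact (map_mul f _ _).trans ((congrArg₂ _ hx hy).trans (map_mul g _ _).symm)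
  | h4 x y hx hy =>
    rw [map_add]
    exact (map_add f _ _).trans ((congrArg₂ _ hx hy).trans (map_add g _ _).symm)

end Perm
end Anyonic
namespace Anyonic

/-! ### Coactions of `C(ℤ/N)` -/

/-- A coaction of `C(ℤ/N)` on a unital `C*`-algebra `X`. Here `X ⊗ C(ℤ/N)` is identified with
`C(ℤ/N, X)`, and `X ⊗ C(ℤ/N) ⊗ C(ℤ/N)` with functions of two variables. -/
structure Coaction (N : ℕ) [NeZero N] (X : Type*) [CStarAlgebra X] where
  /-- The coaction, with `ρ x t` the value at `t` of the function `ρ x`. -/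
  ρ : X →⋆ₐ[ℂ] (ZMod N → X)
  coassoc : ∀ x s t, ρ (ρ x t) s = ρ x (s + t)
  podles : (Submodule.span ℂ {F : ZMod N → X | ∃ (x : X) (f : ZMod N → ℂ),
    F = fun t => f t • ρ x t}).topologicalClosure = ⊤

/-- A `*`-homomorphism between `ℤ/N`-`C*`-algebras is equivariant. -/
def IsEquivariant {N : ℕ} [NeZero N] {X Y : Type*} [CStarAlgebra X] [CStarAlgebra Y]
    (α : Coaction N X) (β : Coaction N Y) (f : X →⋆ₐ[ℂ] Y) : Prop :=
  ∀ x t, β.ρ (f x) t = f (α.ρ x t)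

/-- A family of `*`-endomorphisms forming an action of `ℤ/N` gives a coaction of `C(ℤ/N)`. -/
def Coaction.ofAction {N : ℕ} [NeZero N] {X : Type*} [CStarAlgebra X]
    (σ : ZMod N → X →⋆ₐ[ℂ] X) (h0 : ∀ x, σ 0 x = x)
    (hadd : ∀ x s t, σ s (σ t x) = σ (s + t) x) : Coaction N X where
  ρ :=
    { toFun := fun x t => σ t x
      map_one' := by funext t; simp
      map_mul' := fun x y => by funext t; simp
      map_zero' := by funext t; simp
      map_add' := fun x y => by funext t; simp
      commutes' := fun c => by
        funext t
        exact AlgHomClass.commutes (σ t) c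
      map_star' := fun x => by
        funext t
        exact map_star (σ t) x }
  coassoc := hadd
  podles := by
    refine eq_top_iff.2 (le_trans ?_ (Submodule.le_topologicalClosure _))
    intro F _
    have hF : F = ∑ s, Pi.single s (F s) := by
      funext t; simp [Finset.sum_apply, Pi.single_apply]
    rw [hF]
    refine Submodule.sum_mem _ fun s _ => Submodule.subset_span
      ⟨σ (-s) (F s), Pi.single s 1, ?_⟩
    funext t
    change (Pi.single s (F s) : ZMod N → X) t = (Pi.single s (1 : ℂ) : ZMod N → ℂ) t • σ t (σ (-s) (F s))
    by_cases ht : t = s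
    · subst ht
      simp [hadd, h0]
    · simp [ht]

section PermCoaction

variable {N : ℕ} [NeZero N] {ω : ℂ}

/-- The relations are homogeneous when `q i j` has degree `j - i`. -/
theorem permGen_rotate (hω : IsPrimitiveRoot ω N) (t : ZMod N) :
    PermRelations ω Eq (fun i j => rootPow ω (t * (j - i)) • permGen N ω i j) := by
  have h := permGen_relations (N := N) (ω := ω)
  refine ⟨fun i => ?_, fun i => ?_, fun i j => ?_, fun i j k => ?_, fun i j k => ?_⟩
  · rw [h.zero_left]
    by_cases hi : i = 0
    · subst hi; simp [rootPow_zero]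
    · simp [hi]
  · rw [h.zero_right]
    by_cases hi : i = 0
    · subst hi; simp [rootPow_zero]
    · simp [hi]
  · rw [star_smul, h.star_eq, star_rootPow hω, smul_smul, smul_smul, ← rootPow_add hω,
      ← rootPow_add hω]
    congr 2
    ring
  · rw [h.col_add, Finset.smul_sum]
    refine Finset.sum_congr rfl fun l _ => ?_
    rw [smul_mul_smul_comm, smul_smul, smul_smul, ← rootPow_add hω, ← rootPow_add hω,
      ← rootPow_add hω]
    congr 2
    ring
  · rw [h.row_add, Finset.smul_sum]
    refine Finset.sum_congr rfl fun l _ => ?_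
    rw [smul_mul_smul_comm, smul_smul, smul_smul, ← rootPow_add hω, ← rootPow_add hω,
      ← rootPow_add hω]
    congr 2
    ring

/-- The coaction on the universal `C*`-algebra, `ρ_t (q i j) = ω ^ (t (j - i)) q i j`. -/
noncomputable def permCoaction (hω : IsPrimitiveRoot ω N) : Coaction N (PermAlg N ω) :=
  Coaction.ofAction (fun t => permLift _ (permGen_rotate hω t))
    (fun x => by
      have : permLift _ (permGen_rotate hω 0) = StarAlgHom.id ℂ (PermAlg N ω) :=
        permAlg_hom_ext fun i j => by
          rw [permLift_gen, zero_mul, rootPow_zero, one_smul]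
          rfl
      rw [this]
      rfl)
    (fun x s t => by
      have : (permLift _ (permGen_rotate hω s)).comp (permLift _ (permGen_rotate hω t)) =
          permLift _ (permGen_rotate hω (s + t)) :=
        permAlg_hom_ext fun i j => by
          rw [StarAlgHom.comp_apply, permLift_gen, permLift_gen, map_smul, permLift_gen,
            smul_smul, ← rootPow_add hω, ← add_mul, add_comm t s]
      rw [← this]
      rfl)

theorem permCoaction_gen (hω : IsPrimitiveRoot ω N) (i j t : ZMod N) :
    (permCoaction hω).ρ (permGen N ω i j) t = rootPow ω (t * (j - i)) • permGen N ω i j :=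
  permLift_gen _ (permGen_rotate hω t) i j

end PermCoaction
end Anyonic
namespace Anyonic

set_option linter.unusedSectionVars false

/-! ### Hilbert space tensor products -/

section HilbertTensor

open scoped TensorProduct

/-- The Hilbert space tensor product. -/
def HTensor (H K : Type*) [NormedAddCommGroup H] [InnerProductSpace ℂ H]
    [NormedAddCommGroup K] [InnerProductSpace ℂ K] : Type _ :=
  UniformSpace.Completion (H ⊗[ℂ] K)

noncomputable instance instNormedAddCommGroupHTensor (H K : Type*) [NormedAddCommGroup H]
    [InnerProductSpace ℂ H] [NormedAddCommGroup K] [InnerProductSpace ℂ K] :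
    NormedAddCommGroup (HTensor H K) :=
  inferInstanceAs (NormedAddCommGroup (UniformSpace.Completion (H ⊗[ℂ] K)))

noncomputable instance instInnerProductSpaceHTensor (H K : Type*) [NormedAddCommGroup H]
    [InnerProductSpace ℂ H] [NormedAddCommGroup K] [InnerProductSpace ℂ K] :
    InnerProductSpace ℂ (HTensor H K) :=
  inferInstanceAs (InnerProductSpace ℂ (UniformSpace.Completion (H ⊗[ℂ] K)))

instance instCompleteSpaceHTensor (H K : Type*) [NormedAddCommGroup H]
    [InnerProductSpace ℂ H] [NormedAddCommGroup K] [InnerProductSpace ℂ K] :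
    CompleteSpace (HTensor H K) :=
  inferInstanceAs (CompleteSpace (UniformSpace.Completion (H ⊗[ℂ] K)))

variable {H K H' K' H'' K'' : Type*}
  [NormedAddCommGroup H] [InnerProductSpace ℂ H] [CompleteSpace H]
  [NormedAddCommGroup K] [InnerProductSpace ℂ K] [CompleteSpace K]
  [NormedAddCommGroup H'] [InnerProductSpace ℂ H'] [CompleteSpace H']
  [NormedAddCommGroup K'] [InnerProductSpace ℂ K'] [CompleteSpace K']
  [NormedAddCommGroup H''] [InnerProductSpace ℂ H''] [CompleteSpace H'']
  [NormedAddCommGroup K''] [InnerProductSpace ℂ K''] [CompleteSpace K'']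

/-- The embedding of the algebraic tensor product. -/
noncomputable def hcoe (H K : Type*) [NormedAddCommGroup H] [InnerProductSpace ℂ H]
    [NormedAddCommGroup K] [InnerProductSpace ℂ K] : H ⊗[ℂ] K →ₗᵢ[ℂ] HTensor H K :=
  UniformSpace.Completion.toComplₗᵢ

/-- The elementary tensor of two vectors. -/
noncomputable def htmul (x : H) (y : K) : HTensor H K := hcoe H K (x ⊗ₜ[ℂ] y)

/-- The tensor product of two bounded operators, `x ⊗ y ↦ f x ⊗ g y`. -/
noncomputable def tmap (f : H →L[ℂ] H') (g : K →L[ℂ] K') : HTensor H K →L[ℂ] HTensor H' K' :=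
  (TensorProduct.mapL f g).completion

/-- The flip `x ⊗ y ↦ y ⊗ x`. -/
noncomputable def tflip (H K : Type*) [NormedAddCommGroup H] [InnerProductSpace ℂ H]
    [NormedAddCommGroup K] [InnerProductSpace ℂ K] : HTensor H K →L[ℂ] HTensor K H :=
  ((TensorProduct.commIsometry ℂ H K : H ⊗[ℂ] K ≃ₗᵢ[ℂ] K ⊗[ℂ] H) :
    H ⊗[ℂ] K →L[ℂ] K ⊗[ℂ] H).completion

theorem tmap_htmul (f : H →L[ℂ] H') (g : K →L[ℂ] K') (x : H) (y : K) :
    tmap f g (htmul x y) = htmul (f x) (g y) :=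
  ContinuousLinearMap.completion_apply_coe _ _

theorem tflip_htmul (x : H) (y : K) : tflip H K (htmul x y) = htmul y x :=
  ContinuousLinearMap.completion_apply_coe _ _

/-- Bounded operators on a tensor product are determined by elementary tensors. -/
theorem htensor_ext {E : Type*} [NormedAddCommGroup E] [NormedSpace ℂ E]
    {S T : HTensor H K →L[ℂ] E} (h : ∀ x y, S (htmul x y) = T (htmul x y)) : S = T := by
  have key : ∀ a : H ⊗[ℂ] K, S (hcoe H K a) = T (hcoe H K a) := fun a => by
    induction a using TensorProduct.induction_on with
    | zero => rw [map_zero, map_zero, map_zero]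
    | tmul x y => exact h x y
    | add a b ha hb => rw [map_add, map_add, map_add, ha, hb]
  have hd : DenseRange (hcoe H K) :=
    UniformSpace.Completion.denseRange_coe (α := H ⊗[ℂ] K)
  exact DFunLike.coe_injective
    (hd.equalizer S.continuous T.continuous (funext key))

theorem htmul_add_left (x x' : H) (y : K) : htmul (x + x') y = htmul x y + htmul x' y := by
  rw [htmul, TensorProduct.add_tmul, map_add]; rfl

theorem htmul_add_right (x : H) (y y' : K) : htmul x (y + y') = htmul x y + htmul x y' := by
  rw [htmul, TensorProduct.tmul_add, map_add]; rfl

theorem htmul_smul_left (c : ℂ) (x : H) (y : K) : htmul (c • x) y = c • htmul x y := by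
  rw [htmul, ← TensorProduct.smul_tmul', map_smul]; rfl

theorem htmul_smul_right (c : ℂ) (x : H) (y : K) : htmul x (c • y) = c • htmul x y := by
  rw [htmul, TensorProduct.tmul_smul, map_smul]; rfl

theorem inner_htmul (x x' : H) (y y' : K) :
    inner ℂ (htmul x y) (htmul x' y') = inner ℂ x x' * inner ℂ y y' := by
  rw [htmul, htmul, LinearIsometry.inner_map_map, TensorProduct.inner_tmul]

theorem tmap_comp (f' : H' →L[ℂ] H'') (g' : K' →L[ℂ] K'') (f : H →L[ℂ] H') (g : K →L[ℂ] K') :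
    tmap f' g' ∘L tmap f g = tmap (f' ∘L f) (g' ∘L g) :=
  htensor_ext fun x y => by
    simp only [ContinuousLinearMap.comp_apply, tmap_htmul]

theorem tmap_mul (f' f : H →L[ℂ] H) (g' g : K →L[ℂ] K) :
    tmap f' g' * tmap f g = tmap (f' * f) (g' * g) := tmap_comp _ _ _ _

theorem tmap_one : tmap (1 : H →L[ℂ] H) (1 : K →L[ℂ] K) = 1 :=
  htensor_ext fun x y => by rw [tmap_htmul]; rfl

theorem tmap_add_left (f f' : H →L[ℂ] H') (g : K →L[ℂ] K') :
    tmap (f + f') g = tmap f g + tmap f' g :=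
  htensor_ext fun x y => by
    simp only [add_apply, tmap_htmul, htmul_add_left]

theorem tmap_add_right (f : H →L[ℂ] H') (g g' : K →L[ℂ] K') :
    tmap f (g + g') = tmap f g + tmap f g' :=
  htensor_ext fun x y => by
    simp only [add_apply, tmap_htmul, htmul_add_right]

theorem tmap_smul_left (c : ℂ) (f : H →L[ℂ] H') (g : K →L[ℂ] K') :
    tmap (c • f) g = c • tmap f g :=
  htensor_ext fun x y => by
    simp only [smul_apply, tmap_htmul, htmul_smul_left]

theorem tmap_smul_right (c : ℂ) (f : H →L[ℂ] H') (g : K →L[ℂ] K') :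
    tmap f (c • g) = c • tmap f g :=
  htensor_ext fun x y => by
    simp only [smul_apply, tmap_htmul, htmul_smul_right]

theorem tmap_zero_left (g : K →L[ℂ] K') : tmap (0 : H →L[ℂ] H') g = 0 := by
  rw [← zero_smul ℂ (0 : H →L[ℂ] H'), tmap_smul_left, zero_smul]

theorem tmap_zero_right (f : H →L[ℂ] H') : tmap f (0 : K →L[ℂ] K') = 0 := by
  rw [← zero_smul ℂ (0 : K →L[ℂ] K'), tmap_smul_right, zero_smul]

theorem tmap_sum_left {ι : Type*} (s : Finset ι) (f : ι → H →L[ℂ] H') (g : K →L[ℂ] K') :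
    tmap (∑ i ∈ s, f i) g = ∑ i ∈ s, tmap (f i) g := by
  induction s using Finset.cons_induction with
  | empty => rw [Finset.sum_empty, Finset.sum_empty, tmap_zero_left]
  | cons a s h ih => rw [Finset.sum_cons, Finset.sum_cons, tmap_add_left, ih]

theorem tmap_sum_right {ι : Type*} (s : Finset ι) (f : H →L[ℂ] H') (g : ι → K →L[ℂ] K') :
    tmap f (∑ i ∈ s, g i) = ∑ i ∈ s, tmap f (g i) := by
  induction s using Finset.cons_induction with
  | empty => rw [Finset.sum_empty, Finset.sum_empty, tmap_zero_right]
  | cons a s h ih => rw [Finset.sum_cons, Finset.sum_cons, tmap_add_right, ih]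

theorem tflip_comp_tmap (f : H →L[ℂ] H') (g : K →L[ℂ] K') :
    tflip H' K' ∘L tmap f g = tmap g f ∘L tflip H K :=
  htensor_ext fun x y => by
    simp only [ContinuousLinearMap.comp_apply, tmap_htmul, tflip_htmul]

theorem tflip_tflip : tflip K H ∘L tflip H K = 1 :=
  htensor_ext fun x y => by
    simp only [ContinuousLinearMap.comp_apply, tflip_htmul]
    rfl

theorem inner_ext_htensor {u v : HTensor H K}
    (h : ∀ x y, inner ℂ (htmul x y) u = inner ℂ (htmul x y) v) : u = v := by
  have h1 := htensor_ext (S := innerSL ℂ u) (T := innerSL ℂ v) fun x y => by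
    have := congrArg (starRingEnd ℂ) (h x y)
    rw [inner_conj_symm, inner_conj_symm] at this
    rw [innerSL_apply_apply, innerSL_apply_apply, this]
  refine ext_inner_right ℂ fun z => ?_
  have := congrArg (fun f : HTensor H K →L[ℂ] ℂ => f z) h1
  simpa only [innerSL_apply_apply] using this

theorem adjoint_tmap (f : H →L[ℂ] H') (g : K →L[ℂ] K') :
    (tmap f g).adjoint = tmap f.adjoint g.adjoint :=
  htensor_ext fun x y => inner_ext_htensor fun x' y' => by
    rw [ContinuousLinearMap.adjoint_inner_right, tmap_htmul, tmap_htmul, inner_htmul, inner_htmul,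
      ContinuousLinearMap.adjoint_inner_right, ContinuousLinearMap.adjoint_inner_right]

theorem adjoint_tflip : (tflip H K).adjoint = tflip K H :=
  htensor_ext fun x y => inner_ext_htensor fun x' y' => by
    rw [ContinuousLinearMap.adjoint_inner_right, tflip_htmul, tflip_htmul, inner_htmul,
      inner_htmul, mul_comm]

theorem star_tmap (f : H →L[ℂ] H) (g : K →L[ℂ] K) :
    star (tmap f g) = tmap (star f) (star g) := adjoint_tmap f g

end HilbertTensor

/-! ### Unitary representations of `ℤ/N` and the braiding -/

section Braiding

/-- Unitary representations of `ℤ/N` on a Hilbert space. -/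
abbrev URep (N : ℕ) (H : Type*) [NormedAddCommGroup H] [InnerProductSpace ℂ H] [CompleteSpace H] :
    Type _ := Multiplicative (ZMod N) →* unitary (H →L[ℂ] H)

variable {N : ℕ} [NeZero N] {H K : Type*}
  [NormedAddCommGroup H] [InnerProductSpace ℂ H] [CompleteSpace H]
  [NormedAddCommGroup K] [InnerProductSpace ℂ K] [CompleteSpace K]

/-- The operator by which `t` acts. -/
noncomputable def URep.op (U : URep N H) (t : ZMod N) : H →L[ℂ] H := (U (Multiplicative.ofAdd t) : H →L[ℂ] H)

theorem URep.op_zero (U : URep N H) : U.op 0 = 1 := by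
  rw [URep.op, ofAdd_zero, map_one]; rfl

theorem URep.op_add (U : URep N H) (s t : ZMod N) : U.op (s + t) = U.op s * U.op t := by
  rw [URep.op, ofAdd_add, map_mul]; rfl

theorem URep.star_op (U : URep N H) (t : ZMod N) : star (U.op t) = U.op (-t) := by
  have h1 : star (U.op t) * U.op t = 1 := Unitary.coe_star_mul_self (U (Multiplicative.ofAdd t))
  calc star (U.op t) = star (U.op t) * (U.op t * U.op (-t)) := by
        rw [← U.op_add, add_neg_cancel, U.op_zero, mul_one]
    _ = U.op (-t) := by rw [← mul_assoc, h1, one_mul]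

/-- The orthogonal projection onto the vectors `v` of degree `m`, i.e. with
`U t v = ω ^ (t m) v` for all `t`. -/
noncomputable def URep.proj (ω : ℂ) (U : URep N H) (m : ZMod N) : H →L[ℂ] H :=
  (N : ℂ)⁻¹ • ∑ t, rootPow ω (-(t * m)) • U.op t

theorem sum_rootPow {ω : ℂ} (hω : IsPrimitiveRoot ω N) (a : ZMod N) :
    ∑ t, rootPow ω (t * a) = if a = 0 then (N : ℂ) else 0 := by
  split_ifs with h
  · subst h
    simp [rootPow_zero, ZMod.card]
  · have h1 : rootPow ω a ≠ 1 := by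
      intro h1
      have h2 := (hω.pow_eq_one_iff_dvd _).1 h1
      have h3 := Nat.eq_zero_of_dvd_of_lt h2 (ZMod.val_lt a)
      exact h ((ZMod.val_eq_zero a).1 h3)
    have h2 : rootPow ω a * ∑ t, rootPow ω (t * a) = ∑ t, rootPow ω (t * a) := by
      rw [Finset.mul_sum]
      refine Fintype.sum_equiv (Equiv.addRight 1) _ _ fun t => ?_
      rw [← rootPow_add hω]
      congr 1
      simp; ring
    have h3 : (rootPow ω a - 1) * ∑ t, rootPow ω (t * a) = 0 := by
      rw [sub_mul, h2, one_mul, sub_self]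
    exact (mul_eq_zero.1 h3).resolve_left (sub_ne_zero.2 h1)

theorem URep.op_mul_proj {ω : ℂ} (hω : IsPrimitiveRoot ω N) (U : URep N H) (s m : ZMod N) :
    U.op s * U.proj ω m = rootPow ω (s * m) • U.proj ω m := by
  have h : U.op s * ∑ t, rootPow ω (-(t * m)) • U.op t =
      rootPow ω (s * m) • ∑ t, rootPow ω (-(t * m)) • U.op t := by
    rw [Finset.mul_sum, Finset.smul_sum]
    refine Fintype.sum_equiv (Equiv.addLeft s) _ _ fun t => ?_
    rw [mul_smul_comm, smul_smul, ← rootPow_add hω, ← U.op_add, Equiv.coe_addLeft]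
    congr 2
    ring
  rw [URep.proj, mul_smul_comm, h, smul_comm]

theorem URep.proj_mul_proj {ω : ℂ} (hω : IsPrimitiveRoot ω N) (U : URep N H) (m n : ZMod N) :
    U.proj ω m * U.proj ω n = if m = n then U.proj ω m else 0 := by
  have h0 : U.proj ω m * U.proj ω n =
      (N : ℂ)⁻¹ • ∑ t, rootPow ω (-(t * m)) • U.op t * U.proj ω n := by
    rw [← Finset.sum_mul, ← smul_mul_assoc]
    rfl
  rw [h0]
  have h : ∀ t, rootPow ω (-(t * m)) • U.op t * U.proj ω n =
      rootPow ω (t * (n - m)) • U.proj ω n := fun t => by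
    rw [smul_mul_assoc, U.op_mul_proj hω, smul_smul, ← rootPow_add hω]
    congr 2
    ring
  rw [Finset.sum_congr rfl fun t _ => h t, ← Finset.sum_smul, sum_rootPow hω, smul_smul]
  by_cases hmn : m = n
  · subst hmn
    simp [NeZero.ne N]
  · rw [if_neg hmn, if_neg (fun h => hmn (sub_eq_zero.1 h).symm)]
    simp

theorem URep.sum_proj {ω : ℂ} (hω : IsPrimitiveRoot ω N) (U : URep N H) :
    ∑ m, U.proj ω m = 1 := by
  simp only [URep.proj]
  rw [← Finset.smul_sum, Finset.sum_comm]
  have h : ∀ t : ZMod N, ∑ m : ZMod N, rootPow ω (-(t * m)) • U.op t =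
      if t = 0 then (N : ℂ) • 1 else 0 := fun t => by
    have h1 := sum_rootPow hω (-t)
    rw [← Finset.sum_smul]
    have h2 : ∑ m : ZMod N, rootPow ω (-(t * m)) = ∑ m, rootPow ω (m * -t) :=
      Finset.sum_congr rfl fun m _ => by congr 1; ring
    rw [h2, h1]
    by_cases ht : t = 0
    · subst ht
      simp [U.op_zero]
    · simp [ht]
  rw [Finset.sum_congr rfl fun t _ => h t]
  simp [smul_smul, NeZero.ne N]

theorem URep.star_proj {ω : ℂ} (hω : IsPrimitiveRoot ω N) (U : URep N H) (m : ZMod N) :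
    star (U.proj ω m) = U.proj ω m := by
  rw [URep.proj, star_smul, star_sum]
  congr 1
  · simp
  · refine Fintype.sum_equiv (Equiv.neg (ZMod N)) _ _ fun t => ?_
    rw [star_smul, star_rootPow hω, U.star_op]
    simp

theorem URep.proj_mul_op {ω : ℂ} (hω : IsPrimitiveRoot ω N) (U : URep N H) (s m : ZMod N) :
    U.proj ω m * U.op s = rootPow ω (s * m) • U.proj ω m := by
  have h := congrArg star (U.op_mul_proj hω (-s) m)
  rw [star_mul, U.star_proj hω, U.star_op, neg_neg, star_smul, U.star_proj hω,
    star_rootPow hω] at h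
  rw [h]
  congr 2
  ring

/-- The braiding `c : H ⊗ K → K ⊗ H`, `v ⊗ w ↦ ω ^ (m n) w ⊗ v` for `v` of degree `m` and `w` of
degree `n`. -/
noncomputable def braid (ω : ℂ) (U : URep N H) (V : URep N K) : HTensor H K →L[ℂ] HTensor K H :=
  tflip H K ∘L
    ∑ p : ZMod N × ZMod N, rootPow ω (p.1 * p.2) • tmap (U.proj ω p.1) (V.proj ω p.2)

/-- The dual braiding `K ⊗ H → H ⊗ K`, `w ⊗ v ↦ ω ^ (-m n) v ⊗ w` for `v` of degree `m` and `w` of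
degree `n`. -/
noncomputable def braidDual (ω : ℂ) (U : URep N H) (V : URep N K) :
    HTensor K H →L[ℂ] HTensor H K :=
  (∑ p : ZMod N × ZMod N, rootPow ω (-(p.1 * p.2)) • tmap (U.proj ω p.1) (V.proj ω p.2)) ∘L
    tflip K H

theorem URep.proj_apply_of_degree {ω : ℂ} (hω : IsPrimitiveRoot ω N) (U : URep N H) {v : H}
    {a : ZMod N} (hv : ∀ t, U.op t v = rootPow ω (t * a) • v) (m : ZMod N) :
    U.proj ω m v = if m = a then v else 0 := by
  have h : U.proj ω m v = ((N : ℂ)⁻¹ * ∑ t, rootPow ω (t * (a - m))) • v := by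
    rw [URep.proj, smul_apply, sum_apply, mul_smul,
      Finset.sum_smul]
    congr 1
    refine Finset.sum_congr rfl fun t _ => ?_
    rw [smul_apply, hv, smul_smul, ← rootPow_add hω]
    congr 2
    ring
  rw [h, sum_rootPow hω]
  by_cases hm : m = a
  · subst hm
    simp [NeZero.ne N]
  · rw [if_neg hm, if_neg (fun h => hm (sub_eq_zero.1 h).symm)]
    simp

/-- The braiding on homogeneous vectors. -/
theorem braid_htmul {ω : ℂ} (hω : IsPrimitiveRoot ω N) (U : URep N H) (V : URep N K) {v : H}
    {w : K} {a b : ZMod N} (hv : ∀ t, U.op t v = rootPow ω (t * a) • v)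
    (hw : ∀ t, V.op t w = rootPow ω (t * b) • w) :
    braid ω U V (htmul v w) = rootPow ω (a * b) • htmul w v := by
  have h0 : htmul (0 : H) (0 : K) = 0 := by
    rw [← zero_smul ℂ (0 : H), htmul_smul_left, zero_smul]
  have h1 : htmul (0 : H) w = 0 := by rw [← zero_smul ℂ (0 : H), htmul_smul_left, zero_smul]
  have h2 : htmul v (0 : K) = 0 := by rw [← zero_smul ℂ (0 : K), htmul_smul_right, zero_smul]
  rw [braid, ContinuousLinearMap.comp_apply, sum_apply, Finset.sum_eq_single (a, b)]
  · rw [smul_apply, tmap_htmul, U.proj_apply_of_degree hω hv, V.proj_apply_of_degree hω hw,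
      if_pos rfl, if_pos rfl, map_smul, tflip_htmul]
  · rintro ⟨m, n⟩ _ hmn
    rw [smul_apply, tmap_htmul, U.proj_apply_of_degree hω hv, V.proj_apply_of_degree hω hw]
    split_ifs with hm hn hn
    · exact absurd (Prod.ext hm hn) hmn
    · rw [h2, smul_zero]
    · rw [h1, smul_zero]
    · rw [h0, smul_zero]
  · simp

theorem tmap_proj_mul {ω : ℂ} (hω : IsPrimitiveRoot ω N) (U : URep N H) (V : URep N K)
    (p q : ZMod N × ZMod N) :
    tmap (U.proj ω p.1) (V.proj ω p.2) * tmap (U.proj ω q.1) (V.proj ω q.2) =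
      if p = q then tmap (U.proj ω p.1) (V.proj ω p.2) else 0 := by
  rw [tmap_mul, U.proj_mul_proj hω, V.proj_mul_proj hω]
  obtain ⟨m, n⟩ := p
  obtain ⟨m', n'⟩ := q
  by_cases h1 : m = m'
  · by_cases h2 : n = n'
    · simp [h1, h2]
    · simp [h2, tmap_zero_right]
  · simp [h1, tmap_zero_left]

theorem sum_tmap_proj {ω : ℂ} (hω : IsPrimitiveRoot ω N) (U : URep N H) (V : URep N K) :
    ∑ p : ZMod N × ZMod N, tmap (U.proj ω p.1) (V.proj ω p.2) = 1 := by
  rw [Fintype.sum_prod_type]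
  simp only [← tmap_sum_right, ← tmap_sum_left, URep.sum_proj hω, tmap_one]

theorem phase_mul_phase {ω : ℂ} (hω : IsPrimitiveRoot ω N) (U : URep N H) (V : URep N K)
    (a b : ZMod N × ZMod N → ZMod N) (hab : ∀ p, a p + b p = 0) :
    (∑ p : ZMod N × ZMod N, rootPow ω (a p) • tmap (U.proj ω p.1) (V.proj ω p.2)) *
      (∑ p : ZMod N × ZMod N, rootPow ω (b p) • tmap (U.proj ω p.1) (V.proj ω p.2)) = 1 := by
  rw [Finset.sum_mul, ← sum_tmap_proj hω U V]
  refine Finset.sum_congr rfl fun p _ => ?_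
  rw [Finset.mul_sum, Finset.sum_eq_single p]
  · rw [smul_mul_smul_comm, tmap_proj_mul hω, if_pos rfl, ← rootPow_add hω, hab, rootPow_zero,
      one_smul]
  · intro q _ hq
    rw [smul_mul_smul_comm, tmap_proj_mul hω, if_neg hq.symm, smul_zero]
  · simp

theorem adjoint_braid {ω : ℂ} (hω : IsPrimitiveRoot ω N) (U : URep N H) (V : URep N K) :
    (braid ω U V).adjoint = braidDual ω U V := by
  rw [braid, braidDual, ContinuousLinearMap.adjoint_comp, adjoint_tflip,
    ← ContinuousLinearMap.star_eq_adjoint, star_sum]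
  congr 1
  refine Finset.sum_congr rfl fun p _ => ?_
  rw [star_smul, star_tmap, U.star_proj hω, V.star_proj hω, star_rootPow hω]

theorem braidDual_comp_braid {ω : ℂ} (hω : IsPrimitiveRoot ω N) (U : URep N H) (V : URep N K) :
    braidDual ω U V ∘L braid ω U V = 1 := by
  rw [braid, braidDual, ContinuousLinearMap.comp_assoc, ← ContinuousLinearMap.comp_assoc
    (tflip K H), tflip_tflip]
  exact phase_mul_phase hω U V (fun p => -(p.1 * p.2)) (fun p => p.1 * p.2)
    fun p => neg_add_cancel _

theorem braid_comp_braidDual {ω : ℂ} (hω : IsPrimitiveRoot ω N) (U : URep N H) (V : URep N K) :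
    braid ω U V ∘L braidDual ω U V = 1 := by
  have h := phase_mul_phase hω U V (fun p => p.1 * p.2) (fun p => -(p.1 * p.2))
    fun p => add_neg_cancel _
  rw [braid, braidDual, ContinuousLinearMap.comp_assoc, ← ContinuousLinearMap.comp_assoc _ _
    (tflip K H)]
  rw [ContinuousLinearMap.mul_def] at h
  rw [h]
  exact tflip_tflip

end Braiding
end Anyonic
namespace Anyonic

set_option linter.unusedSectionVars false

/-! ### Braided tensor products -/

/-- A faithful `ℤ/N`-equivariant representation, on a Hilbert space `H`, of a `ℤ/N`-`C*`-algebra. -/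
structure CovariantRep {N : ℕ} [NeZero N] {X : Type*} [CStarAlgebra X] (α : Coaction N X)
    (H : Type*) [NormedAddCommGroup H] [InnerProductSpace ℂ H] [CompleteSpace H] where
  U : URep N H
  π : X →⋆ₐ[ℂ] (H →L[ℂ] H)
  injective : Function.Injective π
  equivariant : ∀ x t, π (α.ρ x t) = U.op t * π x * star (U.op t)

/-- A continuous `*`-endomorphism that preserves a set preserves the `C*`-algebra it generates. -/
theorem map_mem_closure_adjoin {B : Type*} [CStarAlgebra B] (f : B →⋆ₐ[ℂ] B) (hf : Continuous f)
    {G : Set B} (hG : ∀ x ∈ G, f x ∈ G) {T : B}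
    (hT : T ∈ (StarAlgebra.adjoin ℂ G).topologicalClosure) :
    f T ∈ (StarAlgebra.adjoin ℂ G).topologicalClosure := by
  have h : (StarAlgebra.adjoin ℂ G).topologicalClosure ≤
      ((StarAlgebra.adjoin ℂ G).topologicalClosure).comap f :=
    StarSubalgebra.topologicalClosure_minimal
      (StarAlgebra.adjoin_le fun x hx =>
        StarSubalgebra.le_topologicalClosure _ (StarAlgebra.subset_adjoin ℂ G (hG x hx)))
      ((StarSubalgebra.isClosed_topologicalClosure _).preimage hf)
  exact h hT

section Braided

variable {N : ℕ} [NeZero N] {ω : ℂ} {X Y : Type*} [CStarAlgebra X] [CStarAlgebra Y]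
  {α : Coaction N X} {β : Coaction N Y} {H K : Type*}
  [NormedAddCommGroup H] [InnerProductSpace ℂ H] [CompleteSpace H]
  [NormedAddCommGroup K] [InnerProductSpace ℂ K] [CompleteSpace K]

/-- The operator `j₁(x) = x ⊗ 1` on `H ⊗ K`. -/
noncomputable def opJ₁ (r : CovariantRep α H) (_s : CovariantRep β K) :
    X →⋆ₐ[ℂ] (HTensor H K →L[ℂ] HTensor H K) where
  toFun x := tmap (r.π x) 1
  map_one' := by rw [map_one, tmap_one]
  map_mul' x y := by rw [map_mul, tmap_mul, one_mul]
  map_zero' := by rw [map_zero, tmap_zero_left]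
  map_add' x y := by rw [map_add, tmap_add_left]
  commutes' c := by
    rw [Algebra.algebraMap_eq_smul_one, Algebra.algebraMap_eq_smul_one, map_smul, map_one,
      tmap_smul_left, tmap_one]
  map_star' x := by rw [map_star, star_tmap, star_one]

/-- The operator `j₂(y) = c' (y ⊗ 1) c` on `H ⊗ K`, where `c : H ⊗ K → K ⊗ H` is the braiding and
`c' : K ⊗ H → H ⊗ K` its dual. -/
noncomputable def opJ₂ (hω : IsPrimitiveRoot ω N) (r : CovariantRep α H) (s : CovariantRep β K) :
    Y →⋆ₐ[ℂ] (HTensor H K →L[ℂ] HTensor H K) where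
  toFun y := braidDual ω r.U s.U ∘L tmap (s.π y) 1 ∘L braid ω r.U s.U
  map_one' := by
    rw [map_one, tmap_one]
    exact braidDual_comp_braid hω r.U s.U
  map_mul' x y := by
    have h := braid_comp_braidDual hω r.U s.U
    rw [map_mul, ← one_mul (1 : H →L[ℂ] H), ← tmap_mul, one_mul, ContinuousLinearMap.mul_def,
      ContinuousLinearMap.mul_def]
    simp only [ContinuousLinearMap.comp_assoc]
    rw [← ContinuousLinearMap.comp_assoc (braid ω r.U s.U), h]
    rfl
  map_zero' := by
    rw [map_zero, tmap_zero_left, ContinuousLinearMap.zero_comp, ContinuousLinearMap.comp_zero]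
  map_add' x y := by
    rw [map_add, tmap_add_left, ContinuousLinearMap.add_comp, ContinuousLinearMap.comp_add]
  commutes' c := by
    rw [Algebra.algebraMap_eq_smul_one, Algebra.algebraMap_eq_smul_one, map_smul, map_one,
      tmap_smul_left, tmap_one, ContinuousLinearMap.smul_comp, ContinuousLinearMap.comp_smul]
    exact congrArg (c • ·) (braidDual_comp_braid hω r.U s.U)
  map_star' y := by
    have h1 := adjoint_braid hω r.U s.U
    have h2 : (braidDual ω r.U s.U).adjoint = braid ω r.U s.U := by
      rw [← h1, ContinuousLinearMap.adjoint_adjoint]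
    rw [ContinuousLinearMap.star_eq_adjoint, ContinuousLinearMap.adjoint_comp,
      ContinuousLinearMap.adjoint_comp, h1, h2, adjoint_tmap, map_star,
      ContinuousLinearMap.star_eq_adjoint, ← ContinuousLinearMap.star_eq_adjoint (1 : H →L[ℂ] H),
      star_one, ContinuousLinearMap.comp_assoc]

/-- The braided tensor product `X ⊠ Y`: the `C*`-algebra of operators on `H ⊗ K` generated by the
products `j₁(x) j₂(y)`. -/
noncomputable def braidedSubalgebra (hω : IsPrimitiveRoot ω N) (r : CovariantRep α H)
    (s : CovariantRep β K) : StarSubalgebra ℂ (HTensor H K →L[ℂ] HTensor H K) :=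
  (StarAlgebra.adjoin ℂ {T | ∃ x y, T = opJ₁ r s x * opJ₂ hω r s y}).topologicalClosure

/-- The braided tensor product as a type. -/
def Braided (hω : IsPrimitiveRoot ω N) (r : CovariantRep α H) (s : CovariantRep β K) : Type _ :=
  braidedSubalgebra hω r s

theorem isClosed_braided (hω : IsPrimitiveRoot ω N) (r : CovariantRep α H)
    (s : CovariantRep β K) :
    IsClosed (braidedSubalgebra hω r s : Set (HTensor H K →L[ℂ] HTensor H K)) :=
  StarSubalgebra.isClosed_topologicalClosure _

noncomputable instance instCStarAlgebraBraided (hω : IsPrimitiveRoot ω N) (r : CovariantRep α H)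
    (s : CovariantRep β K) : CStarAlgebra (Braided hω r s) :=
  StarSubalgebra.cstarAlgebra (braidedSubalgebra hω r s) (h_closed := isClosed_braided hω r s)

/-- The inclusion of the braided tensor product into the bounded operators. -/
noncomputable def braidedIncl (hω : IsPrimitiveRoot ω N) (r : CovariantRep α H)
    (s : CovariantRep β K) : Braided hω r s →⋆ₐ[ℂ] (HTensor H K →L[ℂ] HTensor H K) :=
  (braidedSubalgebra hω r s).subtype

theorem braidedIncl_injective (hω : IsPrimitiveRoot ω N) (r : CovariantRep α H)
    (s : CovariantRep β K) : Function.Injective (braidedIncl hω r s) :=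
  Subtype.val_injective

theorem opJ₁_mem (hω : IsPrimitiveRoot ω N) (r : CovariantRep α H) (s : CovariantRep β K)
    (x : X) : opJ₁ r s x ∈ braidedSubalgebra hω r s :=
  StarSubalgebra.le_topologicalClosure _
    (StarAlgebra.subset_adjoin ℂ _ ⟨x, 1, by rw [map_one, mul_one]⟩)

theorem opJ₂_mem (hω : IsPrimitiveRoot ω N) (r : CovariantRep α H) (s : CovariantRep β K)
    (y : Y) : opJ₂ hω r s y ∈ braidedSubalgebra hω r s :=
  StarSubalgebra.le_topologicalClosure _
    (StarAlgebra.subset_adjoin ℂ _ ⟨1, y, by rw [map_one, one_mul]⟩)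

/-- The embedding `j₁ : X → X ⊠ Y`. -/
noncomputable def j₁ (hω : IsPrimitiveRoot ω N) (r : CovariantRep α H) (s : CovariantRep β K) :
    X →⋆ₐ[ℂ] Braided hω r s :=
  (opJ₁ r s).codRestrict (braidedSubalgebra hω r s) (opJ₁_mem hω r s)

/-- The embedding `j₂ : Y → X ⊠ Y`. -/
noncomputable def j₂ (hω : IsPrimitiveRoot ω N) (r : CovariantRep α H) (s : CovariantRep β K) :
    Y →⋆ₐ[ℂ] Braided hω r s :=
  (opJ₂ hω r s).codRestrict (braidedSubalgebra hω r s) (opJ₂_mem hω r s)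

/-- The diagonal representation of `ℤ/N` on `H ⊗ K`. -/
noncomputable def URep.tensor (U : URep N H) (V : URep N K) : URep N (HTensor H K) where
  toFun g := ⟨tmap (U g : H →L[ℂ] H) (V g : K →L[ℂ] K), by
    rw [Unitary.mem_iff, star_tmap, tmap_mul, tmap_mul, Unitary.star_mul_self_of_mem (U g).2,
      Unitary.star_mul_self_of_mem (V g).2, Unitary.mul_star_self_of_mem (U g).2,
      Unitary.mul_star_self_of_mem (V g).2, tmap_one]
    exact ⟨rfl, rfl⟩⟩
  map_one' := Subtype.ext (by rw [map_one, map_one]; exact tmap_one)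
  map_mul' g h := Subtype.ext (by rw [map_mul, map_mul]; exact (tmap_mul _ _ _ _).symm)

theorem URep.op_tensor (U : URep N H) (V : URep N K) (t : ZMod N) :
    (U.tensor V).op t = tmap (U.op t) (V.op t) := rfl

theorem braid_comp_op (hω : IsPrimitiveRoot ω N) (U : URep N H) (V : URep N K) (t : ZMod N) :
    braid ω U V ∘L (U.tensor V).op t = (V.tensor U).op t ∘L braid ω U V := by
  rw [braid, URep.op_tensor, URep.op_tensor, ← ContinuousLinearMap.comp_assoc, ← tflip_comp_tmap,
    ContinuousLinearMap.comp_assoc, ContinuousLinearMap.comp_assoc]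
  refine congrArg (tflip H K ∘L ·) ?_
  rw [← ContinuousLinearMap.mul_def, ← ContinuousLinearMap.mul_def]
  rw [Finset.sum_mul, Finset.mul_sum]
  refine Finset.sum_congr rfl fun p _ => ?_
  rw [smul_mul_assoc, mul_smul_comm, tmap_mul, tmap_mul, U.proj_mul_op hω, V.proj_mul_op hω,
    U.op_mul_proj hω, V.op_mul_proj hω]

theorem braidDual_comp_op (hω : IsPrimitiveRoot ω N) (U : URep N H) (V : URep N K) (t : ZMod N) :
    braidDual ω U V ∘L (V.tensor U).op t = (U.tensor V).op t ∘L braidDual ω U V := by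
  have h := congrArg (fun T => braidDual ω U V ∘L T ∘L braidDual ω U V) (braid_comp_op hω U V t)
  simp only [ContinuousLinearMap.comp_assoc, braid_comp_braidDual hω] at h
  simp only [← ContinuousLinearMap.comp_assoc, braidDual_comp_braid hω] at h
  exact h.symm

/-- Conjugation by the diagonal representation. -/
noncomputable def conjOp (U : URep N H) (t : ZMod N) : (H →L[ℂ] H) →⋆ₐ[ℂ] (H →L[ℂ] H) :=
  let e := Unitary.conjStarAlgAut ℂ (H →L[ℂ] H) (U (Multiplicative.ofAdd t))
  { toFun := e
    map_one' := map_one e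
    map_mul' := map_mul e
    map_zero' := map_zero e
    map_add' := map_add e
    commutes' := AlgHomClass.commutes e
    map_star' := map_star e }

theorem conjOp_apply (U : URep N H) (t : ZMod N) (T : H →L[ℂ] H) :
    conjOp U t T = U.op t * T * star (U.op t) := rfl

theorem opJ₁_apply (r : CovariantRep α H) (s : CovariantRep β K) (x : X) :
    opJ₁ r s x = tmap (r.π x) 1 := rfl

theorem opJ₂_apply (hω : IsPrimitiveRoot ω N) (r : CovariantRep α H) (s : CovariantRep β K)
    (y : Y) :
    opJ₂ hω r s y = braidDual ω r.U s.U ∘L tmap (s.π y) 1 ∘L braid ω r.U s.U := rfl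

theorem conjOp_opJ₁ (r : CovariantRep α H) (s : CovariantRep β K) (t : ZMod N) (x : X) :
    conjOp (r.U.tensor s.U) t (opJ₁ r s x) = opJ₁ r s (α.ρ x t) := by
  have h : s.U.op t * star (s.U.op t) = 1 :=
    Unitary.coe_mul_star_self (s.U (Multiplicative.ofAdd t))
  rw [conjOp_apply, opJ₁_apply, opJ₁_apply, URep.op_tensor, star_tmap, r.equivariant, tmap_mul,
    tmap_mul, mul_one, h]

theorem conjOp_opJ₂ (hω : IsPrimitiveRoot ω N) (r : CovariantRep α H) (s : CovariantRep β K)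
    (t : ZMod N) (y : Y) :
    conjOp (r.U.tensor s.U) t (opJ₂ hω r s y) = opJ₂ hω r s (β.ρ y t) := by
  have h : r.U.op t * star (r.U.op t) = 1 :=
    Unitary.coe_mul_star_self (r.U (Multiplicative.ofAdd t))
  have h3 : tmap (s.π (β.ρ y t)) 1 =
      (s.U.tensor r.U).op t * tmap (s.π y) 1 * (s.U.tensor r.U).op (-t) := by
    rw [← URep.star_op, URep.op_tensor, star_tmap, s.equivariant, tmap_mul, tmap_mul, mul_one, h]
  have e1 := braidDual_comp_op hω r.U s.U t
  have e2 := braid_comp_op hω r.U s.U (-t)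
  rw [conjOp_apply, URep.star_op, opJ₂_apply, opJ₂_apply, h3, ContinuousLinearMap.mul_def,
    ContinuousLinearMap.mul_def, ContinuousLinearMap.mul_def, ContinuousLinearMap.mul_def]
  simp only [ContinuousLinearMap.comp_assoc]
  rw [e2, ← ContinuousLinearMap.comp_assoc _ (braidDual ω r.U s.U), ← e1,
    ContinuousLinearMap.comp_assoc]

theorem continuous_conjOp (U : URep N H) (t : ZMod N) : Continuous (conjOp U t) := by
  have : ⇑(conjOp U t) = fun T => U.op t * T * star (U.op t) := funext (conjOp_apply U t)
  rw [this]
  exact (continuous_const.mul continuous_id).mul continuous_const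

theorem conjOp_mem (hω : IsPrimitiveRoot ω N) (r : CovariantRep α H) (s : CovariantRep β K)
    (t : ZMod N) {T : HTensor H K →L[ℂ] HTensor H K} (hT : T ∈ braidedSubalgebra hω r s) :
    conjOp (r.U.tensor s.U) t T ∈ braidedSubalgebra hω r s := by
  refine map_mem_closure_adjoin (conjOp (r.U.tensor s.U) t) (continuous_conjOp _ _) ?_ hT
  rintro _ ⟨x, y, rfl⟩
  rw [map_mul, conjOp_opJ₁, conjOp_opJ₂]
  exact ⟨_, _, rfl⟩

/-- The automorphism of the braided tensor product by which `t` acts. -/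
noncomputable def braidedAct (hω : IsPrimitiveRoot ω N) (r : CovariantRep α H)
    (s : CovariantRep β K) (t : ZMod N) : Braided hω r s →⋆ₐ[ℂ] Braided hω r s :=
  ((conjOp (r.U.tensor s.U) t).comp (braidedIncl hω r s)).codRestrict (braidedSubalgebra hω r s)
    fun T => conjOp_mem hω r s t T.2

theorem braidedIncl_act (hω : IsPrimitiveRoot ω N) (r : CovariantRep α H)
    (s : CovariantRep β K) (t : ZMod N) (T : Braided hω r s) :
    braidedIncl hω r s (braidedAct hω r s t T) =
      (r.U.tensor s.U).op t * braidedIncl hω r s T * star ((r.U.tensor s.U).op t) :=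
  conjOp_apply _ t _

/-- The coaction on the braided tensor product. -/
noncomputable def braidedCoaction (hω : IsPrimitiveRoot ω N) (r : CovariantRep α H)
    (s : CovariantRep β K) : Coaction N (Braided hω r s) :=
  Coaction.ofAction (braidedAct hω r s)
    (fun T => braidedIncl_injective hω r s (by
      rw [braidedIncl_act, URep.op_zero, star_one, one_mul, mul_one]))
    (fun T t u => braidedIncl_injective hω r s (by
      rw [braidedIncl_act, braidedIncl_act, braidedIncl_act, URep.op_add, star_mul]
      simp only [mul_assoc]))

/-- `j₁` is equivariant. -/
theorem j₁_equivariant (hω : IsPrimitiveRoot ω N) (r : CovariantRep α H) (s : CovariantRep β K) :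
    IsEquivariant α (braidedCoaction hω r s) (j₁ hω r s) :=
  fun x t => braidedIncl_injective hω r s (conjOp_opJ₁ r s t x)

/-- `j₂` is equivariant. -/
theorem j₂_equivariant (hω : IsPrimitiveRoot ω N) (r : CovariantRep α H) (s : CovariantRep β K) :
    IsEquivariant β (braidedCoaction hω r s) (j₂ hω r s) :=
  fun y t => braidedIncl_injective hω r s (conjOp_opJ₂ hω r s t y)

/-- The braided tensor product is faithfully and equivariantly represented on `H ⊗ K`; this is used
to form iterated braided tensor products. -/
noncomputable def CovariantRep.braided (hω : IsPrimitiveRoot ω N) (r : CovariantRep α H)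
    (s : CovariantRep β K) : CovariantRep (braidedCoaction hω r s) (HTensor H K) where
  U := r.U.tensor s.U
  π := braidedIncl hω r s
  injective := braidedIncl_injective hω r s
  equivariant T t := braidedIncl_act hω r s t T

end Braided

/-! ### Anyonic compact quantum groups -/

/-- `F : X₁ ⊠ X₂ → Y₁ ⊠ Y₂` is the braided tensor product of the `*`-homomorphisms `f : X₁ → Y₁` and
`g : X₂ → Y₂`. -/
def IsBraidedMap {N : ℕ} [NeZero N] {ω : ℂ} (hω : IsPrimitiveRoot ω N)
    {X₁ X₂ Y₁ Y₂ : Type*} [CStarAlgebra X₁] [CStarAlgebra X₂] [CStarAlgebra Y₁] [CStarAlgebra Y₂]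
    {α₁ : Coaction N X₁} {α₂ : Coaction N X₂} {β₁ : Coaction N Y₁} {β₂ : Coaction N Y₂}
    {H₁ H₂ K₁ K₂ : Type*}
    [NormedAddCommGroup H₁] [InnerProductSpace ℂ H₁] [CompleteSpace H₁]
    [NormedAddCommGroup H₂] [InnerProductSpace ℂ H₂] [CompleteSpace H₂]
    [NormedAddCommGroup K₁] [InnerProductSpace ℂ K₁] [CompleteSpace K₁]
    [NormedAddCommGroup K₂] [InnerProductSpace ℂ K₂] [CompleteSpace K₂]
    (r₁ : CovariantRep α₁ H₁) (r₂ : CovariantRep α₂ H₂)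
    (s₁ : CovariantRep β₁ K₁) (s₂ : CovariantRep β₂ K₂)
    (f : X₁ →⋆ₐ[ℂ] Y₁) (g : X₂ →⋆ₐ[ℂ] Y₂)
    (F : Braided hω r₁ r₂ →⋆ₐ[ℂ] Braided hω s₁ s₂) : Prop :=
  IsEquivariant (braidedCoaction hω r₁ r₂) (braidedCoaction hω s₁ s₂) F ∧
    ∀ x₁ x₂, F (j₁ hω r₁ r₂ x₁ * j₂ hω r₁ r₂ x₂) = j₁ hω s₁ s₂ (f x₁) * j₂ hω s₁ s₂ (g x₂)

section QuantumGroup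

variable {N : ℕ} [NeZero N] {ω : ℂ} (hω : IsPrimitiveRoot ω N) {A : Type*} [CStarAlgebra A]
  {α : Coaction N A} {L : Type*} [NormedAddCommGroup L] [InnerProductSpace ℂ L] [CompleteSpace L]
  (r : CovariantRep α L)

/-- `a : (A ⊠ A) ⊠ A → A ⊠ (A ⊠ A)` is the canonical isomorphism, which respects the three embeddings
of `A`. -/
def IsAssociator
    (a : Braided hω (r.braided hω r) r ≃⋆ₐ[ℂ] Braided hω r (r.braided hω r)) : Prop :=
  (∀ x, a (j₁ hω (r.braided hω r) r (j₁ hω r r x)) = j₁ hω r (r.braided hω r) x) ∧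
  (∀ x, a (j₁ hω (r.braided hω r) r (j₂ hω r r x)) = j₂ hω r (r.braided hω r) (j₁ hω r r x)) ∧
  (∀ x, a (j₂ hω (r.braided hω r) r x) = j₂ hω r (r.braided hω r) (j₂ hω r r x))

/-- Coassociativity: `(Δ ⊠ id) ∘ Δ = (id ⊠ Δ) ∘ Δ` up to the canonical identification of
`(A ⊠ A) ⊠ A` with `A ⊠ (A ⊠ A)`. The maps `Δ ⊠ id`, `id ⊠ Δ` and the identification are uniquely
determined by the conditions. -/
def IsCoassociative (Δ : A →⋆ₐ[ℂ] Braided hω r r) : Prop :=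
  ∃ (ΔI : Braided hω r r →⋆ₐ[ℂ] Braided hω (r.braided hω r) r)
    (IΔ : Braided hω r r →⋆ₐ[ℂ] Braided hω r (r.braided hω r))
    (a : Braided hω (r.braided hω r) r ≃⋆ₐ[ℂ] Braided hω r (r.braided hω r)),
    IsBraidedMap hω r r (r.braided hω r) r Δ (StarAlgHom.id ℂ A) ΔI ∧
    IsBraidedMap hω r r r (r.braided hω r) (StarAlgHom.id ℂ A) Δ IΔ ∧
    IsAssociator hω r a ∧
    ∀ x, a (ΔI (Δ x)) = IΔ (Δ x)

/-- `(A, α, Δ)` is an anyonic compact quantum group, where `A ⊠ A` is formed through the faithful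
equivariant representation `r`. -/
structure IsAnyonicCompactQuantumGroup (Δ : A →⋆ₐ[ℂ] Braided hω r r) : Prop where
  equivariant : IsEquivariant α (braidedCoaction hω r r) Δ
  coassociative : IsCoassociative hω r Δ
  simplifiable_right :
    (Submodule.span ℂ {T | ∃ x y, T = Δ x * j₂ hω r r y}).topologicalClosure = ⊤
  simplifiable_left :
    (Submodule.span ℂ {T | ∃ x y, T = Δ x * j₁ hω r r y}).topologicalClosure = ⊤

end QuantumGroup
end Anyonic

/-! `Δ` is a matrix product in which entries of the two copies of `q` commute up to a phase. An
element of degree `n` in the second copy passes the first copy at the cost of the action of `-n`, so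
`j₂ (q k l)` and `j₁ (q i j)` commute up to `ω ^ (-((l - k) * (j - i)))`. This phase, combined with
the phases in the star, column and row relations of the two factors, gives exactly the phases
required for the product (`PermRelations.braidedMul`). The universal property then yields `Δ`.
Uniqueness and equivariance are checked on generators, where degrees add: `(k - i) + (j - k) = j -
i`.

On generators, coassociativity is the associativity of a matrix product; the work is to construct
the maps in it. Braided tensor products are defined through chosen Hilbert spaces, so for `f ⊠ id`
and `id ⊠ g`, with no injectivity of `f` or `g` assumed, one must bound norms of noncommutative
polynomials in `j₁ x` and `j₂ y`. Conjugation by the unitary `braidPhase` turns `j₁ x` into `∑ b,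
ρ_b(x) ⊗ Q_b` and `j₂ y` into `1 ⊗ y`, where the `Q_b` are the degree projections of the second
space. These operators come from the algebraic tensor product `X ⊗ B(K)`, by a formula that mentions
the representation of `X` only through its amplification. A faithful representation of `X` dominates
every other one on `X ⊗ B(K)` (`norm_amplify_le`): after compression to finitely many vectors of `K`
the question concerns matrices over `X`, where injective `*`-homomorphisms are isometric and all
others contractive. For the second leg the flip plays the same role, because `j₂ y = ∑ a, P_a ⊗
ρ_{-a}(y)`, with `P_a` the degree projections of the first space. The associator is conjugation by
the rebracketing unitary, and it matches the three embeddings because the degree of `v ⊗ w` is the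
sum of the degrees.

Bisimplifiability holds because the matrix product can be inverted from either side. Orthonormality
of rows gives `j₁ (q i k) = ∑ j, Δ (q i j) * star (j₂ (q k j))`, and twisted orthogonality of
columns writes `j₂ (q l j)` as a combination of the `Δ (q i j) * j₁ (q (-i) (-l))`. The commutation
rule carries this from generators to all of the algebra (`closedSpan_mul_eq_top_of_generators`), and
products of the two legs span the braided tensor product.

Finally, a faithful equivariant representation comes from a faithful representation (direct sum of
GNS representations) by letting `x` act in the fibre over `s` as `ρ_s(x)` and `ℤ/N` by shifting the
fibres. -/

namespace Anyonic

set_option linter.unusedSectionVars false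

/-! ### Faithful representations of `C*`-algebras -/

universe u

section GelfandNaimark

open scoped ComplexOrder

/-- Every nonzero element of a `C*`-algebra is detected by a positive functional. -/
theorem exists_positive_functional {B : Type*} [CStarAlgebra B] [PartialOrder B]
    [StarOrderedRing B] {a : B} (ha : a ≠ 0) : ∃ f : B →ₚ[ℂ] ℂ, f (star a * a) ≠ 0 := by
  have hconv : Convex ℝ {b : B | 0 ≤ b} := fun x hx y hy s t hs ht _ =>
    add_nonneg (smul_nonneg hs hx) (smul_nonneg ht hy)
  have hpos : (0 : B) ≤ star a * a := star_mul_self_nonneg a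
  have hnot : -(star a * a) ∉ {b : B | 0 ≤ b} := fun h => by
    have h0 : star a * a = 0 := le_antisymm (neg_nonneg.1 h) hpos
    exact ha ((CStarRing.star_mul_self_eq_zero_iff a).1 h0)
  -- Separate `-(a* a)` from the closed convex cone of positive elements: the real part of `g` is
  -- below `u` at this point and above `u` on the cone.
  obtain ⟨g, u, hu, hg⟩ := RCLike.geometric_hahn_banach_point_closed (𝕜 := ℂ) hconv
    CStarAlgebra.isClosed_nonneg hnot
  have hu0 : u < 0 := by simpa using hg 0 le_rfl
  have hgpos : ∀ b : B, 0 ≤ b → 0 ≤ (g b).re := fun b hb => by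
    by_contra! hneg
    -- This multiple of `b` stays in the cone, and the real part of `g` takes exactly the value `u`
    -- there, against the strict separation.
    have h1 := hg ((u / (g b).re) • b) (smul_nonneg (div_nonneg_of_nonpos hu0.le hneg.le) hb)
    rw [← Complex.coe_smul, map_smul] at h1
    simp [hneg.ne] at h1
  -- Only the real part of `g` is controlled. The hermitian symmetrization of `g` is complex linear
  -- and equals twice that real part on selfadjoint elements.
  let F : B →ₗ[ℂ] ℂ :=
    { toFun := fun x => g x + starRingEnd ℂ (g (star x))
      map_add' := fun x y => by simp only [star_add, map_add]; ring
      map_smul' := fun c x => by simp [star_smul, mul_add] }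
  have hF : ∀ b : B, 0 ≤ b → F b = ((2 * (g b).re : ℝ) : ℂ) := fun b hb => by
    change g b + starRingEnd ℂ (g (star b)) = _
    rw [(IsSelfAdjoint.of_nonneg hb).star_eq, Complex.add_conj]
  refine ⟨PositiveLinearMap.mk₀ F fun b hb => ?_, ?_⟩
  · rw [hF b hb]
    exact_mod_cast mul_nonneg zero_le_two (hgpos b hb)
  · change F _ ≠ 0
    rw [hF _ hpos]
    have h1 : 0 < (g (star a * a)).re := by
      have : -(g (star a * a)).re < u := by simpa using hu
      linarith
    exact_mod_cast (mul_pos zero_lt_two h1).ne'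

/-- The direct sum of a family of representations. -/
noncomputable def directSumRep {B ι : Type*} [CStarAlgebra B] {E : ι → Type*}
    [∀ i, NormedAddCommGroup (E i)] [∀ i, InnerProductSpace ℂ (E i)] [∀ i, CompleteSpace (E i)]
    (π : ∀ i, B →⋆ₐ[ℂ] (E i →L[ℂ] E i)) : B →⋆ₐ[ℂ] (lp E 2 →L[ℂ] lp E 2) := by
  let T : B → (lp E 2 →L[ℂ] lp E 2) := fun b =>
    lp.mapCLM 2 (fun i => π i b) (norm_nonneg b) fun i => NonUnitalStarAlgHom.norm_apply_le (π i) b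
  have hT : ∀ b ξ i, T b ξ i = π i b (ξ i) := fun b ξ i => rfl
  exact
  { toFun := T
    map_one' := by ext ξ i; simp [hT]
    map_mul' := fun x y => by ext ξ i; simp [hT]
    map_zero' := by ext ξ i; simp [hT]
    map_add' := fun x y => by ext ξ i; simp [hT]
    commutes' := fun c => by ext ξ i; simp [hT, Algebra.algebraMap_eq_smul_one]
    map_star' := fun x => by
      rw [ContinuousLinearMap.star_eq_adjoint, ContinuousLinearMap.eq_adjoint_iff]
      intro ξ η
      rw [lp.inner_eq_tsum, lp.inner_eq_tsum]
      refine tsum_congr fun i => ?_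
      rw [hT, hT, map_star, ContinuousLinearMap.star_eq_adjoint,
        ContinuousLinearMap.adjoint_inner_left] }

theorem directSumRep_apply {B ι : Type*} [CStarAlgebra B] {E : ι → Type*}
    [∀ i, NormedAddCommGroup (E i)] [∀ i, InnerProductSpace ℂ (E i)] [∀ i, CompleteSpace (E i)]
    (π : ∀ i, B →⋆ₐ[ℂ] (E i →L[ℂ] E i)) (b : B) (ξ : lp E 2) (i : ι) :
    directSumRep π b ξ i = π i b (ξ i) := rfl

/-- Every unital `C*`-algebra has a faithful representation on a Hilbert space. -/
theorem exists_faithful_rep (B : Type u) [CStarAlgebra B] :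
    ∃ (H : Type u) (_ : NormedAddCommGroup H) (_ : InnerProductSpace ℂ H) (_ : CompleteSpace H)
      (π : B →⋆ₐ[ℂ] (H →L[ℂ] H)), Function.Injective π := by
  classical
  let := CStarAlgebra.spectralOrder B
  have := CStarAlgebra.spectralOrderedRing B
  choose f hf using fun a : {a : B // a ≠ 0} => exists_positive_functional a.2
  refine ⟨lp (fun a => (f a).GNS) 2, inferInstance, inferInstance, inferInstance,
    directSumRep fun a => (f a).gnsStarAlgHom, ?_⟩
  rw [injective_iff_map_eq_zero]
  intro b hb
  by_contra hne
  let a : {a : B // a ≠ 0} := ⟨b, hne⟩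
  -- The cyclic vector for the functional attached to `b` itself: `b` maps it to the class of `b`,
  -- whose squared norm is `f (b* b) ≠ 0`.
  let v : (f a).GNS := (((f a).toPreGNS 1 : (f a).PreGNS) : (f a).GNS)
  have h1 : (f a).gnsStarAlgHom b v = 0 := by
    have h2 := congrArg (fun S => S (lp.single 2 a v) a) hb
    simpa [directSumRep_apply] using h2
  have h3 : (f a).gnsStarAlgHom b v = (((f a).toPreGNS b : (f a).PreGNS) : (f a).GNS) := by
    refine ((f a).gnsNonUnitalStarAlgHom_apply_coe).trans ?_
    simp
  rw [h3] at h1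
  apply hf a
  have h4 := (f a).preGNS_norm_sq ((f a).toPreGNS b)
  rw [← UniformSpace.Completion.norm_coe, h1] at h4
  simpa using h4.symm

end GelfandNaimark

/-! ### The covariant representation induced from a faithful representation -/

section RegularRep

variable {N : ℕ} [NeZero N]

/-- The matrix of the shift `e s ↦ e (s - t)`. -/
def shiftMatrix (t : ZMod N) : Matrix (ZMod N) (ZMod N) ℂ :=
  Matrix.of fun i j => if j = i + t then 1 else 0

theorem shiftMatrix_zero : shiftMatrix (0 : ZMod N) = 1 := by
  ext i j
  simp [shiftMatrix, Matrix.one_apply, eq_comm]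

theorem shiftMatrix_add (s t : ZMod N) :
    shiftMatrix (s + t) = shiftMatrix s * shiftMatrix t := by
  ext i j
  rw [Matrix.mul_apply, Finset.sum_eq_single (i + s)]
  · simp [shiftMatrix, add_assoc]
  · intro k _ hk
    simp [shiftMatrix, hk]
  · simp

theorem star_shiftMatrix (t : ZMod N) : star (shiftMatrix t) = shiftMatrix (-t) := by
  ext i j
  simp only [shiftMatrix, Matrix.star_apply, Matrix.of_apply, apply_ite star, star_one, star_zero]
  refine if_congr ⟨fun h => by rw [h]; ring, fun h => by rw [h]; ring⟩ rfl rfl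

/-- The shift by `t` moves the basis vector at `s` to `s - t`, hence also the projection onto it.
This becomes the covariance of `diagRep` under `shiftRep`. -/
theorem shiftMatrix_conj_single (t s : ZMod N) :
    shiftMatrix t * Matrix.single s s 1 * shiftMatrix (-t) =
      Matrix.single (s - t) (s - t) (1 : ℂ) := by
  ext i j
  rw [Matrix.mul_apply, Finset.sum_eq_single s]
  · rw [Matrix.mul_single_apply_same]
    simp only [shiftMatrix, Matrix.of_apply, Matrix.single_apply, ← ite_and, mul_one, ite_mul, one_mul,
      zero_mul]
    refine if_congr ⟨fun h => ⟨?_, ?_⟩, fun h => ⟨?_, ?_⟩⟩ rfl rfl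
    · rw [h.1]; ring
    · rw [h.2]; ring
    · rw [← h.1]; ring
    · rw [← h.2]; ring
  · intro k _ hk
    rw [Matrix.mul_single_apply_of_ne _ _ _ _ _ hk, zero_mul]
  · simp

/-- The representation of `ℤ/N` by shifts, amplified by a Hilbert space. -/
noncomputable def shiftRep (N : ℕ) [NeZero N] (H : Type*) [NormedAddCommGroup H]
    [InnerProductSpace ℂ H] [CompleteSpace H] : URep N (HTensor H (EuclideanSpace ℂ (ZMod N))) where
  toFun g := ⟨tmap 1 (Matrix.toEuclideanCLM (𝕜 := ℂ) (shiftMatrix g.toAdd)), by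
    rw [Unitary.mem_iff, star_tmap, tmap_mul, tmap_mul, star_one, one_mul, ← map_star, ← map_mul,
      ← map_mul, star_shiftMatrix, ← shiftMatrix_add, ← shiftMatrix_add]
    simp [shiftMatrix_zero, tmap_one]⟩
  map_one' := Subtype.ext (by simp [shiftMatrix_zero, tmap_one])
  map_mul' g h := Subtype.ext (by
    simp [shiftMatrix_add, tmap_mul])

theorem shiftRep_op (H : Type*) [NormedAddCommGroup H]
    [InnerProductSpace ℂ H] [CompleteSpace H] (t : ZMod N) :
    (shiftRep N H).op t = tmap 1 (Matrix.toEuclideanCLM (𝕜 := ℂ) (shiftMatrix t)) := rfl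

variable {X : Type*} [CStarAlgebra X] {H : Type*} [NormedAddCommGroup H]
    [InnerProductSpace ℂ H] [CompleteSpace H]

/-- The diagonal matrix units. -/
noncomputable def diagUnit (s : ZMod N) :
    EuclideanSpace ℂ (ZMod N) →L[ℂ] EuclideanSpace ℂ (ZMod N) :=
  Matrix.toEuclideanCLM (𝕜 := ℂ) (Matrix.single s s 1)

theorem diagUnit_mul (s t : ZMod N) : diagUnit s * diagUnit t = if s = t then diagUnit s else 0 := by
  rw [diagUnit, diagUnit, ← map_mul]
  split_ifs with h
  · subst h; simp
  · rw [Matrix.single_mul_single_of_ne _ _ _ _ h, map_zero]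

theorem sum_diagUnit : ∑ s : ZMod N, diagUnit s = 1 := by
  simp only [diagUnit]
  rw [← map_sum, ← map_one (Matrix.toEuclideanCLM (𝕜 := ℂ) (n := ZMod N))]
  congr 1
  ext i j
  rw [Matrix.sum_apply, Finset.sum_eq_single i]
  · simp [Matrix.single_apply, Matrix.one_apply]
  · intro k _ hk
    simp [hk]
  · simp

theorem star_diagUnit (s : ZMod N) : star (diagUnit s) = diagUnit s := by
  rw [diagUnit, ← map_star, Matrix.star_eq_conjTranspose, Matrix.conjTranspose_single, star_one]

/-- A sum of representations over the points of `ℤ/N`. -/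
noncomputable def diagRep (σ : ZMod N → X →⋆ₐ[ℂ] (H →L[ℂ] H)) :
    X →⋆ₐ[ℂ] (HTensor H (EuclideanSpace ℂ (ZMod N)) →L[ℂ]
      HTensor H (EuclideanSpace ℂ (ZMod N))) where
  toFun x := ∑ s, tmap (σ s x) (diagUnit s)
  map_one' := by
    simp only [map_one, ← tmap_sum_right, sum_diagUnit, tmap_one]
  map_mul' x y := by
    simp only [map_mul, Finset.sum_mul_sum, tmap_mul, diagUnit_mul]
    refine Finset.sum_congr rfl fun s _ => ?_
    rw [Finset.sum_eq_single s]
    · simp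
    · intro t _ ht
      rw [if_neg ht.symm, tmap_zero_right]
    · simp
  map_zero' := by simp [tmap_zero_left]
  map_add' x y := by simp [tmap_add_left, Finset.sum_add_distrib]
  commutes' c := by
    simp only [Algebra.algebraMap_eq_smul_one, map_smul, map_one, tmap_smul_left,
      ← Finset.smul_sum, ← tmap_sum_right, sum_diagUnit, tmap_one]
  map_star' x := by simp [star_sum, star_tmap, star_diagUnit, map_star]

theorem diagRep_apply (σ : ZMod N → X →⋆ₐ[ℂ] (H →L[ℂ] H)) (x : X) :
    diagRep σ x = ∑ s, tmap (σ s x) (diagUnit s) := rfl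

theorem diagRep_injective (σ : ZMod N → X →⋆ₐ[ℂ] (H →L[ℂ] H)) (s : ZMod N)
    (hs : Function.Injective (σ s)) : Function.Injective (diagRep σ) := by
  rw [injective_iff_map_eq_zero]
  intro x hx
  refine (injective_iff_map_eq_zero (σ s)).1 hs x (ContinuousLinearMap.ext fun v => ?_)
  -- On the fibre over `s` only `σ s` acts, and `htmul · (e s)` preserves norms, so vanishing of
  -- `diagRep σ x` forces `σ s x v = 0`.
  have h1 : diagRep σ x (htmul v (EuclideanSpace.single s 1)) =
      htmul (σ s x v) (EuclideanSpace.single s 1) := by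
    have hu : ∀ t, diagUnit t (EuclideanSpace.single s (1 : ℂ)) =
        if t = s then EuclideanSpace.single s 1 else 0 := fun t => by
      ext i
      rw [diagUnit, Matrix.ofLp_toEuclideanCLM]
      by_cases h : t = s
      · by_cases hi : s = i
        · simp [h, hi]
        · simp [h, hi, Ne.symm hi]
      · simp [h]
    rw [diagRep_apply, sum_apply, Finset.sum_eq_single s]
    · rw [tmap_htmul, hu, if_pos rfl]
    · intro t _ ht
      rw [tmap_htmul, hu, if_neg ht, ← zero_smul ℂ (0 : EuclideanSpace ℂ (ZMod N)),
        htmul_smul_right, zero_smul]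
    · simp
  have h2 := inner_htmul (σ s x v) (σ s x v) (EuclideanSpace.single s (1 : ℂ))
    (EuclideanSpace.single s 1)
  rw [← h1, hx] at h2
  simpa using h2.symm

/-- A `ℤ/N`-`C*`-algebra has a faithful equivariant representation. -/
theorem exists_covariantRep {X : Type u} [CStarAlgebra X] (α : Coaction N X)
    (h0 : ∀ x, α.ρ x 0 = x) :
    ∃ (L : Type u) (_ : NormedAddCommGroup L) (_ : InnerProductSpace ℂ L) (_ : CompleteSpace L),
      Nonempty (CovariantRep α L) := by
  obtain ⟨H, _, _, _, π, hπ⟩ := exists_faithful_rep X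
  -- The fibre over `s` carries the representation twisted by `ρ_s`. The fibre over `0` is `π`
  -- itself, which gives injectivity.
  let σ : ZMod N → X →⋆ₐ[ℂ] (H →L[ℂ] H) := fun s =>
    π.comp ((Pi.evalStarAlgHom ℂ (fun _ : ZMod N => X) s).comp α.ρ)
  have hσ : ∀ s x, σ s x = π (α.ρ x s) := fun s x => rfl
  refine ⟨HTensor H (EuclideanSpace ℂ (ZMod N)), inferInstance, inferInstance, inferInstance,
    ⟨{ U := shiftRep N H, π := diagRep σ, injective := ?_, equivariant := ?_ }⟩⟩
  · exact diagRep_injective σ 0 fun x y h => by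
      have h1 := hπ h
      change α.ρ x 0 = α.ρ y 0 at h1
      rwa [h0, h0] at h1
  · intro x t
    rw [URep.star_op, shiftRep_op, shiftRep_op, diagRep_apply, diagRep_apply, Finset.mul_sum,
      Finset.sum_mul]
    -- The fibre `s` of `ρ_t(x)` carries `ρ_{s+t}(x)`, which is the fibre `s + t` of `x` moved to
    -- `s` by the shift.
    refine Fintype.sum_equiv (Equiv.addRight t) _ _ fun s => ?_
    rw [tmap_mul, tmap_mul, one_mul, mul_one, hσ, hσ, α.coassoc, diagUnit, diagUnit, ← map_mul,
      ← map_mul, shiftMatrix_conj_single, Equiv.coe_addRight, add_sub_cancel_right]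

end RegularRep

/-! ### The spatial norm on `X ⊗ B(K)` -/

section Spatial

open scoped TensorProduct
open InnerProductSpace (rankOne)

variable {X : Type*} [CStarAlgebra X] {H H' K : Type*}
  [NormedAddCommGroup H] [InnerProductSpace ℂ H] [CompleteSpace H]
  [NormedAddCommGroup H'] [InnerProductSpace ℂ H'] [CompleteSpace H']
  [NormedAddCommGroup K] [InnerProductSpace ℂ K] [CompleteSpace K]

/-- The amplification `x ⊗ R ↦ π x ⊗ R` of a representation. -/
noncomputable def amplify (K : Type*) [NormedAddCommGroup K] [InnerProductSpace ℂ K]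
    [CompleteSpace K] (π : X →⋆ₐ[ℂ] (H →L[ℂ] H)) :
    X ⊗[ℂ] (K →L[ℂ] K) →ₐ[ℂ] (HTensor H K →L[ℂ] HTensor H K) :=
  Algebra.TensorProduct.lift
    { toFun := fun x => tmap (π x) 1
      map_one' := by rw [map_one, tmap_one]
      map_mul' := fun x y => by rw [map_mul, tmap_mul, one_mul]
      map_zero' := by rw [map_zero, tmap_zero_left]
      map_add' := fun x y => by rw [map_add, tmap_add_left]
      commutes' := fun c => by
        rw [Algebra.algebraMap_eq_smul_one, Algebra.algebraMap_eq_smul_one, map_smul, map_one,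
          tmap_smul_left, tmap_one] }
    { toFun := fun R => tmap 1 R
      map_one' := tmap_one
      map_mul' := fun R S => by rw [tmap_mul, one_mul]
      map_zero' := tmap_zero_right _
      map_add' := fun R S => tmap_add_right _ _ _
      commutes' := fun c => by
        rw [Algebra.algebraMap_eq_smul_one, Algebra.algebraMap_eq_smul_one,
          tmap_smul_right, tmap_one] }
    fun x R => by
      change tmap (π x) 1 * tmap 1 R = tmap 1 R * tmap (π x) 1
      rw [tmap_mul, tmap_mul, one_mul, mul_one, one_mul, mul_one]

theorem amplify_tmul (π : X →⋆ₐ[ℂ] (H →L[ℂ] H)) (x : X) (R : K →L[ℂ] K) :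
    amplify K π (x ⊗ₜ R) = tmap (π x) R := by
  refine (Algebra.TensorProduct.lift_tmul _ _ _ x R).trans ?_
  change tmap (π x) 1 * tmap 1 R = _
  rw [tmap_mul, one_mul, mul_one]

variable {n : ℕ}

/-- Matrices over `X` act on `H ⊗ K` through the matrix units of an orthonormal family. -/
noncomputable def matrixRep (π : X →⋆ₐ[ℂ] (H →L[ℂ] H)) {e : Fin n → K} (he : Orthonormal ℂ e) :
    CStarMatrix (Fin n) (Fin n) X →⋆ₙₐ[ℂ] (HTensor H K →L[ℂ] HTensor H K) where
  toFun M := ∑ a, ∑ b, tmap (π (M a b)) (rankOne ℂ (e a) (e b))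
  map_smul' c M := by
    simp only [CStarMatrix.smul_apply, map_smul, tmap_smul_left, Finset.smul_sum]
    rfl
  map_zero' := by simp [tmap_zero_left]
  map_add' M M' := by simp [tmap_add_left, Finset.sum_add_distrib]
  map_mul' M M' := by
    have hmul : ∀ a b c d, rankOne ℂ (e a) (e b) * rankOne ℂ (e c) (e d) =
        if b = c then rankOne ℂ (e a) (e d) else 0 := fun a b c d => by
      rw [ContinuousLinearMap.mul_def, InnerProductSpace.rankOne_comp_rankOne,
        orthonormal_iff_ite.1 he]
      split_ifs <;> simp
    rw [Finset.sum_mul]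
    refine Finset.sum_congr rfl fun a _ => ?_
    have h1 : ∀ b, tmap (π (M a b)) (rankOne ℂ (e a) (e b)) *
        (∑ c, ∑ d, tmap (π (M' c d)) (rankOne ℂ (e c) (e d))) =
        ∑ d, tmap (π (M a b) * π (M' b d)) (rankOne ℂ (e a) (e d)) := fun b => by
      rw [Finset.mul_sum, Finset.sum_eq_single b]
      · rw [Finset.mul_sum]
        refine Finset.sum_congr rfl fun d _ => ?_
        rw [tmap_mul, hmul, if_pos rfl]
      · intro c _ hc
        rw [Finset.mul_sum]
        refine Finset.sum_eq_zero fun d _ => ?_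
        rw [tmap_mul, hmul, if_neg hc.symm, tmap_zero_right]
      · simp
    rw [Finset.sum_mul, Finset.sum_congr rfl fun b _ => h1 b, Finset.sum_comm]
    refine Finset.sum_congr rfl fun d _ => ?_
    rw [CStarMatrix.mul_apply, map_sum, tmap_sum_left]
    exact Finset.sum_congr rfl fun b _ => by rw [map_mul]
  map_star' M := by
    rw [star_sum]
    simp only [star_sum, star_tmap, ContinuousLinearMap.star_eq_adjoint (rankOne ℂ _ _),
      InnerProductSpace.adjoint_rankOne, CStarMatrix.star_apply, map_star]
    rw [Finset.sum_comm]

theorem matrixRep_apply (π : X →⋆ₐ[ℂ] (H →L[ℂ] H)) {e : Fin n → K} (he : Orthonormal ℂ e)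
    (M : CStarMatrix (Fin n) (Fin n) X) :
    matrixRep π he M = ∑ a, ∑ b, tmap (π (M a b)) (rankOne ℂ (e a) (e b)) := rfl

/-- The entry `M a b` is recovered from the matrix coefficients of the operator between vectors `v ⊗
e b` and `w ⊗ e a`. An injective `*`-homomorphism of `C*`-algebras is isometric, so the norm of a
matrix over `X` can be computed in any faithful representation. -/
theorem matrixRep_injective {π : X →⋆ₐ[ℂ] (H →L[ℂ] H)} (hπ : Function.Injective π)
    {e : Fin n → K} (he : Orthonormal ℂ e) : Function.Injective (matrixRep π he) := by
  rw [injective_iff_map_eq_zero]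
  intro M hM
  refine CStarMatrix.ext fun a b => (injective_iff_map_eq_zero π).1 hπ _
    (ContinuousLinearMap.ext fun v => ?_)
  refine ext_inner_left ℂ fun w => ?_
  have h1 : inner ℂ (htmul w (e a)) (matrixRep π he M (htmul v (e b))) =
      inner ℂ w (π (M a b) v) := by
    simp only [matrixRep_apply, sum_apply, tmap_htmul, inner_sum, inner_htmul,
      InnerProductSpace.rankOne_apply, inner_smul_right, orthonormal_iff_ite.1 he]
    rw [Finset.sum_eq_single a, Finset.sum_eq_single b]
    · simp
    · intro c _ hc; simp [hc]
    · simp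
    · intro c _ hc; simp [hc.symm]
    · simp
  rw [← h1, hM]
  simp

/-- The compression of an element of `X ⊗ B(K)` to a matrix over `X`. -/
noncomputable def compress (e : Fin n → K) :
    X ⊗[ℂ] (K →L[ℂ] K) →ₗ[ℂ] CStarMatrix (Fin n) (Fin n) X :=
  TensorProduct.lift
    { toFun := fun x =>
        { toFun := fun R => CStarMatrix.ofMatrix (Matrix.of fun a b => inner ℂ (e a) (R (e b)) • x)
          map_add' := fun R S => by
            ext a b
            simp [add_smul]
          map_smul' := fun c R => by
            ext a b
            simp [mul_smul] }
      map_add' := fun x y => by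
        ext R a b
        simp
      map_smul' := fun c x => by
        ext R a b
        exact smul_comm _ c x }

theorem compress_tmul (e : Fin n → K) (x : X) (R : K →L[ℂ] K) (a b : Fin n) :
    compress e (x ⊗ₜ R) a b = inner ℂ (e a) (R (e b)) • x := rfl

/-- The matrix `compress e t` is formed over `X`, before any representation is chosen. One matrix
therefore describes the compressions of the amplifications by all representations, which is what
allows two of them to be compared. -/
theorem matrixRep_compress (π : X →⋆ₐ[ℂ] (H →L[ℂ] H)) {e : Fin n → K} (he : Orthonormal ℂ e)
    (t : X ⊗[ℂ] (K →L[ℂ] K)) :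
    matrixRep π he (compress e t) =
      tmap 1 (∑ a, rankOne ℂ (e a) (e a)) * amplify K π t *
        tmap 1 (∑ a, rankOne ℂ (e a) (e a)) := by
  induction t using TensorProduct.induction_on with
  | zero => simp
  | add s t hs ht => rw [map_add, map_add, map_add, hs, ht, mul_add, add_mul]
  | tmul x R =>
    rw [amplify_tmul, tmap_mul, tmap_mul, one_mul, mul_one, matrixRep_apply, Finset.sum_mul,
      Finset.sum_mul_sum, tmap_sum_right]
    refine Finset.sum_congr rfl fun a _ => ?_
    rw [tmap_sum_right]
    refine Finset.sum_congr rfl fun b _ => ?_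
    rw [compress_tmul, map_smul, tmap_smul_left, ← tmap_smul_right]
    congr 1
    ext z
    simp [ContinuousLinearMap.mul_def, smul_smul, mul_comm]

/-- Every element of the algebraic tensor product is fixed by `1 ⊗ p` for every operator `p` that
fixes a suitable finite set of vectors. -/
theorem exists_finset_tmap_fix (a : H ⊗[ℂ] K) : ∃ S : Finset K, ∀ p : K →L[ℂ] K,
    (∀ y ∈ S, p y = y) → tmap 1 p (hcoe H K a) = hcoe H K a := by
  classical
  induction a using TensorProduct.induction_on with
  | zero => exact ⟨∅, fun p _ => by simp⟩
  | tmul x y =>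
    refine ⟨{y}, fun p hp => ?_⟩
    change tmap 1 p (htmul x y) = htmul x y
    rw [tmap_htmul, hp y (by simp)]
    rfl
  | add a b ha hb =>
    obtain ⟨S, hS⟩ := ha
    obtain ⟨T, hT⟩ := hb
    refine ⟨S ∪ T, fun p hp => ?_⟩
    rw [map_add, map_add, hS p fun y hy => hp y (by simp [hy]),
      hT p fun y hy => hp y (by simp [hy])]

/-- Every finite set of vectors is fixed by the projection onto the span of some finite orthonormal
family. -/
theorem exists_orthonormal_fix (S : Finset K) : ∃ (n : ℕ) (e : Fin n → K), Orthonormal ℂ e ∧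
    ∀ y ∈ S, (∑ a, rankOne ℂ (e a) (e a)) y = y := by
  let F : Submodule ℂ K := Submodule.span ℂ (S : Set K)
  let b := stdOrthonormalBasis ℂ F
  refine ⟨_, fun i => (b i : K), ?_, fun y hy => ?_⟩
  · exact b.orthonormal.comp_linearIsometry F.subtypeₗᵢ
  · have h1 := congrArg F.subtype (b.sum_repr' ⟨y, Submodule.subset_span hy⟩)
    simpa [sum_apply] using h1

theorem star_sum_rankOne (e : Fin n → K) :
    star (∑ a, rankOne ℂ (e a) (e a)) = ∑ a, rankOne ℂ (e a) (e a) := by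
  simp [ContinuousLinearMap.star_eq_adjoint]

/-- The operator is a projection `q`, so `‖q‖ = ‖q* q‖ = ‖q‖ ^ 2`, which excludes `‖q‖ > 1`. -/
theorem norm_tmap_one_sum_rankOne_le {e : Fin n → K} (he : Orthonormal ℂ e) :
    ‖(tmap 1 (∑ a, rankOne ℂ (e a) (e a)) : HTensor H K →L[ℂ] HTensor H K)‖ ≤ 1 := by
  set q : HTensor H K →L[ℂ] HTensor H K := tmap 1 (∑ a, rankOne ℂ (e a) (e a)) with hq
  have h1 : (∑ a, rankOne ℂ (e a) (e a)) * (∑ a, rankOne ℂ (e a) (e a)) =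
      ∑ a, rankOne ℂ (e a) (e a) := by
    rw [Finset.sum_mul_sum]
    refine Finset.sum_congr rfl fun a _ => ?_
    rw [Finset.sum_eq_single a]
    · rw [ContinuousLinearMap.mul_def, InnerProductSpace.rankOne_comp_rankOne,
        orthonormal_iff_ite.1 he, if_pos rfl, one_smul]
    · intro b _ hb
      rw [ContinuousLinearMap.mul_def, InnerProductSpace.rankOne_comp_rankOne,
        orthonormal_iff_ite.1 he, if_neg hb.symm, zero_smul]
    · simp
  have h2 : star q * q = q := by
    rw [hq, star_tmap, star_one, star_sum_rankOne, tmap_mul, h1, one_mul]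
  have h3 := CStarRing.norm_star_mul_self (x := q)
  rw [h2] at h3
  by_contra! h
  nlinarith

/-- The amplification of an arbitrary representation is dominated by the amplification of a faithful
one. -/
theorem norm_amplify_le {π : X →⋆ₐ[ℂ] (H →L[ℂ] H)} (hπ : Function.Injective π)
    (σ : X →⋆ₐ[ℂ] (H' →L[ℂ] H')) (t : X ⊗[ℂ] (K →L[ℂ] K)) :
    ‖amplify K σ t‖ ≤ ‖amplify K π t‖ := by
  -- The `C*`-norm on `CStarMatrix` requires an order on `X`.
  let := CStarAlgebra.spectralOrder X
  have := CStarAlgebra.spectralOrderedRing X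
  have key : ∀ ξ η : HTensor H' K,
      ‖inner ℂ ξ (amplify K σ t η)‖ ≤ ‖amplify K π t‖ * ‖ξ‖ * ‖η‖ := by
    intro ξ η
    refine UniformSpace.Completion.induction_on₂ (α := H' ⊗[ℂ] K) (β := H' ⊗[ℂ] K)
      (p := fun ξ η : HTensor H' K =>
        ‖inner ℂ ξ (amplify K σ t η)‖ ≤ ‖amplify K π t‖ * ‖ξ‖ * ‖η‖) ξ η ?_ ?_
    · exact isClosed_le
        (f := fun z : HTensor H' K × HTensor H' K => ‖inner ℂ z.1 (amplify K σ t z.2)‖)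
        (g := fun z : HTensor H' K × HTensor H' K => ‖amplify K π t‖ * ‖z.1‖ * ‖z.2‖)
        (by fun_prop) (by fun_prop)
    · intro a b
      classical
      -- Vectors in the algebraic tensor product involve finitely many vectors of `K`. The
      -- projection `1 ⊗ p` onto the span of these fixes both `a` and `b`, so inserting it on both
      -- sides leaves the matrix coefficient unchanged.
      obtain ⟨S, hS⟩ := exists_finset_tmap_fix a
      obtain ⟨T, hT⟩ := exists_finset_tmap_fix b
      obtain ⟨n, e, he, hfix⟩ := exists_orthonormal_fix (S ∪ T)
      set p : K →L[ℂ] K := ∑ a, rankOne ℂ (e a) (e a) with hp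
      have ha := hS p fun y hy => hfix y (by simp [hy])
      have hb := hT p fun y hy => hfix y (by simp [hy])
      change ‖inner ℂ (hcoe H' K a) (amplify K σ t (hcoe H' K b))‖ ≤
        ‖amplify K π t‖ * ‖hcoe H' K a‖ * ‖hcoe H' K b‖
      have h1 : inner ℂ (hcoe H' K a) (amplify K σ t (hcoe H' K b)) =
          inner ℂ (hcoe H' K a) (matrixRep σ he (compress e t) (hcoe H' K b)) := by
        rw [matrixRep_compress, ← hp]
        conv_lhs => rw [← ha, ← hb]
        rw [← ContinuousLinearMap.adjoint_inner_right, adjoint_tmap,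
          ← ContinuousLinearMap.star_eq_adjoint, ← ContinuousLinearMap.star_eq_adjoint, star_one,
          hp, star_sum_rankOne]
        rfl
      -- `σ` is contractive on matrices over `X`, `π` is isometric on them, and compression by a
      -- projection does not increase the norm.
      have h2 : ‖matrixRep σ he (compress e t)‖ ≤ ‖amplify K π t‖ :=
        calc ‖matrixRep σ he (compress e t)‖ ≤ ‖compress e t‖ :=
              NonUnitalStarAlgHom.norm_apply_le _ _
          _ = ‖matrixRep π he (compress e t)‖ :=
              (NonUnitalStarAlgHom.norm_map _ (matrixRep_injective hπ he) _).symm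
          _ ≤ 1 * ‖amplify K π t‖ * 1 := by
              rw [matrixRep_compress]
              refine (norm_mul_le _ _).trans (mul_le_mul ((norm_mul_le _ _).trans ?_)
                (norm_tmap_one_sum_rankOne_le he) (norm_nonneg _) (by positivity))
              exact mul_le_mul_of_nonneg_right (norm_tmap_one_sum_rankOne_le he) (norm_nonneg _)
          _ = ‖amplify K π t‖ := by rw [one_mul, mul_one]
      rw [h1]
      refine (norm_inner_le_norm _ _).trans ?_
      rw [mul_comm ‖amplify K π t‖, mul_assoc]
      exact mul_le_mul_of_nonneg_left (ContinuousLinearMap.le_of_opNorm_le _ h2 _) (norm_nonneg _)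
  refine ContinuousLinearMap.opNorm_le_bound _ (norm_nonneg _) fun η => ?_
  -- Testing against the image vector itself gives `‖T η‖ ^ 2 ≤ C ‖T η‖ ‖η‖`, and one factor `‖T η‖`
  -- cancels unless it is zero.
  have h1 := key (amplify K σ t η) η
  rw [inner_self_eq_norm_sq_to_K] at h1
  have h2 : ‖amplify K σ t η‖ ^ 2 ≤ ‖amplify K π t‖ * ‖amplify K σ t η‖ * ‖η‖ := by
    simpa using h1
  rcases (norm_nonneg (amplify K σ t η)).eq_or_lt with h | h
  · rw [← h]; positivity
  · nlinarith

end Spatial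

/-! ### Homomorphisms determined on generators -/

section Generators

theorem FreeStarAlgebra.map_eval {ι B B' : Type*} [Ring B] [StarRing B] [Algebra ℂ B]
    [StarModule ℂ B] [Ring B'] [StarRing B'] [Algebra ℂ B'] [StarModule ℂ B']
    (f : B →⋆ₐ[ℂ] B') (b : ι → B) (p : FreeStarAlgebra ι) :
    f (FreeStarAlgebra.eval b p) = FreeStarAlgebra.eval (fun i => f (b i)) p := by
  induction p using FreeStarAlgebra.induction with
  | h1 c => rw [AlgHomClass.commutes, AlgHomClass.commutes, AlgHomClass.commutes]
  | h2 a =>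
    obtain ⟨i, e⟩ := a
    cases e
    · change f (FreeStarAlgebra.eval b (FreeStarAlgebra.gen i)) =
        FreeStarAlgebra.eval (fun i => f (b i)) (FreeStarAlgebra.gen i)
      rw [FreeStarAlgebra.eval_gen, FreeStarAlgebra.eval_gen]
    · rw [← FreeStarAlgebra.star_gen, map_star, map_star, map_star, FreeStarAlgebra.eval_gen,
        FreeStarAlgebra.eval_gen]
  | h3 x y hx hy => rw [map_mul, map_mul, map_mul, hx, hy]
  | h4 x y hx hy => rw [map_add, map_add, map_add, hx, hy]

variable {B B' : Type*} [CStarAlgebra B] [CStarAlgebra B']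

theorem continuous_starAlgHom (f : B →⋆ₐ[ℂ] B') : Continuous f :=
  AddMonoidHomClass.continuous_of_bound f 1 fun x => by
    simpa using NonUnitalStarAlgHom.norm_apply_le f x

/-- The `C*`-subalgebra generated by a set. -/
noncomputable def generated (S : Set B) : StarSubalgebra ℂ B :=
  (StarAlgebra.adjoin ℂ S).topologicalClosure

theorem isClosed_generated (S : Set B) : IsClosed (generated S : Set B) :=
  StarSubalgebra.isClosed_topologicalClosure _

theorem subset_generated (S : Set B) : S ⊆ generated S := fun _ hx =>
  StarSubalgebra.le_topologicalClosure _ (StarAlgebra.subset_adjoin ℂ S hx)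

theorem generated_le {S : Set B} {T : StarSubalgebra ℂ B} (h : S ⊆ T)
    (hT : IsClosed (T : Set B)) : generated S ≤ T :=
  StarSubalgebra.topologicalClosure_minimal (StarAlgebra.adjoin_le h) hT

/-- A `*`-homomorphism on a dense image extends as soon as it is contractive. -/
theorem exists_starAlgHom_of_norm_le {P : Type*} [Ring P] [StarRing P] [Algebra ℂ P]
    (φ : P →⋆ₐ[ℂ] B) (φ' : P →⋆ₐ[ℂ] B') (hd : DenseRange φ) (hn : ∀ p, ‖φ' p‖ ≤ ‖φ p‖) :
    ∃ F : B →⋆ₐ[ℂ] B', ∀ p, F (φ p) = φ' p := by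
  -- This is the extension of `φ p ↦ φ' p`, well defined because the norm bound sends the kernel of
  -- `φ` into that of `φ'`.
  let G : B →L[ℂ] B' := φ'.toAlgHom.toLinearMap.extendOfNorm φ.toAlgHom.toLinearMap
  have hG : ∀ p, G (φ p) = φ' p := fun p =>
    LinearMap.extendOfNorm_eq hd ⟨1, fun p => by rw [one_mul]; exact hn p⟩ p
  have h1 : G 1 = 1 := by rw [← map_one φ, hG, map_one]
  refine ⟨{ toFun := G
            map_one' := h1
            map_zero' := map_zero G
            map_add' := map_add G
            map_mul' := fun x y => ?_
            commutes' := fun c => ?_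
            map_star' := fun x => ?_ }, hG⟩
  · refine hd.induction_on₂ (p := fun x y => G (x * y) = G x * G y)
      (isClosed_eq (by fun_prop) (by fun_prop)) (fun p q => ?_) x y
    rw [← map_mul, hG, hG, hG, map_mul]
  · rw [Algebra.algebraMap_eq_smul_one, map_smul, h1, ← Algebra.algebraMap_eq_smul_one]
  · refine hd.induction_on (p := fun x => G (star x) = star (G x)) x
      (isClosed_eq (by fun_prop) (by fun_prop)) fun p => ?_
    rw [← map_star, hG, hG, map_star]

/-- A `C*`-algebra with a family of generators maps to another one as soon as every noncommutative
`*`-polynomial in the generators has norm at least that of its prospective image. -/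
theorem exists_starAlgHom_of_generators {ι : Type*} (g : ι → B) (g' : ι → B')
    (hg : generated (Set.range g) = ⊤)
    (hn : ∀ p, ‖FreeStarAlgebra.eval g' p‖ ≤ ‖FreeStarAlgebra.eval g p‖) :
    ∃ F : B →⋆ₐ[ℂ] B', ∀ i, F (g i) = g' i := by
  have hle : StarAlgebra.adjoin ℂ (Set.range g) ≤ (FreeStarAlgebra.eval g).range := by
    refine StarAlgebra.adjoin_le ?_
    rintro _ ⟨i, rfl⟩
    exact ⟨FreeStarAlgebra.gen i, FreeStarAlgebra.eval_gen g i⟩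
  have hd : DenseRange (FreeStarAlgebra.eval g) := fun x => by
    have hx : x ∈ generated (Set.range g) := hg ▸ trivial
    exact closure_mono (fun y hy => hle hy) hx
  obtain ⟨F, hF⟩ := exists_starAlgHom_of_norm_le (FreeStarAlgebra.eval g)
    (FreeStarAlgebra.eval g') hd hn
  exact ⟨F, fun i => by rw [← FreeStarAlgebra.eval_gen g i, hF, FreeStarAlgebra.eval_gen]⟩

/-- `*`-homomorphisms that agree on generators are equal. -/
theorem starAlgHom_ext_of_generators {S : Set B} (hS : generated S = ⊤)
    {f g : B →⋆ₐ[ℂ] B'} (h : ∀ x ∈ S, f x = g x) : f = g := by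
  have hle : generated S ≤ StarAlgHom.equalizer f g :=
    generated_le h
      (isClosed_eq (continuous_starAlgHom f) (continuous_starAlgHom g))
  refine StarAlgHom.ext fun x => hle ?_
  rw [hS]
  trivial

end Generators

/-! ### Norms under unitary equivalence -/

section Unitary

variable {E F : Type*}
  [NormedAddCommGroup E] [InnerProductSpace ℂ E] [CompleteSpace E]
  [NormedAddCommGroup F] [InnerProductSpace ℂ F] [CompleteSpace F]

/-- Operators intertwined by a unitary have the same norm. -/
theorem norm_eq_of_intertwine {Z : E →L[ℂ] F} (h1 : Z.adjoint ∘L Z = 1) (h2 : Z ∘L Z.adjoint = 1)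
    {S : E →L[ℂ] E} {T : F →L[ℂ] F} (h : T ∘L Z = Z ∘L S) : ‖T‖ = ‖S‖ := by
  have hZ : ∀ x, ‖Z x‖ = ‖x‖ := (ContinuousLinearMap.norm_map_iff_adjoint_comp_self Z).2 h1
  have hZ' : ∀ x, ‖Z.adjoint x‖ = ‖x‖ :=
    (ContinuousLinearMap.norm_map_iff_adjoint_comp_self Z.adjoint).2 (by
      rw [ContinuousLinearMap.adjoint_adjoint]; exact h2)
  refine le_antisymm ?_ ?_
  · refine ContinuousLinearMap.opNorm_le_bound _ (norm_nonneg _) fun y => ?_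
    have e1 : T y = Z (S (Z.adjoint y)) :=
      calc T y = T ((Z ∘L Z.adjoint) y) := by rw [h2]; rfl
        _ = (T ∘L Z) (Z.adjoint y) := rfl
        _ = Z (S (Z.adjoint y)) := by rw [h]; rfl
    rw [e1, hZ, ← hZ' y]
    exact S.le_opNorm _
  · refine ContinuousLinearMap.opNorm_le_bound _ (norm_nonneg _) fun x => ?_
    have e1 : Z (S x) = T (Z x) := congrArg (fun R => R x) h.symm
    rw [← hZ, e1, ← hZ x]
    exact T.le_opNorm _

end Unitary

/-! ### Comparison of polynomial norms through amplifications -/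

section Amplify

open scoped TensorProduct

variable {X : Type*} [CStarAlgebra X] {H H' K E E' : Type*}
  [NormedAddCommGroup H] [InnerProductSpace ℂ H] [CompleteSpace H]
  [NormedAddCommGroup H'] [InnerProductSpace ℂ H'] [CompleteSpace H']
  [NormedAddCommGroup K] [InnerProductSpace ℂ K] [CompleteSpace K]
  [NormedAddCommGroup E] [InnerProductSpace ℂ E] [CompleteSpace E]
  [NormedAddCommGroup E'] [InnerProductSpace ℂ E'] [CompleteSpace E']

/-- If the generators `g i` and `g' i` are unitarily equivalent to the amplifications of one element
of `X ⊗ B(K)` by a faithful and by an arbitrary representation, then noncommutative `*`-polynomials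
in the `g i` dominate those in the `g' i`. -/
theorem norm_eval_le_of_amplify {π : X →⋆ₐ[ℂ] (H →L[ℂ] H)} (hπ : Function.Injective π)
    (σ : X →⋆ₐ[ℂ] (H' →L[ℂ] H')) {Z : E →L[ℂ] HTensor H K} {Z' : E' →L[ℂ] HTensor H' K}
    (h1 : Z.adjoint ∘L Z = 1) (h2 : Z ∘L Z.adjoint = 1)
    (h1' : Z'.adjoint ∘L Z' = 1) (h2' : Z' ∘L Z'.adjoint = 1) {ι : Type*}
    (g : ι → E →L[ℂ] E) (g' : ι → E' →L[ℂ] E')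
    (hstar : ∀ i, ∃ j, star (g i) = g j ∧ star (g' i) = g' j)
    (h : ∀ i, ∃ t, amplify K π t ∘L Z = Z ∘L g i ∧ amplify K σ t ∘L Z' = Z' ∘L g' i)
    (p : FreeStarAlgebra ι) :
    ‖FreeStarAlgebra.eval g' p‖ ≤ ‖FreeStarAlgebra.eval g p‖ := by
  -- The same `t` has to represent `p` on both sides. `amplify` is only an algebra homomorphism, so
  -- sums and products are immediate while adjoints of generators are supplied by `hstar`.
  suffices hp : ∃ t, amplify K π t ∘L Z = Z ∘L FreeStarAlgebra.eval g p ∧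
      amplify K σ t ∘L Z' = Z' ∘L FreeStarAlgebra.eval g' p by
    obtain ⟨t, ht, ht'⟩ := hp
    rw [← norm_eq_of_intertwine h1 h2 ht, ← norm_eq_of_intertwine h1' h2' ht']
    exact norm_amplify_le hπ σ t
  induction p using FreeStarAlgebra.induction with
  | h1 c =>
    refine ⟨c • ((1 : X) ⊗ₜ[ℂ] (1 : K →L[ℂ] K)), ?_, ?_⟩ <;>
    · rw [map_smul, amplify_tmul, map_one, tmap_one, AlgHomClass.commutes, Algebra.algebraMap_eq_smul_one,
        ContinuousLinearMap.comp_smul, ContinuousLinearMap.smul_comp]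
      rfl
  | h2 a =>
    obtain ⟨i, e⟩ := a
    cases e
    · change ∃ t, amplify K π t ∘L Z = Z ∘L FreeStarAlgebra.eval g (FreeStarAlgebra.gen i) ∧
        amplify K σ t ∘L Z' = Z' ∘L FreeStarAlgebra.eval g' (FreeStarAlgebra.gen i)
      rw [FreeStarAlgebra.eval_gen, FreeStarAlgebra.eval_gen]
      exact h i
    · rw [← FreeStarAlgebra.star_gen, map_star, map_star, FreeStarAlgebra.eval_gen,
        FreeStarAlgebra.eval_gen]
      obtain ⟨j, hj, hj'⟩ := hstar i
      rw [hj, hj']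
      exact h j
  | h3 x y hx hy =>
    obtain ⟨t, ht, ht'⟩ := hx
    obtain ⟨u, hu, hu'⟩ := hy
    refine ⟨t * u, ?_, ?_⟩
    · rw [map_mul, map_mul, ContinuousLinearMap.mul_def, ContinuousLinearMap.mul_def,
        ContinuousLinearMap.comp_assoc, hu, ← ContinuousLinearMap.comp_assoc, ht,
        ContinuousLinearMap.comp_assoc]
    · rw [map_mul, map_mul, ContinuousLinearMap.mul_def, ContinuousLinearMap.mul_def,
        ContinuousLinearMap.comp_assoc, hu', ← ContinuousLinearMap.comp_assoc, ht',
        ContinuousLinearMap.comp_assoc]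
  | h4 x y hx hy =>
    obtain ⟨t, ht, ht'⟩ := hx
    obtain ⟨u, hu, hu'⟩ := hy
    refine ⟨t + u, ?_, ?_⟩
    · rw [map_add, map_add, ContinuousLinearMap.add_comp, ContinuousLinearMap.comp_add, ht, hu]
    · rw [map_add, map_add, ContinuousLinearMap.add_comp, ContinuousLinearMap.comp_add, ht', hu']

end Amplify

/-! ### The structure of braided tensor products -/

section BraidPhase

variable {N : ℕ} [NeZero N] {ω : ℂ} {H K : Type*}
  [NormedAddCommGroup H] [InnerProductSpace ℂ H] [CompleteSpace H]
  [NormedAddCommGroup K] [InnerProductSpace ℂ K] [CompleteSpace K]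

/-- The degree projections resolve the identity, and `U t` is the scalar `ω ^ (t a)` on the vectors
of degree `a`. -/
theorem URep.op_eq_sum (hω : IsPrimitiveRoot ω N) (U : URep N H) (t : ZMod N) :
    U.op t = ∑ a, rootPow ω (t * a) • U.proj ω a := by
  calc U.op t = U.op t * ∑ a, U.proj ω a := by rw [U.sum_proj hω, mul_one]
    _ = ∑ a, rootPow ω (t * a) • U.proj ω a := by
      rw [Finset.mul_sum]
      exact Finset.sum_congr rfl fun a _ => U.op_mul_proj hω t a

/-- The unitary `v ⊗ w ↦ ω ^ (m n) v ⊗ w` for `v` of degree `m` and `w` of degree `n`. -/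
noncomputable def braidPhase (ω : ℂ) (U : URep N H) (V : URep N K) :
    HTensor H K →L[ℂ] HTensor H K :=
  ∑ p : ZMod N × ZMod N, rootPow ω (p.1 * p.2) • tmap (U.proj ω p.1) (V.proj ω p.2)

/-- Summing over the degree of the first vector alone reassembles the operators `U b`. In this form
the phase acts on the first leg through the group only, so covariance computes conjugation of `x ⊗
1`. -/
theorem braidPhase_eq_left (hω : IsPrimitiveRoot ω N) (U : URep N H) (V : URep N K) :
    braidPhase ω U V = ∑ b, tmap (U.op b) (V.proj ω b) := by
  rw [braidPhase, Fintype.sum_prod_type, Finset.sum_comm]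
  refine Finset.sum_congr rfl fun b _ => ?_
  rw [U.op_eq_sum hω, tmap_sum_left]
  refine Finset.sum_congr rfl fun a _ => ?_
  rw [tmap_smul_left, mul_comm]

theorem braidPhase_eq_right (hω : IsPrimitiveRoot ω N) (U : URep N H) (V : URep N K) :
    braidPhase ω U V = ∑ a, tmap (U.proj ω a) (V.op a) := by
  rw [braidPhase, Fintype.sum_prod_type]
  refine Finset.sum_congr rfl fun b _ => ?_
  rw [V.op_eq_sum hω, tmap_sum_right]
  refine Finset.sum_congr rfl fun a _ => ?_
  rw [tmap_smul_right]

theorem braid_eq (U : URep N H) (V : URep N K) :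
    braid ω U V = tflip H K ∘L braidPhase ω U V := rfl

theorem tflip_comp_braid (U : URep N H) (V : URep N K) :
    tflip K H ∘L braid ω U V = braidPhase ω U V := by
  rw [braid_eq, ← ContinuousLinearMap.comp_assoc, tflip_tflip]
  rfl

theorem braidPhase_comp_braidDual (hω : IsPrimitiveRoot ω N) (U : URep N H) (V : URep N K) :
    braidPhase ω U V ∘L braidDual ω U V = tflip K H := by
  rw [← tflip_comp_braid, ContinuousLinearMap.comp_assoc, braid_comp_braidDual hω]
  rfl

theorem adjoint_braidPhase (hω : IsPrimitiveRoot ω N) (U : URep N H) (V : URep N K) :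
    (braidPhase ω U V).adjoint = braidDual ω U V ∘L tflip H K := by
  rw [← tflip_comp_braid, ContinuousLinearMap.adjoint_comp, adjoint_braid hω, adjoint_tflip]

theorem adjoint_braidPhase_comp (hω : IsPrimitiveRoot ω N) (U : URep N H) (V : URep N K) :
    (braidPhase ω U V).adjoint ∘L braidPhase ω U V = 1 := by
  rw [adjoint_braidPhase hω, ContinuousLinearMap.comp_assoc, ← braid_eq, braidDual_comp_braid hω]

theorem braidPhase_comp_adjoint (hω : IsPrimitiveRoot ω N) (U : URep N H) (V : URep N K) :
    braidPhase ω U V ∘L (braidPhase ω U V).adjoint = 1 := by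
  rw [adjoint_braidPhase hω, ← ContinuousLinearMap.comp_assoc, braidPhase_comp_braidDual hω,
    tflip_tflip]

theorem adjoint_tflip_comp : (tflip H K).adjoint ∘L tflip H K = 1 := by
  rw [adjoint_tflip, tflip_tflip]

theorem tflip_comp_adjoint : tflip H K ∘L (tflip H K).adjoint = 1 := by
  rw [adjoint_tflip, tflip_tflip]

end BraidPhase

/-! ### The two legs inside `X ⊗ B(K)` and `B(H) ⊗ Y` -/

section Braided

variable {N : ℕ} [NeZero N] {ω : ℂ} {X Y : Type*} [CStarAlgebra X] [CStarAlgebra Y]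
  {α : Coaction N X} {β : Coaction N Y} {H K : Type*}
  [NormedAddCommGroup H] [InnerProductSpace ℂ H] [CompleteSpace H]
  [NormedAddCommGroup K] [InnerProductSpace ℂ K] [CompleteSpace K]

theorem CovariantRep.π_ρ_mul_op (r : CovariantRep α H) (x : X) (t : ZMod N) :
    r.π (α.ρ x t) * r.U.op t = r.U.op t * r.π x := by
  rw [r.equivariant, mul_assoc, URep.star_op, ← URep.op_add, neg_add_cancel, URep.op_zero, mul_one]

/-- On vectors whose second factor has degree `b` the phase is `U b ⊗ 1`, and conjugation by `U b`
is `ρ_b`. The left-hand operator is the amplification of `∑ b, ρ_b(x) ⊗ Q_b`, an element of `X ⊗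
B(K)`. -/
theorem braidPhase_comp_opJ₁ (hω : IsPrimitiveRoot ω N) (r : CovariantRep α H)
    (s : CovariantRep β K) (x : X) :
    (∑ b, tmap (r.π (α.ρ x b)) (s.U.proj ω b)) ∘L braidPhase ω r.U s.U =
      braidPhase ω r.U s.U ∘L opJ₁ r s x := by
  rw [braidPhase_eq_left hω, ← ContinuousLinearMap.mul_def, ← ContinuousLinearMap.mul_def,
    opJ₁_apply, Finset.sum_mul, Finset.sum_mul]
  refine Finset.sum_congr rfl fun b _ => ?_
  rw [Finset.mul_sum, Finset.sum_eq_single b]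
  · rw [tmap_mul, tmap_mul, s.U.proj_mul_proj hω, if_pos rfl, mul_one, r.π_ρ_mul_op]
  · intro c _ hc
    rw [tmap_mul, s.U.proj_mul_proj hω, if_neg hc.symm, tmap_zero_right]
  · simp

/-- The phase cancels the one in the dual braiding and only flips remain, so `j₂ y` becomes an
ordinary second leg. -/
theorem braidPhase_comp_opJ₂ (hω : IsPrimitiveRoot ω N) (r : CovariantRep α H)
    (s : CovariantRep β K) (y : Y) :
    tmap 1 (s.π y) ∘L braidPhase ω r.U s.U = braidPhase ω r.U s.U ∘L opJ₂ hω r s y := by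
  rw [opJ₂_apply, ← ContinuousLinearMap.comp_assoc, braidPhase_comp_braidDual hω,
    ← ContinuousLinearMap.comp_assoc, tflip_comp_tmap, ContinuousLinearMap.comp_assoc,
    tflip_comp_braid]

/-- On vectors whose first factor has degree `a` the phase is `1 ⊗ V a`, so undoing the conjugation
of `braidPhase_comp_opJ₂` twists `y` by `ρ_{-a}`. The degree `a` is that of the incoming vector of
`H`. -/
theorem opJ₂_eq_sum (hω : IsPrimitiveRoot ω N) (r : CovariantRep α H)
    (s : CovariantRep β K) (y : Y) :
    opJ₂ hω r s y = ∑ a, tmap (r.U.proj ω a) (s.π (β.ρ y (-a))) := by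
  have h : braidPhase ω r.U s.U ∘L (∑ a, tmap (r.U.proj ω a) (s.π (β.ρ y (-a)))) =
      braidPhase ω r.U s.U ∘L opJ₂ hω r s y := by
    rw [← braidPhase_comp_opJ₂, braidPhase_eq_right hω, ← ContinuousLinearMap.mul_def,
      ← ContinuousLinearMap.mul_def, Finset.mul_sum, Finset.mul_sum]
    refine Finset.sum_congr rfl fun a _ => ?_
    rw [Finset.sum_mul, Finset.sum_eq_single a]
    · rw [tmap_mul, tmap_mul, r.U.proj_mul_proj hω, if_pos rfl, one_mul, s.equivariant,
        URep.star_op, neg_neg, ← mul_assoc, ← mul_assoc, ← URep.op_add, add_neg_cancel,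
        URep.op_zero, one_mul]
    · intro c _ hc
      rw [tmap_mul, r.U.proj_mul_proj hω, if_neg hc, tmap_zero_left]
    · simp
  have h1 := adjoint_braidPhase_comp hω r.U s.U
  rw [← ContinuousLinearMap.mul_def] at h1
  rw [← ContinuousLinearMap.mul_def, ← ContinuousLinearMap.mul_def] at h
  rw [← one_mul (opJ₂ hω r s y), ← h1, mul_assoc, ← h, ← mul_assoc, h1, one_mul]

/-- Flipping places `Y` in the first factor, so that the comparison of amplifications, which varies
the first factor, also handles the second leg. -/
theorem tflip_comp_opJ₁ (r : CovariantRep α H) (s : CovariantRep β K) (x : X) :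
    tmap 1 (r.π x) ∘L tflip H K = tflip H K ∘L opJ₁ r s x := by
  rw [opJ₁_apply, tflip_comp_tmap]

theorem tflip_comp_opJ₂ (hω : IsPrimitiveRoot ω N) (r : CovariantRep α H)
    (s : CovariantRep β K) (y : Y) :
    (∑ a, tmap (s.π (β.ρ y (-a))) (r.U.proj ω a)) ∘L tflip H K =
      tflip H K ∘L opJ₂ hω r s y := by
  rw [opJ₂_eq_sum]
  refine htensor_ext fun v w => ?_
  simp only [ContinuousLinearMap.comp_apply, sum_apply, map_sum, tmap_htmul, tflip_htmul]

theorem norm_braidedIncl (hω : IsPrimitiveRoot ω N) (r : CovariantRep α H)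
    (s : CovariantRep β K) (T : Braided hω r s) : ‖braidedIncl hω r s T‖ = ‖T‖ :=
  NonUnitalStarAlgHom.norm_map _ (braidedIncl_injective hω r s) T

/-- The braided tensor product is generated by the images of `j₁` and `j₂`. -/
theorem generated_range_eq_top (hω : IsPrimitiveRoot ω N) (r : CovariantRep α H)
    (s : CovariantRep β K) :
    generated (Set.range (Sum.elim (j₁ hω r s) (j₂ hω r s))) = ⊤ := by
  set S := generated (Set.range (Sum.elim (j₁ hω r s) (j₂ hω r s))) with hS
  have hgen : ∀ i, Sum.elim (j₁ hω r s) (j₂ hω r s) i ∈ S := fun i =>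
    subset_generated _ ⟨i, rfl⟩
  -- The inclusion is isometric, so a closed subalgebra of the braided tensor product remains closed
  -- among all bounded operators. The subalgebra defining `Braided` is then contained in this image.
  have hclosed : IsClosed (braidedIncl hω r s '' (S : Set (Braided hω r s))) :=
    (NonUnitalStarAlgHom.isometry (braidedIncl hω r s)
      (braidedIncl_injective hω r s)).isClosedEmbedding.isClosedMap _
      (isClosed_generated _)
  have hle : braidedSubalgebra hω r s ≤ S.map (braidedIncl hω r s) := by
    refine StarSubalgebra.topologicalClosure_minimal (StarAlgebra.adjoin_le ?_) hclosed
    rintro _ ⟨x, y, rfl⟩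
    exact ⟨j₁ hω r s x * j₂ hω r s y, mul_mem (hgen (Sum.inl x)) (hgen (Sum.inr y)), rfl⟩
  refine eq_top_iff.2 fun T _ => ?_
  obtain ⟨T', hT', h⟩ := hle T.2
  rwa [← braidedIncl_injective hω r s h]

theorem braided_hom_ext {hω : IsPrimitiveRoot ω N} {r : CovariantRep α H}
    {s : CovariantRep β K} {B : Type*} [CStarAlgebra B] {f g : Braided hω r s →⋆ₐ[ℂ] B}
    (h₁ : ∀ x, f (j₁ hω r s x) = g (j₁ hω r s x)) (h₂ : ∀ y, f (j₂ hω r s y) = g (j₂ hω r s y)) :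
    f = g := by
  refine starAlgHom_ext_of_generators (generated_range_eq_top hω r s) ?_
  rintro _ ⟨i | i, rfl⟩
  · exact h₁ i
  · exact h₂ i

end Braided

/-! ### Functoriality of braided tensor products -/

section Functoriality

open scoped TensorProduct

variable {N : ℕ} [NeZero N] {ω : ℂ} {X₁ X₂ Y₁ Y₂ : Type*}
  [CStarAlgebra X₁] [CStarAlgebra X₂] [CStarAlgebra Y₁] [CStarAlgebra Y₂]
  {α₁ : Coaction N X₁} {α₂ : Coaction N X₂} {β₁ : Coaction N Y₁} {β₂ : Coaction N Y₂}
  {H₁ H₂ K₁ K₂ : Type*}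
  [NormedAddCommGroup H₁] [InnerProductSpace ℂ H₁] [CompleteSpace H₁]
  [NormedAddCommGroup H₂] [InnerProductSpace ℂ H₂] [CompleteSpace H₂]
  [NormedAddCommGroup K₁] [InnerProductSpace ℂ K₁] [CompleteSpace K₁]
  [NormedAddCommGroup K₂] [InnerProductSpace ℂ K₂] [CompleteSpace K₂]

theorem IsBraidedMap.map_j₁ {hω : IsPrimitiveRoot ω N}
    {r₁ : CovariantRep α₁ H₁} {r₂ : CovariantRep α₂ H₂}
    {s₁ : CovariantRep β₁ K₁} {s₂ : CovariantRep β₂ K₂} {f : X₁ →⋆ₐ[ℂ] Y₁} {g : X₂ →⋆ₐ[ℂ] Y₂}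
    {F : Braided hω r₁ r₂ →⋆ₐ[ℂ] Braided hω s₁ s₂} (hF : IsBraidedMap hω r₁ r₂ s₁ s₂ f g F)
    (x : X₁) : F (j₁ hω r₁ r₂ x) = j₁ hω s₁ s₂ (f x) := by
  simpa using hF.2 x 1

theorem IsBraidedMap.map_j₂ {hω : IsPrimitiveRoot ω N}
    {r₁ : CovariantRep α₁ H₁} {r₂ : CovariantRep α₂ H₂}
    {s₁ : CovariantRep β₁ K₁} {s₂ : CovariantRep β₂ K₂} {f : X₁ →⋆ₐ[ℂ] Y₁} {g : X₂ →⋆ₐ[ℂ] Y₂}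
    {F : Braided hω r₁ r₂ →⋆ₐ[ℂ] Braided hω s₁ s₂} (hF : IsBraidedMap hω r₁ r₂ s₁ s₂ f g F)
    (y : X₂) : F (j₂ hω r₁ r₂ y) = j₂ hω s₁ s₂ (g y) := by
  simpa using hF.2 1 y

/-- The coaction at a point of `ℤ/N`. -/
noncomputable def Coaction.act {X : Type*} [CStarAlgebra X] (α : Coaction N X) (t : ZMod N) :
    X →⋆ₐ[ℂ] X :=
  (Pi.evalStarAlgHom ℂ (fun _ : ZMod N => X) t).comp α.ρ

theorem Coaction.act_apply {X : Type*} [CStarAlgebra X] (α : Coaction N X) (t : ZMod N) (x : X) :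
    α.act t x = α.ρ x t := rfl

theorem norm_eval_braided (hω : IsPrimitiveRoot ω N) (r : CovariantRep α₁ H₁)
    (s : CovariantRep α₂ H₂) {ι : Type*} (g : ι → Braided hω r s) (p : FreeStarAlgebra ι) :
    ‖FreeStarAlgebra.eval g p‖ =
      ‖FreeStarAlgebra.eval (fun i => braidedIncl hω r s (g i)) p‖ := by
  rw [← norm_braidedIncl, FreeStarAlgebra.map_eval]

/-- The braided tensor product of equivariant homomorphisms exists as soon as it is contractive on
noncommutative `*`-polynomials in the generators. -/
theorem exists_isBraidedMap (hω : IsPrimitiveRoot ω N)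
    (r₁ : CovariantRep α₁ H₁) (r₂ : CovariantRep α₂ H₂)
    (s₁ : CovariantRep β₁ K₁) (s₂ : CovariantRep β₂ K₂) {f : X₁ →⋆ₐ[ℂ] Y₁} {g : X₂ →⋆ₐ[ℂ] Y₂}
    (hf : IsEquivariant α₁ β₁ f) (hg : IsEquivariant α₂ β₂ g)
    (hn : ∀ p : FreeStarAlgebra (X₁ ⊕ X₂),
      ‖FreeStarAlgebra.eval
        (Sum.elim (fun x => opJ₁ s₁ s₂ (f x)) (fun y => opJ₂ hω s₁ s₂ (g y))) p‖ ≤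
      ‖FreeStarAlgebra.eval (Sum.elim (opJ₁ r₁ r₂) (opJ₂ hω r₁ r₂)) p‖) :
    ∃ F : Braided hω r₁ r₂ →⋆ₐ[ℂ] Braided hω s₁ s₂, IsBraidedMap hω r₁ r₂ s₁ s₂ f g F := by
  obtain ⟨F, hF⟩ := exists_starAlgHom_of_generators (Sum.elim (j₁ hω r₁ r₂) (j₂ hω r₁ r₂))
    (Sum.elim (fun x => j₁ hω s₁ s₂ (f x)) (fun y => j₂ hω s₁ s₂ (g y)))
    (generated_range_eq_top hω r₁ r₂) (fun p => by
      rw [norm_eval_braided, norm_eval_braided]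
      convert hn p using 4
      · ext1 i; cases i <;> rfl
      · ext1 i; cases i <;> rfl)
  have h₁ : ∀ x, F (j₁ hω r₁ r₂ x) = j₁ hω s₁ s₂ (f x) := fun x => hF (Sum.inl x)
  have h₂ : ∀ y, F (j₂ hω r₁ r₂ y) = j₂ hω s₁ s₂ (g y) := fun y => hF (Sum.inr y)
  refine ⟨F, fun T t => ?_, fun x y => by rw [map_mul, h₁, h₂]⟩
  -- Equivariance is an equality of two `*`-homomorphisms, so it need only be checked on the two
  -- legs.
  have h : ((braidedCoaction hω s₁ s₂).act t).comp F =
      F.comp ((braidedCoaction hω r₁ r₂).act t) := by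
    refine braided_hom_ext (fun x => ?_) (fun y => ?_)
    · rw [StarAlgHom.comp_apply, StarAlgHom.comp_apply, Coaction.act_apply, Coaction.act_apply,
        h₁, j₁_equivariant, j₁_equivariant, h₁, hf]
    · rw [StarAlgHom.comp_apply, StarAlgHom.comp_apply, Coaction.act_apply, Coaction.act_apply,
        h₂, j₂_equivariant, j₂_equivariant, h₂, hg]
  exact congrArg (fun G : Braided hω r₁ r₂ →⋆ₐ[ℂ] Braided hω s₁ s₂ => G T) h

theorem isEquivariant_id {X : Type*} [CStarAlgebra X] (α : Coaction N X) :
    IsEquivariant α α (StarAlgHom.id ℂ X) := fun _ _ => rfl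

/-- The map `f ⊠ id`. -/
theorem exists_isBraidedMap_left (hω : IsPrimitiveRoot ω N)
    (r₁ : CovariantRep α₁ H₁) (r₂ : CovariantRep α₂ H₂) (s₁ : CovariantRep β₁ K₁)
    {f : X₁ →⋆ₐ[ℂ] Y₁} (hf : IsEquivariant α₁ β₁ f) :
    ∃ F : Braided hω r₁ r₂ →⋆ₐ[ℂ] Braided hω s₁ r₂,
      IsBraidedMap hω r₁ r₂ s₁ r₂ f (StarAlgHom.id ℂ X₂) F := by
  refine exists_isBraidedMap hω r₁ r₂ s₁ r₂ hf (isEquivariant_id α₂) fun p => ?_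
  -- The representation `s₁.π ∘ f` need not be faithful, since `f` need not be injective.
  -- Faithfulness is required only of `r₁`.
  refine norm_eval_le_of_amplify r₁.injective (s₁.π.comp f)
    (adjoint_braidPhase_comp hω r₁.U r₂.U) (braidPhase_comp_adjoint hω r₁.U r₂.U)
    (adjoint_braidPhase_comp hω s₁.U r₂.U) (braidPhase_comp_adjoint hω s₁.U r₂.U) _ _ ?_ ?_ p
  · rintro (x | y)
    · exact ⟨Sum.inl (star x), by simp [map_star], by simp [map_star]⟩
    · exact ⟨Sum.inr (star y), by simp [map_star], by simp [map_star]⟩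
  · rintro (x | y)
    · refine ⟨∑ b, (α₁.ρ x b) ⊗ₜ[ℂ] (r₂.U.proj ω b), ?_, ?_⟩
      · rw [map_sum, Sum.elim_inl, ← braidPhase_comp_opJ₁ hω]
        simp only [amplify_tmul]
      · rw [map_sum, Sum.elim_inl, ← braidPhase_comp_opJ₁ hω]
        simp only [amplify_tmul, StarAlgHom.comp_apply, hf x]
    · refine ⟨1 ⊗ₜ[ℂ] (r₂.π y), ?_, ?_⟩
      · rw [Sum.elim_inr, ← braidPhase_comp_opJ₂, amplify_tmul, map_one]
      · rw [Sum.elim_inr, ← braidPhase_comp_opJ₂, amplify_tmul, map_one]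
        rfl

/-- The map `id ⊠ g`. -/
theorem exists_isBraidedMap_right (hω : IsPrimitiveRoot ω N)
    (r₁ : CovariantRep α₁ H₁) (r₂ : CovariantRep α₂ H₂) (s₂ : CovariantRep β₂ K₂)
    {g : X₂ →⋆ₐ[ℂ] Y₂} (hg : IsEquivariant α₂ β₂ g) :
    ∃ F : Braided hω r₁ r₂ →⋆ₐ[ℂ] Braided hω r₁ s₂,
      IsBraidedMap hω r₁ r₂ r₁ s₂ (StarAlgHom.id ℂ X₁) g F := by
  refine exists_isBraidedMap hω r₁ r₂ r₁ s₂ (isEquivariant_id α₁) hg fun p => ?_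
  -- Here the second leg varies, so the flip takes the place of `braidPhase` and the space of `r₁`
  -- becomes the fixed factor.
  refine norm_eval_le_of_amplify r₂.injective (s₂.π.comp g)
    adjoint_tflip_comp tflip_comp_adjoint adjoint_tflip_comp tflip_comp_adjoint _ _ ?_ ?_ p
  · rintro (x | y)
    · exact ⟨Sum.inl (star x), by simp [map_star], by simp [map_star]⟩
    · exact ⟨Sum.inr (star y), by simp [map_star], by simp [map_star]⟩
  · rintro (x | y)
    · refine ⟨1 ⊗ₜ[ℂ] (r₁.π x), ?_, ?_⟩
      · rw [Sum.elim_inl, ← tflip_comp_opJ₁, amplify_tmul, map_one]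
      · rw [Sum.elim_inl, ← tflip_comp_opJ₁, amplify_tmul, map_one]
        rfl
    · refine ⟨∑ a, (α₂.ρ y (-a)) ⊗ₜ[ℂ] (r₁.U.proj ω a), ?_, ?_⟩
      · rw [map_sum, Sum.elim_inr, ← tflip_comp_opJ₂]
        simp only [amplify_tmul]
      · rw [map_sum, Sum.elim_inr, ← tflip_comp_opJ₂]
        simp only [amplify_tmul, StarAlgHom.comp_apply, hg y]

end Functoriality

/-! ### Associativity of Hilbert space tensor products -/

section Assoc

open scoped TensorProduct

variable {H K M : Type*}
  [NormedAddCommGroup H] [InnerProductSpace ℂ H] [CompleteSpace H]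
  [NormedAddCommGroup K] [InnerProductSpace ℂ K] [CompleteSpace K]
  [NormedAddCommGroup M] [InnerProductSpace ℂ M] [CompleteSpace M]

/-- Tensoring on the right with a fixed vector. -/
noncomputable def htmulRight (H : Type*) [NormedAddCommGroup H] [InnerProductSpace ℂ H]
    (y : K) : H →L[ℂ] HTensor H K :=
  LinearMap.mkContinuous
    { toFun := fun x => htmul x y
      map_add' := fun x x' => by rw [htmul, TensorProduct.add_tmul, map_add]; rfl
      map_smul' := fun c x => by rw [htmul, ← TensorProduct.smul_tmul', map_smul]; rfl } ‖y‖
    fun x => by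
      change ‖htmul x y‖ ≤ _
      rw [htmul, LinearIsometry.norm_map, TensorProduct.norm_tmul, mul_comm]

/-- Tensoring on the left with a fixed vector. -/
noncomputable def htmulLeft (K : Type*) [NormedAddCommGroup K] [InnerProductSpace ℂ K]
    (x : H) : K →L[ℂ] HTensor H K :=
  LinearMap.mkContinuous
    { toFun := fun y => htmul x y
      map_add' := fun y y' => by rw [htmul, TensorProduct.tmul_add, map_add]; rfl
      map_smul' := fun c y => by rw [htmul, TensorProduct.tmul_smul, map_smul]; rfl } ‖x‖
    fun y => by
      change ‖htmul x y‖ ≤ _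
      rw [htmul, LinearIsometry.norm_map, TensorProduct.norm_tmul]

/-- With the third vector fixed, both operators become bounded on `H ⊗ K`, where elementary tensors
already decide equality. -/
theorem htensor_ext₃ {E : Type*} [NormedAddCommGroup E] [NormedSpace ℂ E]
    {S T : HTensor (HTensor H K) M →L[ℂ] E}
    (h : ∀ x y z, S (htmul (htmul x y) z) = T (htmul (htmul x y) z)) : S = T :=
  htensor_ext fun u z => by
    have h1 : S ∘L htmulRight _ z = T ∘L htmulRight _ z := htensor_ext fun x y => h x y z
    exact congrArg (fun R => R u) h1

theorem htensor_ext₃' {E : Type*} [NormedAddCommGroup E] [NormedSpace ℂ E]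
    {S T : HTensor H (HTensor K M) →L[ℂ] E}
    (h : ∀ x y z, S (htmul x (htmul y z)) = T (htmul x (htmul y z))) : S = T :=
  htensor_ext fun x u => by
    have h1 : S ∘L htmulLeft _ x = T ∘L htmulLeft _ x := htensor_ext fun y z => h x y z
    exact congrArg (fun R => R u) h1

/-- The algebraic threefold tensor product in the Hilbert space one, bracketed to the left. -/
noncomputable def hcoeLeft (H K M : Type*) [NormedAddCommGroup H] [InnerProductSpace ℂ H]
    [NormedAddCommGroup K] [InnerProductSpace ℂ K]
    [NormedAddCommGroup M] [InnerProductSpace ℂ M] :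
    (H ⊗[ℂ] K) ⊗[ℂ] M →ₗᵢ[ℂ] HTensor (HTensor H K) M :=
  (hcoe (HTensor H K) M).comp (TensorProduct.mapIsometry (hcoe H K) LinearIsometry.id)

/-- The algebraic threefold tensor product in the Hilbert space one, bracketed to the right. -/
noncomputable def hcoeRight (H K M : Type*) [NormedAddCommGroup H] [InnerProductSpace ℂ H]
    [NormedAddCommGroup K] [InnerProductSpace ℂ K]
    [NormedAddCommGroup M] [InnerProductSpace ℂ M] :
    (H ⊗[ℂ] K) ⊗[ℂ] M →ₗᵢ[ℂ] HTensor H (HTensor K M) :=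
  ((hcoe H (HTensor K M)).comp (TensorProduct.mapIsometry LinearIsometry.id (hcoe K M))).comp
    (TensorProduct.assocIsometry ℂ H K M).toLinearIsometry

theorem hcoeLeft_tmul (x : H) (y : K) (z : M) :
    hcoeLeft H K M ((x ⊗ₜ y) ⊗ₜ z) = htmul (htmul x y) z := rfl

theorem hcoeRight_tmul (x : H) (y : K) (z : M) :
    hcoeRight H K M ((x ⊗ₜ y) ⊗ₜ z) = htmul x (htmul y z) := rfl

/-- A vector orthogonal to the range defines a functional vanishing on all threefold elementary
tensors, hence it is zero. -/
theorem denseRange_hcoeLeft : DenseRange (hcoeLeft H K M) := by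
  have h : (LinearMap.range (hcoeLeft H K M).toLinearMap).topologicalClosure = ⊤ := by
    rw [Submodule.topologicalClosure_eq_top_iff, Submodule.eq_bot_iff]
    intro w hw
    have h1 : innerSL ℂ w = 0 := htensor_ext₃ fun x y z => by
      rw [innerSL_apply_apply, ← hcoeLeft_tmul]
      exact Submodule.inner_left_of_mem_orthogonal
        (LinearMap.mem_range_self (hcoeLeft H K M).toLinearMap _) hw
    have h2 := congrArg (fun S : HTensor (HTensor H K) M →L[ℂ] ℂ => S w) h1
    simpa using h2
  exact Submodule.dense_iff_topologicalClosure_eq_top.2 h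

/-- The associator `(H ⊗ K) ⊗ M → H ⊗ (K ⊗ M)`. -/
noncomputable def hassoc (H K M : Type*) [NormedAddCommGroup H] [InnerProductSpace ℂ H]
    [NormedAddCommGroup K] [InnerProductSpace ℂ K]
    [NormedAddCommGroup M] [InnerProductSpace ℂ M] :
    HTensor (HTensor H K) M →L[ℂ] HTensor H (HTensor K M) :=
  (hcoeRight H K M).toLinearMap.extendOfNorm (hcoeLeft H K M).toLinearMap

theorem hassoc_hcoeLeft (a : (H ⊗[ℂ] K) ⊗[ℂ] M) :
    hassoc H K M (hcoeLeft H K M a) = hcoeRight H K M a :=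
  LinearMap.extendOfNorm_eq (e := (hcoeLeft H K M).toLinearMap) denseRange_hcoeLeft
    ⟨1, fun a => by
      rw [one_mul]
      exact ((hcoeRight H K M).norm_map a).trans_le ((hcoeLeft H K M).norm_map a).ge⟩ a

theorem hassoc_htmul (x : H) (y : K) (z : M) :
    hassoc H K M (htmul (htmul x y) z) = htmul x (htmul y z) := by
  rw [← hcoeLeft_tmul, hassoc_hcoeLeft, hcoeRight_tmul]

theorem adjoint_hassoc_comp : (hassoc H K M).adjoint ∘L hassoc H K M = 1 := by
  refine (ContinuousLinearMap.norm_map_iff_adjoint_comp_self _).1 fun u => ?_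
  refine denseRange_hcoeLeft.induction_on (p := fun u => ‖hassoc H K M u‖ = ‖u‖) u
    (isClosed_eq (by fun_prop) (by fun_prop)) fun a => ?_
  rw [hassoc_hcoeLeft, LinearIsometry.norm_map, LinearIsometry.norm_map]

/-- The isometry `hassoc` has every elementary tensor in its range, and `Z Z* Z = Z` makes `Z Z*`
the identity there. -/
theorem hassoc_comp_adjoint : hassoc H K M ∘L (hassoc H K M).adjoint = 1 :=
  htensor_ext₃' fun x y z => by
    rw [← hassoc_htmul]
    change hassoc H K M (((hassoc H K M).adjoint ∘L hassoc H K M) _) = _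
    rw [adjoint_hassoc_comp]
    rfl

theorem tmap_comp_hassoc (S : H →L[ℂ] H) (T : K →L[ℂ] K) (R : M →L[ℂ] M) :
    tmap S (tmap T R) ∘L hassoc H K M = hassoc H K M ∘L tmap (tmap S T) R :=
  htensor_ext₃ fun x y z => by
    simp only [ContinuousLinearMap.comp_apply, hassoc_htmul, tmap_htmul]

end Assoc

/-! ### Associativity of braided tensor products -/

section BraidedAssoc

variable {N : ℕ} [NeZero N] {ω : ℂ} {X Y Z : Type*} [CStarAlgebra X] [CStarAlgebra Y]
  [CStarAlgebra Z] {α : Coaction N X} {β : Coaction N Y} {γ : Coaction N Z} {H K M : Type*}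
  [NormedAddCommGroup H] [InnerProductSpace ℂ H] [CompleteSpace H]
  [NormedAddCommGroup K] [InnerProductSpace ℂ K] [CompleteSpace K]
  [NormedAddCommGroup M] [InnerProductSpace ℂ M] [CompleteSpace M]

/-- Under the diagonal representation degrees add: a tensor of degree `c` splits into parts of
degrees `a` and `c - a`. -/
theorem URep.proj_tensor (hω : IsPrimitiveRoot ω N) (U : URep N H) (V : URep N K) (c : ZMod N) :
    (U.tensor V).proj ω c = ∑ a, tmap (U.proj ω a) (V.proj ω (c - a)) := by
  have h : ∀ t, rootPow ω (-(t * c)) • (U.tensor V).op t =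
      ∑ a, tmap (U.proj ω a) (rootPow ω (-(t * (c - a))) • V.op t) := fun t => by
    rw [URep.op_tensor, U.op_eq_sum hω, tmap_sum_left, Finset.smul_sum]
    refine Finset.sum_congr rfl fun a _ => ?_
    rw [tmap_smul_left, tmap_smul_right, smul_smul, ← rootPow_add hω]
    congr 2
    ring
  rw [URep.proj, Finset.sum_congr rfl fun t _ => h t, Finset.sum_comm, Finset.smul_sum]
  refine Finset.sum_congr rfl fun a _ => ?_
  rw [← tmap_sum_right, ← tmap_smul_right]
  rfl

theorem hassoc_comp_opJ₁_j₁ (hω : IsPrimitiveRoot ω N) (r : CovariantRep α H)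
    (s : CovariantRep β K) (u : CovariantRep γ M) (x : X) :
    opJ₁ r (s.braided hω u) x ∘L hassoc H K M =
      hassoc H K M ∘L opJ₁ (r.braided hω s) u (j₁ hω r s x) := by
  have h : opJ₁ (r.braided hω s) u (j₁ hω r s x) = tmap (tmap (r.π x) 1) 1 := rfl
  rw [h, ← tmap_comp_hassoc, tmap_one]
  rfl

/-- In both bracketings the middle leg braids past the first only and acts as `∑ a, P_a ⊗ ρ_{-a}(y)
⊗ 1`; the right one uses that `j₁` is equivariant. -/
theorem hassoc_comp_opJ₁_j₂ (hω : IsPrimitiveRoot ω N) (r : CovariantRep α H)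
    (s : CovariantRep β K) (u : CovariantRep γ M) (y : Y) :
    opJ₂ hω r (s.braided hω u) (j₁ hω s u y) ∘L hassoc H K M =
      hassoc H K M ∘L opJ₁ (r.braided hω s) u (j₂ hω r s y) := by
  have h : opJ₁ (r.braided hω s) u (j₂ hω r s y) = tmap (opJ₂ hω r s y) 1 := rfl
  have h' : ∀ t, (s.braided hω u).π ((braidedCoaction hω s u).ρ (j₁ hω s u y) t) =
      tmap (s.π (β.ρ y t)) 1 := fun t => by
    rw [j₁_equivariant]
    rfl
  rw [h, opJ₂_eq_sum, opJ₂_eq_sum, tmap_sum_left]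
  refine htensor_ext₃ fun a b c => ?_
  simp only [ContinuousLinearMap.comp_apply, sum_apply, map_sum, hassoc_htmul, tmap_htmul, h']

/-- Braiding `z` past `H ⊗ K` at once twists it by the total degree, while braiding it past `K` and
`H` in succession twists it by each degree. Since `ρ` is an action these agree: both are `∑ P_a ⊗
Q_b ⊗ ρ_{-(a+b)}(z)`. -/
theorem hassoc_comp_opJ₂ (hω : IsPrimitiveRoot ω N) (r : CovariantRep α H)
    (s : CovariantRep β K) (u : CovariantRep γ M) (z : Z) :
    opJ₂ hω r (s.braided hω u) (j₂ hω s u z) ∘L hassoc H K M =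
      hassoc H K M ∘L opJ₂ hω (r.braided hω s) u z := by
  have h : ∀ t, (s.braided hω u).π ((braidedCoaction hω s u).ρ (j₂ hω s u z) t) =
      ∑ b, tmap (s.U.proj ω b) (u.π (γ.ρ z (-b + t))) := fun t => by
    rw [j₂_equivariant]
    refine (opJ₂_eq_sum hω s u (γ.ρ z t)).trans ?_
    simp only [γ.coassoc]
  have h' : ∀ c, (r.braided hω s).U.proj ω c =
      ∑ a, tmap (r.U.proj ω a) (s.U.proj ω (c - a)) := URep.proj_tensor hω r.U s.U
  rw [opJ₂_eq_sum, opJ₂_eq_sum]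
  simp only [h, h', tmap_sum_left, tmap_sum_right]
  rw [Finset.sum_comm (γ := ZMod N) (f := fun c a => tmap (tmap (r.U.proj ω a)
    (s.U.proj ω (c - a))) (u.π (γ.ρ z (-c))))]
  refine htensor_ext₃ fun v w x => ?_
  simp only [ContinuousLinearMap.comp_apply, sum_apply, map_sum, hassoc_htmul, tmap_htmul]
  -- The total degree on the left bracketing is `c = b + a`.
  refine Finset.sum_congr rfl fun a _ => Fintype.sum_equiv (Equiv.addRight a) _ _ fun b => ?_
  rw [Equiv.coe_addRight, add_sub_cancel_right, neg_add]

/-- Unitarily equivalent generators satisfy the same norm identities. -/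
theorem norm_eval_eq_of_intertwine {Z : H →L[ℂ] K} (h1 : Z.adjoint ∘L Z = 1)
    (h2 : Z ∘L Z.adjoint = 1) {ι : Type*} (g : ι → H →L[ℂ] H) (g' : ι → K →L[ℂ] K)
    (h : ∀ i, g' i ∘L Z = Z ∘L g i) (p : FreeStarAlgebra ι) :
    ‖FreeStarAlgebra.eval g' p‖ = ‖FreeStarAlgebra.eval g p‖ := by
  refine norm_eq_of_intertwine h1 h2 ?_
  induction p using FreeStarAlgebra.induction with
  | h1 c =>
    rw [AlgHomClass.commutes, AlgHomClass.commutes, Algebra.algebraMap_eq_smul_one,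
      Algebra.algebraMap_eq_smul_one, ContinuousLinearMap.comp_smul,
      ContinuousLinearMap.smul_comp]
    rfl
  | h2 a =>
    obtain ⟨i, e⟩ := a
    cases e
    · change FreeStarAlgebra.eval g' (FreeStarAlgebra.gen i) ∘L Z =
        Z ∘L FreeStarAlgebra.eval g (FreeStarAlgebra.gen i)
      rw [FreeStarAlgebra.eval_gen, FreeStarAlgebra.eval_gen, h]
    · rw [← FreeStarAlgebra.star_gen, map_star, map_star, FreeStarAlgebra.eval_gen,
        FreeStarAlgebra.eval_gen, ContinuousLinearMap.star_eq_adjoint,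
        ContinuousLinearMap.star_eq_adjoint]
      -- Taking adjoints gives an intertwining by `Z*` in the opposite direction; unitarity of `Z`
      -- turns it back into one by `Z`.
      have e1 := congrArg ContinuousLinearMap.adjoint (h i)
      rw [ContinuousLinearMap.adjoint_comp, ContinuousLinearMap.adjoint_comp] at e1
      calc (g' i).adjoint ∘L Z = (Z ∘L Z.adjoint) ∘L (g' i).adjoint ∘L Z := by rw [h2]; rfl
        _ = Z ∘L (Z.adjoint ∘L (g' i).adjoint) ∘L Z := rfl
        _ = Z ∘L (g i).adjoint ∘L (Z.adjoint ∘L Z) := by rw [e1]; rfl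
        _ = Z ∘L (g i).adjoint := by rw [h1]; rfl
  | h3 x y hx hy =>
    rw [map_mul, map_mul, ContinuousLinearMap.mul_def, ContinuousLinearMap.mul_def,
      ContinuousLinearMap.comp_assoc, hy, ← ContinuousLinearMap.comp_assoc, hx,
      ContinuousLinearMap.comp_assoc]
  | h4 x y hx hy =>
    rw [map_add, map_add, ContinuousLinearMap.add_comp, ContinuousLinearMap.comp_add, hx, hy]

theorem generated_eq_top_of_mem (hω : IsPrimitiveRoot ω N) (r : CovariantRep α H)
    (s : CovariantRep β K) {S : Set (Braided hω r s)} (h₁ : ∀ x, j₁ hω r s x ∈ generated S)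
    (h₂ : ∀ y, j₂ hω r s y ∈ generated S) : generated S = ⊤ := by
  rw [eq_top_iff, ← generated_range_eq_top hω r s]
  refine generated_le ?_ (isClosed_generated S)
  rintro _ ⟨i | i, rfl⟩
  · exact h₁ i
  · exact h₂ i

/-- A homomorphism maps the algebra generated by a set into every closed algebra that contains the
images of the generators. -/
theorem map_mem_generated {B B' : Type*} [CStarAlgebra B] [CStarAlgebra B'] (f : B →⋆ₐ[ℂ] B')
    {S : Set B} {S' : Set B'} (hS : generated S = ⊤) (h : ∀ x ∈ S, f x ∈ generated S') (x : B) :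
    f x ∈ generated S' := by
  have hle : generated S ≤ (generated S').comap f :=
    generated_le h ((isClosed_generated S').preimage (continuous_starAlgHom f))
  exact hle (hS ▸ trivial : x ∈ generated S)

/-- The three embeddings into the iterated braided tensor product bracketed to the left. -/
noncomputable def embLeft (hω : IsPrimitiveRoot ω N) (r : CovariantRep α H)
    (s : CovariantRep β K) (u : CovariantRep γ M) :
    (X ⊕ Y) ⊕ Z → Braided hω (r.braided hω s) u :=
  Sum.elim (fun i => j₁ hω (r.braided hω s) u (Sum.elim (j₁ hω r s) (j₂ hω r s) i))
    (j₂ hω (r.braided hω s) u)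

/-- The three embeddings into the iterated braided tensor product bracketed to the right. -/
noncomputable def embRight (hω : IsPrimitiveRoot ω N) (r : CovariantRep α H)
    (s : CovariantRep β K) (u : CovariantRep γ M) :
    (X ⊕ Y) ⊕ Z → Braided hω r (s.braided hω u) :=
  Sum.elim (Sum.elim (j₁ hω r (s.braided hω u))
    (fun y => j₂ hω r (s.braided hω u) (j₁ hω s u y)))
    (fun z => j₂ hω r (s.braided hω u) (j₂ hω s u z))

theorem generated_range_embLeft (hω : IsPrimitiveRoot ω N) (r : CovariantRep α H)
    (s : CovariantRep β K) (u : CovariantRep γ M) :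
    generated (Set.range (embLeft hω r s u)) = ⊤ := by
  refine generated_eq_top_of_mem hω _ _ (fun T => ?_) (fun z => subset_generated _ ⟨Sum.inr z, rfl⟩)
  refine map_mem_generated (j₁ hω (r.braided hω s) u) (generated_range_eq_top hω r s) ?_ T
  rintro _ ⟨i, rfl⟩
  exact subset_generated _ ⟨Sum.inl i, rfl⟩

theorem generated_range_embRight (hω : IsPrimitiveRoot ω N) (r : CovariantRep α H)
    (s : CovariantRep β K) (u : CovariantRep γ M) :
    generated (Set.range (embRight hω r s u)) = ⊤ := by
  refine generated_eq_top_of_mem hω _ _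
    (fun x => subset_generated _ ⟨Sum.inl (Sum.inl x), rfl⟩) (fun T => ?_)
  refine map_mem_generated (j₂ hω r (s.braided hω u)) (generated_range_eq_top hω s u) ?_ T
  rintro _ ⟨i | i, rfl⟩
  · exact subset_generated _ ⟨Sum.inl (Sum.inr i), rfl⟩
  · exact subset_generated _ ⟨Sum.inr i, rfl⟩

theorem norm_eval_embRight (hω : IsPrimitiveRoot ω N) (r : CovariantRep α H)
    (s : CovariantRep β K) (u : CovariantRep γ M) (p : FreeStarAlgebra ((X ⊕ Y) ⊕ Z)) :
    ‖FreeStarAlgebra.eval (embRight hω r s u) p‖ = ‖FreeStarAlgebra.eval (embLeft hω r s u) p‖ := by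
  rw [norm_eval_braided, norm_eval_braided]
  refine norm_eval_eq_of_intertwine adjoint_hassoc_comp hassoc_comp_adjoint _ _ ?_ p
  rintro ((x | y) | z)
  · exact hassoc_comp_opJ₁_j₁ hω r s u x
  · exact hassoc_comp_opJ₁_j₂ hω r s u y
  · exact hassoc_comp_opJ₂ hω r s u z

/-- The canonical isomorphism between the two iterated braided tensor products. -/
theorem exists_associator (hω : IsPrimitiveRoot ω N) (r : CovariantRep α H)
    (s : CovariantRep β K) (u : CovariantRep γ M) :
    ∃ a : Braided hω (r.braided hω s) u ≃⋆ₐ[ℂ] Braided hω r (s.braided hω u),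
      ∀ i, a (embLeft hω r s u i) = embRight hω r s u i := by
  obtain ⟨F, hF⟩ := exists_starAlgHom_of_generators (embLeft hω r s u) (embRight hω r s u)
    (generated_range_embLeft hω r s u) fun p => (norm_eval_embRight hω r s u p).le
  obtain ⟨G, hG⟩ := exists_starAlgHom_of_generators (embRight hω r s u) (embLeft hω r s u)
    (generated_range_embRight hω r s u) fun p => (norm_eval_embRight hω r s u p).ge
  -- Equality of polynomial norms gives homomorphisms in both directions; they exchange the
  -- generating families, so they are mutually inverse.
  have hGF : G.comp F = StarAlgHom.id ℂ _ := by
    refine starAlgHom_ext_of_generators (generated_range_embLeft hω r s u) ?_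
    rintro _ ⟨i, rfl⟩
    rw [StarAlgHom.comp_apply, hF, hG]
    rfl
  have hFG : F.comp G = StarAlgHom.id ℂ _ := by
    refine starAlgHom_ext_of_generators (generated_range_embRight hω r s u) ?_
    rintro _ ⟨i, rfl⟩
    rw [StarAlgHom.comp_apply, hG, hF]
    rfl
  exact ⟨StarAlgEquiv.ofStarAlgHom F G hGF hFG, hF⟩

end BraidedAssoc

/-! ### Commutation relations and spanning sets -/

section Ideal

variable {B : Type*} [CStarAlgebra B]

/-- A closed subspace that contains the unit and is stable under left multiplication by generators
is everything. -/
theorem submodule_eq_top_of_generated {S : Set B} (hS : generated S = ⊤) {M : Submodule ℂ B}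
    (hM : IsClosed (M : Set B)) (h1 : 1 ∈ M)
    (h : ∀ x ∈ S, ∀ m ∈ M, x * m ∈ M ∧ star x * m ∈ M) : M = ⊤ := by
  -- Stability under `x` and under `star x` is proved together: the star case of the induction
  -- merely exchanges the two halves.
  have key : ∀ x ∈ StarAlgebra.adjoin ℂ S, ∀ m ∈ M, x * m ∈ M ∧ star x * m ∈ M := by
    intro x hx
    induction hx using StarAlgebra.adjoin_induction with
    | mem x hx => exact h x hx
    | algebraMap c =>
      intro m hm
      rw [← algebraMap_star_comm, ← Algebra.smul_def, ← Algebra.smul_def]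
      exact ⟨M.smul_mem _ hm, M.smul_mem _ hm⟩
    | add x y _ _ hx hy =>
      intro m hm
      rw [star_add, add_mul, add_mul]
      exact ⟨M.add_mem (hx m hm).1 (hy m hm).1, M.add_mem (hx m hm).2 (hy m hm).2⟩
    | mul x y _ _ hx hy =>
      intro m hm
      rw [star_mul, mul_assoc, mul_assoc]
      exact ⟨(hx _ (hy m hm).1).1, (hy _ (hx m hm).2).2⟩
    | star x _ hx =>
      intro m hm
      rw [star_star]
      exact ⟨(hx m hm).2, (hx m hm).1⟩
  refine eq_top_iff.2 fun x _ => ?_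
  have hx : x ∈ generated S := hS ▸ trivial
  exact closure_minimal (fun y hy => by simpa using (key y hy 1 h1).1) hM hx

/-- The closed linear span of a set. -/
noncomputable def closedSpan (S : Set B) : Submodule ℂ B := (Submodule.span ℂ S).topologicalClosure

theorem isClosed_closedSpan (S : Set B) : IsClosed (closedSpan S : Set B) :=
  Submodule.isClosed_topologicalClosure _

theorem subset_closedSpan (S : Set B) : S ⊆ closedSpan S := fun _ hx =>
  Submodule.le_topologicalClosure _ (Submodule.subset_span hx)

theorem closedSpan_le {S : Set B} {M : Submodule ℂ B} (hM : IsClosed (M : Set B)) (h : S ⊆ M) :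
    closedSpan S ≤ M :=
  Submodule.topologicalClosure_minimal _ (Submodule.span_le.2 h) hM

/-- The closed span of a set is stable under left multiplication by `a` if `a` maps the set
to it. -/
theorem mul_mem_closedSpan {S : Set B} {a : B} (h : ∀ x ∈ S, a * x ∈ closedSpan S) {m : B}
    (hm : m ∈ closedSpan S) : a * m ∈ closedSpan S :=
  closedSpan_le (M := (closedSpan S).comap (LinearMap.mulLeft ℂ a))
    ((isClosed_closedSpan S).preimage (continuous_const.mul continuous_id)) h hm

theorem map_sum_mul_mem {X ι : Type*} [CStarAlgebra X] [Fintype ι] (f : X →⋆ₐ[ℂ] B)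
    (M : Submodule ℂ B) (c : ι → X) (z : B) (h : ∀ i, f (c i) * z ∈ M) :
    f (∑ i, c i) * z ∈ M := by
  rw [map_sum, Finset.sum_mul]
  exact Submodule.sum_mem _ fun i _ => h i

end Ideal

/-! ### Decomposition into homogeneous components -/

section Homogeneous

variable {N : ℕ} [NeZero N] {ω : ℂ} {X : Type*} [CStarAlgebra X]

/-- The homogeneous elements of degree `n`. -/
def IsHomogeneous (ω : ℂ) (α : Coaction N X) (n : ZMod N) (x : X) : Prop :=
  ∀ t, α.ρ x t = rootPow ω (t * n) • x

/-- The homogeneous component of degree `n`. -/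
noncomputable def Coaction.component (ω : ℂ) (α : Coaction N X) (n : ZMod N) (x : X) : X :=
  (N : ℂ)⁻¹ • ∑ t, rootPow ω (-(t * n)) • α.ρ x t

/-- Averaging against a character: applying `ρ_s` shifts the summation index by `s`, which brings
out the factor `ω ^ (s n)`. -/
theorem Coaction.isHomogeneous_component (hω : IsPrimitiveRoot ω N) (α : Coaction N X) (n : ZMod N)
    (x : X) : IsHomogeneous ω α n (α.component ω n x) := by
  intro s
  rw [← Coaction.act_apply, Coaction.component, map_smul, map_sum, smul_comm, Finset.smul_sum (r := rootPow ω (s * n))]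
  congr 1
  refine Fintype.sum_equiv (Equiv.addLeft s) _ _ fun t => ?_
  rw [map_smul, Coaction.act_apply, α.coassoc, smul_smul, ← rootPow_add hω, Equiv.coe_addLeft]
  congr 2
  ring

/-- By orthogonality of characters, summing over all degrees leaves only the term `t = 0`, with
coefficient one. -/
theorem Coaction.sum_component (hω : IsPrimitiveRoot ω N) (α : Coaction N X)
    (h0 : ∀ x, α.ρ x 0 = x) (x : X) : ∑ n, α.component ω n x = x := by
  simp only [Coaction.component]
  rw [← Finset.smul_sum, Finset.sum_comm]
  have h : ∀ t : ZMod N, ∑ n : ZMod N, rootPow ω (-(t * n)) • α.ρ x t =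
      if t = 0 then (N : ℂ) • x else 0 := fun t => by
    have h2 : ∑ m : ZMod N, rootPow ω (-(t * m)) = ∑ m, rootPow ω (m * -t) :=
      Finset.sum_congr rfl fun m _ => by congr 1; ring
    rw [← Finset.sum_smul, h2, sum_rootPow hω]
    by_cases ht : t = 0
    · subst ht
      simp [h0]
    · simp [ht]
  rw [Finset.sum_congr rfl fun t _ => h t]
  simp [smul_smul, NeZero.ne N]

end Homogeneous

/-! ### Commutation of the two legs -/

section Commutation

variable {N : ℕ} [NeZero N] {ω : ℂ} {X Y : Type*} [CStarAlgebra X] [CStarAlgebra Y]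
  {α : Coaction N X} {β : Coaction N Y} {H K : Type*}
  [NormedAddCommGroup H] [InnerProductSpace ℂ H] [CompleteSpace H]
  [NormedAddCommGroup K] [InnerProductSpace ℂ K] [CompleteSpace K]
  (hω : IsPrimitiveRoot ω N) (r : CovariantRep α H) (s : CovariantRep β K)

/-- For homogeneous `y` the twist `ρ_{-a}` is the scalar `ω ^ (-a n)`, and these scalars reassemble
the projections `P_a` into `U (-n)`. -/
theorem opJ₂_of_isHomogeneous {n : ZMod N} {y : Y} (hy : IsHomogeneous ω β n y) :
    opJ₂ hω r s y = tmap (r.U.op (-n)) (s.π y) := by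
  rw [opJ₂_eq_sum, r.U.op_eq_sum hω, tmap_sum_left]
  refine Finset.sum_congr rfl fun a _ => ?_
  rw [hy, map_smul, tmap_smul_right, tmap_smul_left]
  congr 2
  ring

/-- The operator `U (-n)` in the first factor of `j₂ y` conjugates `x` into `ρ_{-n}(x)`. -/
theorem j₂_mul_j₁ {n : ZMod N} {y : Y} (hy : IsHomogeneous ω β n y) (x : X) :
    j₂ hω r s y * j₁ hω r s x = j₁ hω r s (α.ρ x (-n)) * j₂ hω r s y := by
  refine braidedIncl_injective hω r s ?_
  rw [map_mul, map_mul]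
  change opJ₂ hω r s y * opJ₁ r s x = opJ₁ r s (α.ρ x (-n)) * opJ₂ hω r s y
  rw [opJ₂_of_isHomogeneous hω r s hy, opJ₁_apply, opJ₁_apply, tmap_mul, tmap_mul, r.π_ρ_mul_op,
    one_mul, mul_one]

/-- After conjugation by `braidPhase`, a homogeneous `x` becomes `x ⊗ V m` and `y` becomes `1 ⊗ y`;
covariance of `V m` gives the twist of `y`. Here the first leg is homogeneous and the second
arbitrary, as reordering in the other direction requires. -/
theorem j₁_mul_j₂ {m : ZMod N} {x : X} (hx : IsHomogeneous ω α m x) (y : Y) :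
    j₁ hω r s x * j₂ hω r s y = j₂ hω r s (β.ρ y m) * j₁ hω r s x := by
  refine braidedIncl_injective hω r s ?_
  rw [map_mul, map_mul]
  change opJ₁ r s x * opJ₂ hω r s y = opJ₂ hω r s (β.ρ y m) * opJ₁ r s x
  set W := braidPhase ω r.U s.U with hW
  have hx' : tmap (r.π x) (s.U.op m) * W = W * opJ₁ r s x := by
    refine Eq.trans ?_ (braidPhase_comp_opJ₁ hω r s x)
    rw [← ContinuousLinearMap.mul_def]
    congr 1
    rw [s.U.op_eq_sum hω, tmap_sum_right]
    refine Finset.sum_congr rfl fun b _ => ?_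
    rw [hx, map_smul, tmap_smul_left, tmap_smul_right, mul_comm]
  have hy : ∀ y, tmap 1 (s.π y) * W = W * opJ₂ hω r s y := braidPhase_comp_opJ₂ hω r s
  have h : W * (opJ₁ r s x * opJ₂ hω r s y) = W * (opJ₂ hω r s (β.ρ y m) * opJ₁ r s x) := by
    rw [← mul_assoc, ← hx', mul_assoc, ← hy, ← mul_assoc, ← mul_assoc, ← hy, mul_assoc _ W, ← hx',
      ← mul_assoc, tmap_mul, tmap_mul, s.π_ρ_mul_op, one_mul, mul_one]
  have h1 : W.adjoint * W = 1 := adjoint_braidPhase_comp hω r.U s.U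
  rw [← one_mul (opJ₁ r s x * opJ₂ hω r s y), ← h1, mul_assoc, h, ← mul_assoc, h1, one_mul]

/-- Products `j₁ x * j₂ y` span the braided tensor product. -/
theorem closedSpan_j₁_mul_j₂ (h0 : ∀ y, β.ρ y 0 = y) :
    closedSpan {T | ∃ x y, T = j₁ hω r s x * j₂ hω r s y} = ⊤ := by
  have hgen := generated_range_eq_top hω r s
  refine submodule_eq_top_of_generated hgen (isClosed_closedSpan _)
    (subset_closedSpan _ ⟨1, 1, by rw [map_one, map_one, one_mul]⟩) ?_
  have hmul : ∀ i, ∀ m ∈ closedSpan {T | ∃ x y, T = j₁ hω r s x * j₂ hω r s y},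
      Sum.elim (j₁ hω r s) (j₂ hω r s) i * m ∈
        closedSpan {T | ∃ x y, T = j₁ hω r s x * j₂ hω r s y} := by
    rintro (x' | y') m hm
    · refine mul_mem_closedSpan ?_ hm
      rintro _ ⟨x, y, rfl⟩
      rw [Sum.elim_inl, ← mul_assoc, ← map_mul]
      exact subset_closedSpan _ ⟨_, _, rfl⟩
    · refine mul_mem_closedSpan ?_ hm
      rintro _ ⟨x, y, rfl⟩
      -- The commutation rule needs a homogeneous left factor, so `y'` is split into its components.
      rw [Sum.elim_inr, ← β.sum_component hω h0 y']
      refine map_sum_mul_mem _ _ _ _ fun n => ?_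
      rw [← mul_assoc, j₂_mul_j₁ hω r s (β.isHomogeneous_component hω n y'), mul_assoc, ← map_mul]
      exact subset_closedSpan _ ⟨_, _, rfl⟩
  rintro _ ⟨i | i, rfl⟩ m hm
  · refine ⟨hmul _ m hm, ?_⟩
    rw [Sum.elim_inl, ← map_star]
    exact hmul (Sum.inl (star i)) m hm
  · refine ⟨hmul _ m hm, ?_⟩
    rw [Sum.elim_inr, ← map_star]
    exact hmul (Sum.inr (star i)) m hm

/-- Products `j₂ y * j₁ x` span the braided tensor product. -/
theorem closedSpan_j₂_mul_j₁ (h0 : ∀ x, α.ρ x 0 = x) :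
    closedSpan {T | ∃ y x, T = j₂ hω r s y * j₁ hω r s x} = ⊤ := by
  have hgen := generated_range_eq_top hω r s
  refine submodule_eq_top_of_generated hgen (isClosed_closedSpan _)
    (subset_closedSpan _ ⟨1, 1, by rw [map_one, map_one, one_mul]⟩) ?_
  have hmul : ∀ i, ∀ m ∈ closedSpan {T | ∃ y x, T = j₂ hω r s y * j₁ hω r s x},
      Sum.elim (j₁ hω r s) (j₂ hω r s) i * m ∈
        closedSpan {T | ∃ y x, T = j₂ hω r s y * j₁ hω r s x} := by
    rintro (x' | y') m hm
    · refine mul_mem_closedSpan ?_ hm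
      rintro _ ⟨x, y, rfl⟩
      rw [Sum.elim_inl, ← α.sum_component hω h0 x']
      refine map_sum_mul_mem _ _ _ _ fun n => ?_
      rw [← mul_assoc, j₁_mul_j₂ hω r s (α.isHomogeneous_component hω n x'), mul_assoc, ← map_mul]
      exact subset_closedSpan _ ⟨_, _, rfl⟩
    · refine mul_mem_closedSpan ?_ hm
      rintro _ ⟨x, y, rfl⟩
      rw [Sum.elim_inr, ← mul_assoc, ← map_mul]
      exact subset_closedSpan _ ⟨_, _, rfl⟩
  rintro _ ⟨i | i, rfl⟩ m hm
  · refine ⟨hmul _ m hm, ?_⟩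
    rw [Sum.elim_inl, ← map_star]
    exact hmul (Sum.inl (star i)) m hm
  · refine ⟨hmul _ m hm, ?_⟩
    rw [Sum.elim_inr, ← map_star]
    exact hmul (Sum.inr (star i)) m hm

end Commutation

/-! ### The comultiplication -/

section Relations

variable {N : ℕ} [NeZero N] {ω : ℂ} {B : Type*} [Ring B] [StarRing B] [Algebra ℂ B]
  {q q' : ZMod N → ZMod N → B}

/-- The braided matrix product of two matrices satisfying the relations satisfies the relations. -/
theorem PermRelations.braidedMul (hω : IsPrimitiveRoot ω N) (h : PermRelations ω Eq q)
    (h' : PermRelations ω Eq q')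
    (hc : ∀ i j k l, q' k l * q i j = rootPow ω (-((l - k) * (j - i))) • (q i j * q' k l)) :
    PermRelations ω Eq (fun i j => ∑ k, q i k * q' k j) where
  zero_left i := by
    rw [Finset.sum_eq_single 0]
    · rw [h.zero_left, if_pos rfl, one_mul, h'.zero_left]
    · intro k _ hk
      rw [h.zero_left, if_neg hk, zero_mul]
    · simp
  zero_right i := by
    rw [Finset.sum_eq_single 0]
    · rw [h'.zero_right, if_pos rfl, mul_one, h.zero_right]
    · intro k _ hk
      rw [h'.zero_right, if_neg hk, mul_zero]
    · simp
  star_eq i j := by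
    rw [star_sum, Finset.smul_sum]
    refine Fintype.sum_equiv (Equiv.neg (ZMod N)) _ _ fun k => ?_
    -- The involution reverses the two factors; the crossing phase restores their order and leaves
    -- `-(i * (i - j))`, free of `k`.
    rw [star_mul, h.star_eq, h'.star_eq, smul_mul_smul_comm, hc, smul_smul, ← rootPow_add hω,
      ← rootPow_add hω, Equiv.neg_apply]
    congr 2
    ring
  col_add i j k := by
    -- Both sides are brought to one normal form. Here `q'` is expanded by its column relation, with
    -- `c = a + b`.
    have hl : ∑ c, q k c * q' c (i + j) =
        ∑ b, ∑ a, rootPow ω (-(b * (i - a))) • (q k (a + b) * (q' a i * q' b j)) := by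
      simp only [h'.col_add, Finset.mul_sum]
      rw [Finset.sum_comm]
      refine Finset.sum_congr rfl fun b _ => ?_
      refine Fintype.sum_equiv (Equiv.subRight b) _ _ fun c => ?_
      rw [Equiv.subRight_apply, sub_add_cancel, mul_smul_comm]
      congr 3
      ring
    have hr : ∑ l, rootPow ω (-(l * (i - k + l))) •
        ((∑ a, q (k - l) a * q' a i) * ∑ b, q l b * q' b j) =
        ∑ b, ∑ a, rootPow ω (-(b * (i - a))) • (q k (a + b) * (q' a i * q' b j)) := by
      simp only [Finset.sum_mul_sum]
      simp only [h.col_add, Finset.smul_sum, Finset.sum_mul]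
      rw [Finset.sum_congr rfl fun l _ => Finset.sum_comm, Finset.sum_comm]
      refine Finset.sum_congr rfl fun b _ => ?_
      rw [Finset.sum_comm]
      refine Finset.sum_congr rfl fun a _ => Finset.sum_congr rfl fun l _ => ?_
      -- On this side `q` is expanded. Moving `q' a i` past `q l b` contributes `-((i - a) * (b -
      -- l))`, which turns `-(l * (i - k + l))` into the phase `-(l * (a - k + l))` of the column
      -- relation for `q k (a + b)` plus `-(b * (i - a))`.
      rw [mul_assoc (q (k - l) a), ← mul_assoc (q' a i), hc, smul_mul_assoc, mul_smul_comm,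
        smul_mul_assoc, smul_smul, smul_smul, ← rootPow_add hω, ← rootPow_add hω]
      simp only [mul_assoc]
      congr 2
      ring
    exact hl.trans hr.symm
  row_add i j k := by
    -- The roles are exchanged for rows: `q` is expanded here and `q'` on the other side. The
    -- crossing phase changes `-(i * (l - j))` into `-(b * (l - a))`, needed for `q' (b + a) k`,
    -- plus `-(i * (a - j))`.
    have hl : ∑ c, q (i + j) c * q' c k =
        ∑ a, ∑ b, rootPow ω (-(i * (a - j))) • (q j a * q i b * q' (b + a) k) := by
      simp only [h.row_add, Finset.sum_mul]
      rw [Finset.sum_comm]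
      refine Finset.sum_congr rfl fun a _ => ?_
      refine Fintype.sum_equiv (Equiv.subRight a) _ _ fun c => ?_
      rw [Equiv.subRight_apply, sub_add_cancel, smul_mul_assoc]
    have hr : ∑ l, rootPow ω (-(i * (l - j))) •
        ((∑ a, q j a * q' a l) * ∑ b, q i b * q' b (k - l)) =
        ∑ a, ∑ b, rootPow ω (-(i * (a - j))) • (q j a * q i b * q' (b + a) k) := by
      simp only [Finset.sum_mul_sum]
      simp only [h'.row_add, Finset.smul_sum, Finset.mul_sum]
      rw [Finset.sum_comm]
      refine Finset.sum_congr rfl fun a _ => ?_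
      rw [Finset.sum_comm]
      refine Finset.sum_congr rfl fun b _ => Finset.sum_congr rfl fun l _ => ?_
      rw [mul_assoc (q j a), ← mul_assoc (q' a l), hc, smul_mul_assoc, mul_smul_comm,
        mul_smul_comm, smul_smul, smul_smul, ← rootPow_add hω, ← rootPow_add hω]
      simp only [mul_assoc]
      congr 2
      ring
    exact hl.trans hr.symm

/-- The rows of a matrix satisfying the relations are orthonormal. -/
theorem PermRelations.row_mul_star (hω : IsPrimitiveRoot ω N) (h : PermRelations ω Eq q)
    (k m : ZMod N) : ∑ l, q m l * star (q k l) = if m = k then 1 else 0 := by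
  -- With last index `0` the left side is a Kronecker delta, and each `q (-k) (-l)` on the right is
  -- `star (q k l)` up to a phase.
  have h1 := h.row_add (-k) m 0
  have h2 : ∑ l, q m l * star (q k l) = rootPow ω (-(k * (k - m))) • q (-k + m) 0 := by
    rw [h1, Finset.smul_sum]
    refine Finset.sum_congr rfl fun l _ => ?_
    rw [h.star_eq, mul_smul_comm, smul_smul, ← rootPow_add hω, zero_sub]
    congr 2
    ring
  rw [h2, h.zero_right]
  by_cases hm : m = k
  · subst hm
    simp [rootPow_zero]
  · rw [if_neg hm, if_neg (fun e => hm (by linear_combination e)), smul_zero]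

/-- The twisted orthogonality of the columns. -/
theorem PermRelations.column_mul (h : PermRelations ω Eq q) (k l : ZMod N) :
    ∑ i, rootPow ω (i * k - i * i) • (q i k * q (-i) (-l)) = if k = l then 1 else 0 := by
  -- Row index `0` makes the left side a Kronecker delta; the sum is then reindexed by negation.
  have h1 := h.col_add k (-l) 0
  rw [h.zero_left] at h1
  refine Eq.trans ?_ (h1.symm.trans (if_congr (by rw [← sub_eq_add_neg, sub_eq_zero]) rfl rfl))
  refine Fintype.sum_equiv (Equiv.neg (ZMod N)) _ _ fun i => ?_
  rw [Equiv.neg_apply, zero_sub, neg_neg]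
  congr 2
  ring

/-- Orthonormality of the rows of `q'` cancels it from the right. This recovers the first leg from
products of `Δ` with the second. -/
theorem PermRelations.sum_braidedMul_mul_star (hω : IsPrimitiveRoot ω N)
    (h' : PermRelations ω Eq q') (i k : ZMod N) :
    ∑ j, (∑ m, q i m * q' m j) * star (q' k j) = q i k := by
  simp only [Finset.sum_mul, mul_assoc]
  rw [Finset.sum_comm]
  simp only [← Finset.mul_sum, h'.row_mul_star hω]
  simp

/-- Once `q (-i) (-l)` has crossed `q' k j`, the twisted column orthogonality collapses the sum to
`k = l`. This recovers the second leg from products of `Δ` with the first. -/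
theorem PermRelations.sum_braidedMul_mul (hω : IsPrimitiveRoot ω N) (h : PermRelations ω Eq q)
    (hc : ∀ i j k l, q' k l * q i j = rootPow ω (-((l - k) * (j - i))) • (q i j * q' k l))
    (l j : ZMod N) :
    ∑ i, rootPow ω (l * l - l * j + i * j - i * i) • ((∑ k, q i k * q' k j) * q (-i) (-l)) =
      q' l j := by
  have h1 : ∀ k, ∑ i, rootPow ω (l * l - l * j + i * j - i * i) •
      (q i k * q' k j * q (-i) (-l)) = if k = l then q' l j else 0 := fun k => by
    -- The chosen weight cancels the `j`-dependent part of the crossing phase. What remains is the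
    -- weight `i * k - i * i` of `column_mul` and `l * l - k * l`, which vanishes at `k = l`.
    have h2 : ∀ i, rootPow ω (l * l - l * j + i * j - i * i) • (q i k * q' k j * q (-i) (-l)) =
        rootPow ω (l * l - k * l) • ((rootPow ω (i * k - i * i) • (q i k * q (-i) (-l))) * q' k j) :=
      fun i => by
        rw [mul_assoc, hc, mul_smul_comm, smul_mul_assoc, smul_smul, smul_smul, ← rootPow_add hω,
          ← rootPow_add hω, mul_assoc]
        congr 2
        ring
    rw [Finset.sum_congr rfl fun i _ => h2 i, ← Finset.smul_sum, ← Finset.sum_mul, h.column_mul]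
    by_cases hk : k = l
    · subst hk
      simp [rootPow_zero]
    · simp [hk]
  simp only [Finset.sum_mul, Finset.smul_sum]
  rw [Finset.sum_comm, Finset.sum_congr rfl fun k _ => h1 k]
  simp

end Relations

/-! ### From generators to bisimplifiability -/

section Simplifiable

variable {N : ℕ} [NeZero N] {X Y Z B : Type*} [CStarAlgebra X] [CStarAlgebra Y]
  [CStarAlgebra Z] [CStarAlgebra B]

/-- If the images under `u` of generators factor through products `Δ a * v y` with `v y` commuting
with the range of `u` up to the coaction, then the span of the products `Δ a * v y` contains all
products `u x * v y`. -/
theorem closedSpan_mul_eq_top_of_generators {α : Coaction N X} (h0 : ∀ x, α.ρ x 0 = x)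
    (u : X →⋆ₐ[ℂ] B) (v : Y →⋆ₐ[ℂ] B) (Δ : Z →⋆ₐ[ℂ] B) {S : Set X} (hS : generated S = ⊤)
    (hstar : ∀ x ∈ S, star x ∈ S) (hρ : ∀ x ∈ S, ∀ t, ∃ c : ℂ, α.ρ x t = c • x)
    (hfac : ∀ x ∈ S, u x ∈ Submodule.span ℂ
      {T | ∃ a y n, T = Δ a * v y ∧ ∀ z, v y * u z = u (α.ρ z n) * v y})
    (huv : closedSpan {T | ∃ x y, T = u x * v y} = ⊤) :
    closedSpan {T | ∃ x y, T = Δ x * v y} = ⊤ := by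
  set M := closedSpan {T | ∃ x y, T = Δ x * v y} with hM
  have hΔM : ∀ a, ∀ m ∈ M, Δ a * m ∈ M := fun a m hm => by
    refine mul_mem_closedSpan ?_ hm
    rintro _ ⟨x, y, rfl⟩
    rw [← mul_assoc, ← map_mul]
    exact subset_closedSpan _ ⟨_, _, rfl⟩
  let φ : ZMod N → Y → X →ₗ[ℂ] B := fun t y =>
    (LinearMap.mulRight ℂ (v y)).comp (u.comp (α.act t)).toAlgHom.toLinearMap
  have hφ : ∀ t y x, φ t y x = u (α.ρ x t) * v y := fun _ _ _ => rfl
  -- The condition is imposed on all translates `ρ_t(x)` because moving a factor `v y'` across `u m`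
  -- replaces `m` by a translate.
  let G : Submodule ℂ X := ⨅ t, ⨅ y, M.comap (φ t y)
  have hG : ∀ x, x ∈ G ↔ ∀ t y, u (α.ρ x t) * v y ∈ M := fun x => by
    simp only [G, Submodule.mem_iInf, Submodule.mem_comap, hφ]
  have hGc : IsClosed (G : Set X) := by
    have : (G : Set X) = ⋂ t, ⋂ y, (fun x => u (α.ρ x t) * v y) ⁻¹' (M : Set B) := by
      ext x
      simp only [Set.mem_iInter, Set.mem_preimage, SetLike.mem_coe, hG]
    rw [this]
    refine isClosed_iInter fun t => isClosed_iInter fun y => (isClosed_closedSpan _).preimage ?_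
    exact (continuous_starAlgHom (u.comp (α.act t))).mul continuous_const
  have hG1 : (1 : X) ∈ G := (hG 1).2 fun t y => by
    have : α.ρ 1 t = 1 := map_one (α.act t)
    rw [this, map_one, one_mul]
    exact subset_closedSpan _ ⟨1, y, by rw [map_one, one_mul]⟩
  have hGm : ∀ x ∈ S, ∀ m ∈ G, x * m ∈ G := fun x hx m hm => (hG _).2 fun t y => by
    obtain ⟨c, hcx⟩ := hρ x hx t
    -- Generators are eigenvectors of the action, so only `m` is really translated.
    have h1 : α.ρ (x * m) t = c • (x * α.ρ m t) := by
      rw [← smul_mul_assoc, ← hcx]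
      exact map_mul (α.act t) x m
    rw [h1, map_smul, smul_mul_assoc, map_mul, mul_assoc]
    refine M.smul_mem c ?_
    have h2 : Submodule.span ℂ {T | ∃ a y n, T = Δ a * v y ∧ ∀ z, v y * u z = u (α.ρ z n) * v y} ≤
        M.comap (LinearMap.mulRight ℂ (u (α.ρ m t) * v y)) := by
      refine Submodule.span_le.2 ?_
      rintro _ ⟨a, y', n, rfl, hcomm⟩
      change Δ a * v y' * (u (α.ρ m t) * v y) ∈ M
      -- `Δ a * v y' * u m * v y` becomes `Δ a * u (ρ_n(m)) * v (y' * y)`; the last two factors lie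
      -- in `M` by the assumption on `m`, and `M` absorbs `Δ a` from the left.
      rw [mul_assoc, ← mul_assoc (v y'), hcomm, α.coassoc, mul_assoc, ← map_mul]
      exact hΔM a _ ((hG m).1 hm _ _)
    exact h2 (hfac x hx)
  have hGt : G = ⊤ := submodule_eq_top_of_generated hS hGc hG1 fun x hx m hm =>
    ⟨hGm x hx m hm, hGm _ (hstar x hx) m hm⟩
  rw [eq_top_iff, ← huv]
  refine closedSpan_le (isClosed_closedSpan _) ?_
  rintro _ ⟨x, y, rfl⟩
  have := (hG x).1 (hGt ▸ Submodule.mem_top) 0 y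
  rwa [h0] at this

end Simplifiable

/-! ### The generating set of the universal algebra -/

section PermGenerators

variable {N : ℕ} [NeZero N] {ω : ℂ}

theorem permCoaction_zero (hω : IsPrimitiveRoot ω N) (x : PermAlg N ω) :
    (permCoaction hω).ρ x 0 = x := by
  have : (permCoaction hω).act 0 = StarAlgHom.id ℂ (PermAlg N ω) :=
    permAlg_hom_ext fun i j => by
      rw [Coaction.act_apply, permCoaction_gen, zero_mul, rootPow_zero, one_smul]
      rfl
  exact congrArg (fun f : PermAlg N ω →⋆ₐ[ℂ] PermAlg N ω => f x) this

theorem isHomogeneous_permGen (hω : IsPrimitiveRoot ω N) (i j : ZMod N) :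
    IsHomogeneous ω (permCoaction hω) (j - i) (permGen N ω i j) :=
  fun t => permCoaction_gen hω i j t

/-- The multiples of the generators. -/
def permGenMultiples (N : ℕ) [NeZero N] (ω : ℂ) : Set (PermAlg N ω) :=
  {x | ∃ (c : ℂ) (i j : ZMod N), x = c • permGen N ω i j}

/-- The star relation sends a generator to a phase times another generator. Scalars are admitted in
the generating set so that it is closed under the involution. -/
theorem star_mem_permGenMultiples (x : PermAlg N ω) (hx : x ∈ permGenMultiples N ω) :
    star x ∈ permGenMultiples N ω := by
  obtain ⟨c, i, j, rfl⟩ := hx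
  refine ⟨star c * rootPow ω (-(i * (i - j))), -i, -j, ?_⟩
  rw [star_smul, permGen_relations.star_eq, smul_smul]

theorem permGen_mem_permGenMultiples (i j : ZMod N) :
    permGen N ω i j ∈ permGenMultiples N ω := ⟨1, i, j, (one_smul _ _).symm⟩

theorem generated_permGenMultiples : generated (permGenMultiples N ω) = ⊤ := by
  refine eq_top_iff.2 fun x _ => ?_
  refine (permSeminorm N ω).compl_induction
    (C := fun x => (x : PermAlg N ω) ∈ generated (permGenMultiples N ω)) x
    (isClosed_generated _) fun a => ?_
  change ((permSeminorm N ω).coeHom a : PermAlg N ω) ∈ generated (permGenMultiples N ω)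
  induction a using FreeStarAlgebra.induction with
  | h1 c =>
    rw [AlgHomClass.commutes]
    exact (generated (permGenMultiples N ω)).algebraMap_mem c
  | h2 a =>
    obtain ⟨⟨i, j⟩, e⟩ := a
    have h := subset_generated _ (permGen_mem_permGenMultiples (ω := ω) i j)
    cases e
    · exact h
    · rw [← FreeStarAlgebra.star_gen, map_star]
      change star (permGen N ω i j) ∈ generated (permGenMultiples N ω)
      exact star_mem h
  | h3 x y hx hy =>
    rw [map_mul]
    exact mul_mem hx hy
  | h4 x y hx hy =>
    rw [map_add]
    exact add_mem hx hy

theorem permCoaction_of_mem_permGenMultiples (hω : IsPrimitiveRoot ω N) (x : PermAlg N ω)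
    (hx : x ∈ permGenMultiples N ω) (t : ZMod N) : ∃ c : ℂ, (permCoaction hω).ρ x t = c • x := by
  obtain ⟨c, i, j, rfl⟩ := hx
  refine ⟨rootPow ω (t * (j - i)), ?_⟩
  rw [← Coaction.act_apply, map_smul, Coaction.act_apply, permCoaction_gen, smul_comm]

end PermGenerators

/-! ### The comultiplication and its properties -/

section Comultiplication

theorem map_sum_mul {ι B C : Type*} [Fintype ι] [CStarAlgebra B] [CStarAlgebra C]
    (f : B →⋆ₐ[ℂ] C) (x y : ι → B) : f (∑ k, x k * y k) = ∑ k, f (x k) * f (y k) := by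
  rw [map_sum]
  exact Finset.sum_congr rfl fun k _ => map_mul f _ _

/-- Associativity of the matrix product, to which coassociativity reduces once the embeddings are
identified. -/
theorem sum_sum_mul_mul {ι κ B : Type*} [Fintype ι] [Fintype κ] [Ring B] (x : ι → B)
    (y : ι → κ → B) (z : κ → B) :
    ∑ k, (∑ m, x m * y m k) * z k = ∑ m, x m * ∑ k, y m k * z k := by
  simp only [Finset.sum_mul, Finset.mul_sum, mul_assoc]
  exact Finset.sum_comm

variable {N : ℕ} [NeZero N] {ω : ℂ} (hω : IsPrimitiveRoot ω N) {L : Type*}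
  [NormedAddCommGroup L] [InnerProductSpace ℂ L] [CompleteSpace L]
  (r : CovariantRep (permCoaction hω) L)

/-- The second generator has degree `l - k`, so crossing applies `ρ_{-(l-k)}` to the first, which is
an eigenvector of degree `j - i`. -/
theorem j₂_permGen_mul_j₁_permGen (i j k l : ZMod N) :
    j₂ hω r r (permGen N ω k l) * j₁ hω r r (permGen N ω i j) =
      rootPow ω (-((l - k) * (j - i))) •
        (j₁ hω r r (permGen N ω i j) * j₂ hω r r (permGen N ω k l)) := by
  rw [j₂_mul_j₁ hω r r (isHomogeneous_permGen hω k l), permCoaction_gen, map_smul, smul_mul_assoc,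
    neg_mul]

theorem permRelations_map {B : Type*} [CStarAlgebra B] (f : PermAlg N ω →⋆ₐ[ℂ] B) :
    PermRelations ω Eq (fun i j => f (permGen N ω i j)) :=
  permGen_relations.map f fun _ _ h => congrArg f h

/-- The comultiplication. -/
noncomputable def comul : PermAlg N ω →⋆ₐ[ℂ] Braided hω r r :=
  permLift _ (PermRelations.braidedMul hω (permRelations_map (j₁ hω r r))
    (permRelations_map (j₂ hω r r)) (j₂_permGen_mul_j₁_permGen hω r))

theorem comul_permGen (i j : ZMod N) : comul hω r (permGen N ω i j) =
    ∑ k, j₁ hω r r (permGen N ω i k) * j₂ hω r r (permGen N ω k j) :=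
  permLift_gen _ _ i j

theorem isHomogeneous_star_permGen (i j : ZMod N) :
    IsHomogeneous ω (permCoaction hω) (i - j) (star (permGen N ω i j)) := fun t => by
  have h : (permCoaction hω).ρ (star (permGen N ω i j)) t =
      star ((permCoaction hω).ρ (permGen N ω i j) t) := map_star ((permCoaction hω).act t) _
  rw [h, permCoaction_gen, star_smul, star_rootPow hω]
  congr 2
  ring

/-- The degrees `k - i` and `j - k` of the two factors add up to `j - i` for every `k`. -/
theorem comul_equivariant :
    IsEquivariant (permCoaction hω) (braidedCoaction hω r r) (comul hω r) := by
  intro x t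
  have h : ((braidedCoaction hω r r).act t).comp (comul hω r) =
      (comul hω r).comp ((permCoaction hω).act t) := permAlg_hom_ext fun i j => by
    rw [StarAlgHom.comp_apply, StarAlgHom.comp_apply, Coaction.act_apply (permCoaction hω),
      permCoaction_gen, map_smul, comul_permGen, map_sum_mul, Finset.smul_sum]
    refine Finset.sum_congr rfl fun k _ => ?_
    rw [Coaction.act_apply, Coaction.act_apply, j₁_equivariant, j₂_equivariant,
      permCoaction_gen, permCoaction_gen, map_smul, map_smul, smul_mul_smul_comm, ← rootPow_add hω]
    congr 2
    ring
  exact congrArg (fun f : PermAlg N ω →⋆ₐ[ℂ] Braided hω r r => f x) h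

theorem comul_coassociative : IsCoassociative hω r (comul hω r) := by
  obtain ⟨ΔI, hΔI⟩ := exists_isBraidedMap_left hω r r (r.braided hω r) (comul_equivariant hω r)
  obtain ⟨IΔ, hIΔ⟩ := exists_isBraidedMap_right hω r r (r.braided hω r) (comul_equivariant hω r)
  obtain ⟨a, ha⟩ := exists_associator hω r r r
  have ha₁ := fun x => ha (Sum.inl (Sum.inl x))
  have ha₂ := fun x => ha (Sum.inl (Sum.inr x))
  have ha₃ := fun x => ha (Sum.inr x)
  refine ⟨ΔI, IΔ, a, hΔI, hIΔ, ⟨ha₁, ha₂, ha₃⟩, fun x => ?_⟩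
  let b : Braided hω (r.braided hω r) r →⋆ₐ[ℂ] Braided hω r (r.braided hω r) := a
  -- On `q i j` both sides are the sum of `q i m`, `q m k`, `q k j` in the three legs of the right
  -- bracketing, grouped differently.
  have h : b.comp (ΔI.comp (comul hω r)) = IΔ.comp (comul hω r) := permAlg_hom_ext fun i j => by
    have h₁ : ∀ k, ΔI (j₁ hω r r (permGen N ω i k)) =
        ∑ m, j₁ hω (r.braided hω r) r (j₁ hω r r (permGen N ω i m)) *
          j₁ hω (r.braided hω r) r (j₂ hω r r (permGen N ω m k)) := fun k => by
      rw [hΔI.map_j₁, comul_permGen, map_sum_mul]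
    have h₂ : ∀ k, IΔ (j₂ hω r r (permGen N ω k j)) =
        ∑ m, j₂ hω r (r.braided hω r) (j₁ hω r r (permGen N ω k m)) *
          j₂ hω r (r.braided hω r) (j₂ hω r r (permGen N ω m j)) := fun k => by
      rw [hIΔ.map_j₂, comul_permGen, map_sum_mul]
    have h₃ : ∀ k, b (ΔI (j₁ hω r r (permGen N ω i k))) =
        ∑ m, j₁ hω r (r.braided hω r) (permGen N ω i m) *
          j₂ hω r (r.braided hω r) (j₁ hω r r (permGen N ω m k)) := fun k => by
      rw [h₁, map_sum_mul]
      exact Finset.sum_congr rfl fun m _ => congrArg₂ _ (ha₁ _) (ha₂ _)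
    have h₄ : ∀ k, b (ΔI (j₂ hω r r (permGen N ω k j))) =
        j₂ hω r (r.braided hω r) (j₂ hω r r (permGen N ω k j)) := fun k =>
      (congrArg b (hΔI.map_j₂ _)).trans (ha₃ _)
    have h₅ : ∀ k, IΔ (j₁ hω r r (permGen N ω i k)) =
        j₁ hω r (r.braided hω r) (permGen N ω i k) := fun k => hIΔ.map_j₁ _
    rw [StarAlgHom.comp_apply, StarAlgHom.comp_apply, StarAlgHom.comp_apply, comul_permGen,
      map_sum_mul, map_sum_mul, map_sum_mul, Finset.sum_congr rfl fun k _ => congrArg₂ _ (h₃ k) (h₄ k),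
      Finset.sum_congr rfl fun k _ => congrArg₂ _ (h₅ k) (h₂ k)]
    exact sum_sum_mul_mul _ _ _
  exact congrArg (fun f : PermAlg N ω →⋆ₐ[ℂ] Braided hω r (r.braided hω r) => f x) h

theorem closedSpan_comul_mul_j₂ :
    closedSpan {T | ∃ x y, T = comul hω r x * j₂ hω r r y} = ⊤ := by
  refine closedSpan_mul_eq_top_of_generators (permCoaction_zero hω) (j₁ hω r r) (j₂ hω r r)
    (comul hω r) generated_permGenMultiples star_mem_permGenMultiples
    (permCoaction_of_mem_permGenMultiples hω) ?_
    (closedSpan_j₁_mul_j₂ hω r r (permCoaction_zero hω))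
  rintro _ ⟨c, i, k, rfl⟩
  -- The generator of the first leg is written through `Δ (q i j)` and `star (q k j)`. The latter
  -- has degree `k - j`, hence commutes past `j₁` with the twist `-(k - j)`.
  rw [map_smul, ← PermRelations.sum_braidedMul_mul_star (q := fun i j => j₁ hω r r (permGen N ω i j))
    hω (permRelations_map (j₂ hω r r)) i k]
  refine Submodule.smul_mem _ c (Submodule.sum_mem _ fun j _ => Submodule.subset_span
    ⟨permGen N ω i j, star (permGen N ω k j), -(k - j), ?_,
      j₂_mul_j₁ hω r r (isHomogeneous_star_permGen hω k j)⟩)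
  rw [comul_permGen, map_star]

theorem closedSpan_comul_mul_j₁ :
    closedSpan {T | ∃ x y, T = comul hω r x * j₁ hω r r y} = ⊤ := by
  refine closedSpan_mul_eq_top_of_generators (permCoaction_zero hω) (j₂ hω r r) (j₁ hω r r)
    (comul hω r) generated_permGenMultiples star_mem_permGenMultiples
    (permCoaction_of_mem_permGenMultiples hω) ?_
    (closedSpan_j₂_mul_j₁ hω r r (permCoaction_zero hω))
  rintro _ ⟨c, l, j, rfl⟩
  -- With the legs exchanged, the factor crossing `j₂` is `q (-i) (-l)`; its degree is the twist.
  rw [map_smul, ← PermRelations.sum_braidedMul_mul hω (permRelations_map (j₁ hω r r))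
    (j₂_permGen_mul_j₁_permGen hω r) l j]
  refine Submodule.smul_mem _ c (Submodule.sum_mem _ fun i _ => Submodule.smul_mem _ _
    (Submodule.subset_span ⟨permGen N ω i j, permGen N ω (-i) (-l), _, ?_,
      j₁_mul_j₂ hω r r (isHomogeneous_permGen hω (-i) (-l))⟩))
  rw [comul_permGen]

end Comultiplication

end Anyonic

theorem proposition2 (N : ℕ) [NeZero N] (ω : ℂ) (hω : IsPrimitiveRoot ω N) :
    (∃ (L : Type) (_ : NormedAddCommGroup L) (_ : InnerProductSpace ℂ L) (_ : CompleteSpace L),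
      Nonempty (Anyonic.CovariantRep (Anyonic.permCoaction hω) L)) ∧
    ∀ (L : Type*) [NormedAddCommGroup L] [InnerProductSpace ℂ L] [CompleteSpace L]
      (r : Anyonic.CovariantRep (Anyonic.permCoaction hω) L),
      ∃ Δ : Anyonic.PermAlg N ω →⋆ₐ[ℂ] Anyonic.Braided hω r r,
        (∀ i j : ZMod N, Δ (Anyonic.permGen N ω i j) =
          ∑ k : ZMod N, Anyonic.j₁ hω r r (Anyonic.permGen N ω i k) *
            Anyonic.j₂ hω r r (Anyonic.permGen N ω k j)) ∧
        (∀ Δ' : Anyonic.PermAlg N ω →⋆ₐ[ℂ] Anyonic.Braided hω r r,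
          (∀ i j : ZMod N, Δ' (Anyonic.permGen N ω i j) =
            ∑ k : ZMod N, Anyonic.j₁ hω r r (Anyonic.permGen N ω i k) *
              Anyonic.j₂ hω r r (Anyonic.permGen N ω k j)) → Δ' = Δ) ∧
        Anyonic.IsAnyonicCompactQuantumGroup hω r Δ := by
  refine ⟨Anyonic.exists_covariantRep _ (Anyonic.permCoaction_zero hω), fun L _ _ _ r => ?_⟩
  exact ⟨Anyonic.comul hω r, Anyonic.comul_permGen hω r,
    fun Δ' h => Anyonic.permAlg_hom_ext fun i j =>
      (h i j).trans (Anyonic.comul_permGen hω r i j).symm,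
    Anyonic.comul_equivariant hω r, Anyonic.comul_coassociative hω r,
    Anyonic.closedSpan_comul_mul_j₂ hω r, Anyonic.closedSpan_comul_mul_j₁ hω r⟩
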